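/- **Setting.** Let $\mathcal G=(\mathcal V,\mathcal E)$ be a finite connected discrete graph with $E$ edges. Put $\mathscr L_{\mathcal G}=\{(l_e)_{e\in\mathcal E}\in\mathbb R^{E} : \sum_e l_e=1,\ l_e>0 \text{ for all } e\}$ and let $\overline{\mathscr L_{\mathcal G}}$ be its closure in $\mathbb R^{E}$. For $\underline l\in\overline{\mathscr L_{\mathcal G}}$ let $\Gamma(\mathcal G;\underline l)$ be the metric graph in which each edge $e$ with $l_e>0$ is identified with the interval $[0,l_e]$, while each edge $e$ with $l_e=0$ is removed and its two end vertices are identified. On a compact connected metric graph $\Gamma$ consider the Neumann Laplacian $f\mapsto -f''$ on each edge, on the functions which are $H^2$ on each edge, continuous at the vertices, and have vanishing sum of the outgoing derivatives at each vertex. Let $0=\lambda_0<\lambda_1\le\lambda_2\le\dots$ be its eigenvalues, counted with multiplicity; the spectral gap of $\Gamma$ is $k_1(\Gamma)=\sqrt{\lambda_1}$. The graph $\Gamma(\mathcal G;\underline l^*)$ is a *supremizer* of $\mathcal G$ if $\underline l^*\in\overline{\mathscr L_{\mathcal G}}$ and $k_1(\Gamma(\mathcal G;\underline l^*))\ge k_1(\Gamma(\mathcal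 G;\underline l))$ for all $\underline l\in\overline{\mathscr L_{\mathcal G}}$. It is a *maximizer* if the same holds with $\mathscr L_{\mathcal G}$ in place of $\overline{\mathscr L_{\mathcal G}}$ in both places. Metric graphs are regarded as the same when they are isometric for the path distance (so vertices of degree two are immaterial). The *equilateral star* with $m$ edges is the metric graph of $m$ edges of length $1/m$ which join a central vertex to $m$ further vertices. A star graph is a discrete graph whose edges join one central vertex to each of the other vertices (a single edge is included). **Theorem.** Let $\mathcal G$ be a tree graph with $E_l\ge 2$ leaves (vertices of degree one). Then the unique supremizer of $\mathcal G$ is the equilateral star with $E_l$ edges, whose spectral gap is $\frac{\pi}{2}E_l$. That is, $\mathcal G$ has a supremizer; for $\underline l\in\overline{\mathscr L_{\mathcal G}}$, the graph $\Gamma(\mathcal G;\underline l)$ is a supremizer if and only if it is isometric to the equilateral star with $E_l$ edges; and the spectral gap of the equilateral star with $E_l$ edges, and of every supremizer, is $\frac{\pi}{2}E_l$. In particular, this supremizer is a maximizer (that is, some $\underline l$ gives both a supremizer and a maximizer) if and only if $\mathcal G$ is a star graph up to vertices of degree two, that is, if and only if $\mathcal G$ has at most one vertex of degree at least three. This holds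 for every star graph. If $\mathcal G$ has no vertices of degree two, then there is exactly one $\underline l\in\overline{\mathscr L_{\mathcal G}}$ for which $\Gamma(\mathcal G;\underline l)$ is a supremizer, and the supremizer is a maximizer if and only if $\mathcal G$ is a star graph. -/

import Mathlib

universe u

/-- The set of all length vectors of total length one with positive entries on the edges of a
finite discrete graph. -/
def lengthSpace {V : Type*} (G : SimpleGraph V) [Fintype G.edgeSet] : Set (G.edgeSet → ℝ) :=
  {l | ∑ e, l e = 1 ∧ ∀ e, 0 < l e}

/-- A compact metric graph: a finite multigraph (loops and parallel edges are allowed), each edge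
`e` of which is identified with the interval `[0, len e]`, of positive length, running from the
vertex `src e` to the vertex `tgt e`. -/
structure MetricGraph where
  Vert : Type u
  Edge : Type u
  [finVert : Finite Vert]
  [finEdge : Finite Edge]
  src : Edge → Vert
  tgt : Edge → Vert
  len : Edge → ℝ
  len_pos : ∀ e, 0 < len e

namespace MetricGraph

attribute [instance] MetricGraph.finVert MetricGraph.finEdge

noncomputable instance (Γ : MetricGraph) : Fintype Γ.Edge := Fintype.ofFinite _

/-- The endpoint `0` of each edge is glued to the vertex `src e`, and the endpoint `len e` to the
vertex `tgt e`. -/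
inductive Glue (Γ : MetricGraph) :
    Γ.Vert ⊕ (Σ e : Γ.Edge, Set.Icc (0 : ℝ) (Γ.len e)) →
    Γ.Vert ⊕ (Σ e : Γ.Edge, Set.Icc (0 : ℝ) (Γ.len e)) → Prop
  | src (e : Γ.Edge) :
      Glue Γ (Sum.inl (Γ.src e)) (Sum.inr ⟨e, 0, Set.left_mem_Icc.2 (Γ.len_pos e).le⟩)
  | tgt (e : Γ.Edge) :
      Glue Γ (Sum.inl (Γ.tgt e)) (Sum.inr ⟨e, Γ.len e, Set.right_mem_Icc.2 (Γ.len_pos e).le⟩)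

/-- The points of the metric graph: the edges, as closed intervals, glued along the vertices. -/
def Point (Γ : MetricGraph) : Type _ := Quot Γ.Glue

/-- The point of the edge `e` with coordinate `x ∈ [0, len e]` (a real number outside of this
interval is first replaced by the nearest endpoint). -/
noncomputable def pt (Γ : MetricGraph) (e : Γ.Edge) (x : ℝ) : Γ.Point :=
  Quot.mk _ (Sum.inr ⟨e, Set.projIcc 0 (Γ.len e) (Γ.len_pos e).le x⟩)

/-- `Γ.Path p q r` says that there is a path of length `r` from `p` to `q`, made of finitely many
segments, each of which runs inside one edge. -/
inductive Path (Γ : MetricGraph) : Γ.Point → Γ.Point → ℝ → Prop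
  | nil (p : Γ.Point) : Path Γ p p 0
  | step {p : Γ.Point} {r : ℝ} (e : Γ.Edge) (s t : ℝ)
      (hs : s ∈ Set.Icc 0 (Γ.len e)) (ht : t ∈ Set.Icc 0 (Γ.len e)) :
      Path Γ p (Γ.pt e s) r → Path Γ p (Γ.pt e t) (r + |s - t|)

/-- The path distance of a connected metric graph. -/
noncomputable def dist (Γ : MetricGraph) (p q : Γ.Point) : ℝ := sInf {r | Γ.Path p q r}

/-- Two connected metric graphs are isometric. In particular vertices of degree two, which are
invisible in the metric space, do not matter. -/
def Isometric (Γ Γ' : MetricGraph) : Prop :=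
  ∃ φ : Γ.Point ≃ Γ'.Point, ∀ p q, Γ'.dist (φ p) (φ q) = Γ.dist p q

open scoped Classical in
/-- `Γ.IsNeumannLaplacian f h` says that the function `f` on the metric graph belongs to the domain
of the Neumann Laplacian `H`, and that `H f = h` almost everywhere. That is, on each edge `f` is of
class `H²`: it is an antiderivative of some `f'`, which is in turn an antiderivative of the
square-integrable function `f'' = -h`; and at each vertex the sum of the outgoing derivatives
vanishes. (Continuity at the vertices is automatic, as `f` is a function on the glued space and is
continuous on each closed edge.) -/
def IsNeumannLaplacian (Γ : MetricGraph) (f h : Γ.Point → ℝ) : Prop :=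
  ∃ f' : Γ.Edge → ℝ → ℝ,
    (∀ e, MeasureTheory.MemLp (fun x => h (Γ.pt e x)) 2
      (MeasureTheory.volume.restrict (Set.Icc 0 (Γ.len e)))) ∧
    (∀ e, ∀ x ∈ Set.Icc 0 (Γ.len e),
      f (Γ.pt e x) = f (Γ.pt e 0) + ∫ t in (0 : ℝ)..x, f' e t) ∧
    (∀ e, ∀ x ∈ Set.Icc 0 (Γ.len e),
      f' e x = f' e 0 + ∫ t in (0 : ℝ)..x, -h (Γ.pt e t)) ∧
    (∀ v, ∑ e, ((if Γ.src e = v then f' e 0 else 0) +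
      (if Γ.tgt e = v then -f' e (Γ.len e) else 0)) = 0)

/-- The `n`-th eigenvalue, `n = 0, 1, 2, …`, of the Neumann Laplacian, in ascending order and
counted with multiplicity: the least `c` such that there are `n + 1` linearly independent
eigenfunctions with eigenvalues at most `c`. -/
noncomputable def eigenvalue (Γ : MetricGraph) (n : ℕ) : ℝ :=
  sInf {c : ℝ | ∃ φ : Fin (n + 1) → Γ.Point → ℝ, LinearIndependent ℝ φ ∧
    ∀ i, ∃ μ ≤ c, Γ.IsNeumannLaplacian (φ i) (μ • φ i)}

/-- The spectral gap `k₁ = √λ₁`. -/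
noncomputable def spectralGap (Γ : MetricGraph) : ℝ := √(Γ.eigenvalue 1)

/-- The star with `m` edges, each of length `1 / m`. -/
noncomputable def equilateralStar (m : ℕ) : MetricGraph where
  Vert := Option (Fin m)
  Edge := Fin m
  src _ := none
  tgt i := some i
  len _ := 1 / m
  len_pos i := one_div_pos.2 (Nat.cast_pos.2 i.pos)

/-- The metric graph obtained from the finite simple graph `G` and the nonnegative edge lengths `l`:
each edge of length zero is removed and its two end vertices are identified. The orientation of the
edges, needed only to fix their coordinates, is chosen arbitrarily. -/
noncomputable def ofGraph {V : Type*} [Finite V] (G : SimpleGraph V) (l : G.edgeSet → ℝ) :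
    MetricGraph where
  Vert := Quot fun v w : V => ∃ h : G.Adj v w, l ⟨s(v, w), h⟩ = 0
  Edge := {e : G.edgeSet // 0 < l e}
  src e := Quot.mk _ (Quot.out e.1.1).1
  tgt e := Quot.mk _ (Quot.out e.1.1).2
  len e := l e.1
  len_pos e := e.2

end MetricGraph

/-- The metric graph with lengths `l` is a supremizer of `G`. -/
def IsSupremizer {V : Type*} [Finite V] (G : SimpleGraph V) [Fintype G.edgeSet]
    (l : G.edgeSet → ℝ) : Prop :=
  l ∈ closure (lengthSpace G) ∧ ∀ l' ∈ closure (lengthSpace G),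
    (MetricGraph.ofGraph G l').spectralGap ≤ (MetricGraph.ofGraph G l).spectralGap

/-- The metric graph with lengths `l` is a maximizer of `G`. -/
def IsMaximizer {V : Type*} [Finite V] (G : SimpleGraph V) [Fintype G.edgeSet]
    (l : G.edgeSet → ℝ) : Prop :=
  l ∈ lengthSpace G ∧ ∀ l' ∈ lengthSpace G,
    (MetricGraph.ofGraph G l').spectralGap ≤ (MetricGraph.ofGraph G l).spectralGap

/-- The number of leaves, that is, of vertices of degree one. -/
def numLeaves {V : Type*} [Fintype V] (G : SimpleGraph V) [DecidableRel G.Adj] : ℕ :=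
  (Finset.univ.filter fun v => G.degree v = 1).card

/-- `G` is a star graph: one central vertex is joined by an edge to each of the other vertices, and
there are no other edges. (A single edge is the star with one edge.) -/
def IsStarGraph {V : Type*} (G : SimpleGraph V) : Prop :=
  ∃ c, G = SimpleGraph.starGraph c

/-!
The spectral gap of the metric graphs of a tree with `m` leaves is governed by the distances of the
leaves.

*Averaging.* The distance of two vertices is the sum of the lengths of the edges that separate them.
An edge with `S` leaves on one side and `T = m - S` on the other separates `S T ≥ m - 1` pairs of
leaves, with equality only if it isolates a single leaf. As the lengths sum up to one, some two
leaves have a distance `D ≥ 2 / m`; and if no distance exceeds `2 / m`, then all of them are equal to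
`2 / m`, and every edge of positive length isolates a leaf (`IsTree.isEquidistant_of_le`). Call such
lengths equidistant.

*Upper bound.* The spectral gap is at most `π / D` if two vertices are joined by a geodesic of length
`D`. In terms of the values at the vertices, the eigenvalue equation for `k ^ 2` reads `A(k) u = 0`,
with symmetric matrices `A(k)` that depend continuously on `k` as long as `k` times each edge length
stays below `π`. With the position `x` along the geodesic, the quadratic form of `A(π / D)` is
nonpositive on the span of `cos (k x)` and `sin (k x)`, because on the geodesic the contributions of
the edges telescope; the form of `A(0)` has no two-dimensional nonpositive subspace. Hence some
`A(k)`, `0 < k ≤ π / D`, is singular (`exists_singular_of_nonpos_pair`), which gives an eigenfunction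
(`GeodFlow.exists_eigenfunction`). If some edge is as long as `D`, there are no other edges, and the
eigenfunction is a cosine.

*Equality.* For equidistant lengths, all edges off the geodesic between two leaves project to its
midpoint, so the metric graph looks like an equilateral star (`StarData`). Testing with functions of
the position alone, Green's formula shows that an eigenfunction with an eigenvalue below
`(π m / 2) ^ 2` is determined on each geodesic by its value at the leaf, that these values agree, and
finally that it is constant (`StarData.eq_const`). A point of such a graph is determined by its
distances to the leaves, and the occurring tuples of distances depend only on `m`, so any two such
graphs are isometric (`StarData.isometric`). Conversely, an isometry to the star bounds the distances
of the leaves by its diameter `2 / m`.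

*Combinatorics.* Thus the supremizers are the equidistant lengths. Splitting, for each leaf, the
length `1 / m` among the edges which isolate it gives equidistant lengths
(`IsTree.exists_isEquidistant`). All lengths can be positive if and only if every edge isolates a
leaf. On each side of an edge the numbers `2 - deg` sum up to one (`IsTree.sum_side`), so an edge
isolates a leaf if and only if one of its sides contains no vertex of degree at least three; this
holds for all edges if and only if there is at most one such vertex.
-/

universe v

/-! ### Points, functions and paths on a metric graph -/

namespace MetricGraph

variable (Γ : MetricGraph.{u})

/-- A vertex, as a point of the metric graph. -/
def vert (v : Γ.Vert) : Γ.Point := Quot.mk _ (Sum.inl v)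

lemma pt_zero (e : Γ.Edge) : Γ.pt e 0 = Γ.vert (Γ.src e) := by
  unfold pt vert
  rw [Set.projIcc_left]
  exact (Quot.sound (Glue.src e)).symm

lemma pt_len (e : Γ.Edge) : Γ.pt e (Γ.len e) = Γ.vert (Γ.tgt e) := by
  unfold pt vert
  rw [Set.projIcc_right]
  exact (Quot.sound (Glue.tgt e)).symm

lemma zero_mem (e : Γ.Edge) : (0 : ℝ) ∈ Set.Icc 0 (Γ.len e) := Set.left_mem_Icc.2 (Γ.len_pos e).le

lemma len_mem (e : Γ.Edge) : Γ.len e ∈ Set.Icc 0 (Γ.len e) :=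
  Set.right_mem_Icc.2 (Γ.len_pos e).le

variable {Γ}

lemma exists_pt_or_vert (p : Γ.Point) :
    (∃ v, p = Γ.vert v) ∨ ∃ e, ∃ y ∈ Set.Icc 0 (Γ.len e), p = Γ.pt e y := by
  induction p using Quot.ind with
  | mk a =>
    rcases a with v | ⟨e, y⟩
    · exact Or.inl ⟨v, rfl⟩
    · refine Or.inr ⟨e, y, y.2, ?_⟩
      unfold pt
      rw [Set.projIcc_val]

/-- The function on the metric graph with given values at the vertices and on the edges. -/
def liftFun (h : Γ.Vert → ℝ) (F : Γ.Edge → ℝ → ℝ) (h0 : ∀ e, F e 0 = h (Γ.src e))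
    (hl : ∀ e, F e (Γ.len e) = h (Γ.tgt e)) : Γ.Point → ℝ :=
  Quot.lift (fun a => Sum.elim h (fun q => F q.1 q.2) a) (by
    rintro _ _ (e | e)
    · exact (h0 e).symm
    · exact (hl e).symm)

lemma liftFun_vert (h : Γ.Vert → ℝ) (F : Γ.Edge → ℝ → ℝ) (h0 : ∀ e, F e 0 = h (Γ.src e))
    (hl : ∀ e, F e (Γ.len e) = h (Γ.tgt e)) (v : Γ.Vert) :
    liftFun h F h0 hl (Γ.vert v) = h v := rfl

lemma liftFun_pt (h : Γ.Vert → ℝ) (F : Γ.Edge → ℝ → ℝ) (h0 : ∀ e, F e 0 = h (Γ.src e))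
    (hl : ∀ e, F e (Γ.len e) = h (Γ.tgt e)) (e : Γ.Edge) {y : ℝ} (hy : y ∈ Set.Icc 0 (Γ.len e)) :
    liftFun h F h0 hl (Γ.pt e y) = F e y := by
  unfold pt
  rw [Set.projIcc_of_mem _ hy]
  rfl

lemma Path.nonneg {p q : Γ.Point} {r : ℝ} (h : Γ.Path p q r) : 0 ≤ r := by
  induction h with
  | nil => exact le_rfl
  | step e s t hs ht _ ih => positivity

lemma Path.trans {p q s : Γ.Point} {a b : ℝ} (h : Γ.Path p q a) (h' : Γ.Path q s b) :
    Γ.Path p s (a + b) := by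
  induction h' with
  | nil => simpa using h
  | step e s t hs ht _ ih =>
    rw [← add_assoc]
    exact Path.step e s t hs ht ih

lemma Path.single (e : Γ.Edge) {s t : ℝ} (hs : s ∈ Set.Icc 0 (Γ.len e))
    (ht : t ∈ Set.Icc 0 (Γ.len e)) : Γ.Path (Γ.pt e s) (Γ.pt e t) |s - t| := by
  simpa using Path.step e s t hs ht (Path.nil _)

lemma Path.symm {p q : Γ.Point} {a : ℝ} (h : Γ.Path p q a) : Γ.Path q p a := by
  induction h with
  | nil => exact Path.nil _
  | step e s t hs ht _ ih =>
    rw [add_comm, abs_sub_comm]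
    exact (Path.single e ht hs).trans ih

/-- A function which is 1-Lipschitz on each edge is 1-Lipschitz along paths. -/
lemma Path.abs_sub_le {X : Γ.Point → ℝ}
    (hX : ∀ e, ∀ s ∈ Set.Icc 0 (Γ.len e), ∀ t ∈ Set.Icc 0 (Γ.len e),
      |X (Γ.pt e s) - X (Γ.pt e t)| ≤ |s - t|)
    {p q : Γ.Point} {a : ℝ} (h : Γ.Path p q a) : |X p - X q| ≤ a := by
  induction h with
  | nil => simp
  | step e s t hs ht _ ih =>
    exact (_root_.abs_sub_le _ _ _).trans (add_le_add ih (hX e s hs t ht))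

lemma bddBelow_path (p q : Γ.Point) : BddBelow {r | Γ.Path p q r} :=
  ⟨0, fun _ h => Path.nonneg h⟩

lemma Path.dist_le {p q : Γ.Point} {a : ℝ} (h : Γ.Path p q a) : Γ.dist p q ≤ a :=
  csInf_le (bddBelow_path p q) h

lemma dist_comm' (p q : Γ.Point) : Γ.dist p q = Γ.dist q p := by
  unfold dist
  congr 1
  ext r
  exact ⟨Path.symm, Path.symm⟩

/-- Connectedness of a metric graph, in the form in which it is used: a function on the vertices
which takes the same value at the two ends of each edge is constant. -/
def IsConn (Γ : MetricGraph.{u}) : Prop :=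
  ∀ H : Γ.Vert → ℝ, (∀ e, H (Γ.src e) = H (Γ.tgt e)) → ∀ v w, H v = H w

lemma IsConn.exists_pt (hΓ : Γ.IsConn) [hne : Nonempty Γ.Edge] (p : Γ.Point) :
    ∃ e, ∃ y ∈ Set.Icc 0 (Γ.len e), p = Γ.pt e y := by
  classical
  rcases exists_pt_or_vert p with ⟨v, rfl⟩ | h
  · by_contra hcon
    have hs : ∀ e, Γ.src e ≠ v := fun e he =>
      hcon ⟨e, 0, Γ.zero_mem e, by rw [pt_zero, he]⟩
    have ht : ∀ e, Γ.tgt e ≠ v := fun e he =>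
      hcon ⟨e, _, Γ.len_mem e, by rw [pt_len, he]⟩
    obtain ⟨e⟩ := hne
    have := hΓ (fun w => if w = v then 1 else 0) (fun e => by simp [hs e, ht e]) v (Γ.src e)
    simp [hs e] at this
  · exact h

lemma IsConn.exists_path_vert (hΓ : Γ.IsConn) (v w : Γ.Vert) :
    ∃ r, Γ.Path (Γ.vert v) (Γ.vert w) r := by
  classical
  have key := hΓ (fun w => if ∃ r, Γ.Path (Γ.vert v) (Γ.vert w) r then 1 else 0) (fun e => by
    have h1 : Γ.Path (Γ.vert (Γ.src e)) (Γ.vert (Γ.tgt e)) |0 - Γ.len e| := by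
      rw [← pt_zero, ← pt_len]
      exact Path.single e (Γ.zero_mem e) (Γ.len_mem e)
    have : (∃ r, Γ.Path (Γ.vert v) (Γ.vert (Γ.src e)) r) ↔
        ∃ r, Γ.Path (Γ.vert v) (Γ.vert (Γ.tgt e)) r :=
      ⟨fun ⟨r, h⟩ => ⟨_, h.trans h1⟩, fun ⟨r, h⟩ => ⟨_, h.trans h1.symm⟩⟩
    simp only [this]) v w
  by_contra hcon
  have hv : ∃ r, Γ.Path (Γ.vert v) (Γ.vert v) r := ⟨0, Path.nil _⟩
  simp [hv, hcon] at key

lemma IsConn.exists_path (hΓ : Γ.IsConn) (p q : Γ.Point) : ∃ r, Γ.Path p q r := by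
  have hv : ∀ p : Γ.Point, ∃ v r, Γ.Path p (Γ.vert v) r := fun p => by
    rcases exists_pt_or_vert p with ⟨v, rfl⟩ | ⟨e, y, hy, rfl⟩
    · exact ⟨v, 0, Path.nil _⟩
    · exact ⟨Γ.src e, _, by rw [← pt_zero]; exact Path.single e hy (Γ.zero_mem e)⟩
  obtain ⟨v, r, h1⟩ := hv p
  obtain ⟨w, r', h2⟩ := hv q
  obtain ⟨s, h3⟩ := hΓ.exists_path_vert v w
  exact ⟨_, (h1.trans h3).trans h2.symm⟩

lemma IsConn.le_dist (hΓ : Γ.IsConn) {X : Γ.Point → ℝ}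
    (hX : ∀ e, ∀ s ∈ Set.Icc 0 (Γ.len e), ∀ t ∈ Set.Icc 0 (Γ.len e),
      |X (Γ.pt e s) - X (Γ.pt e t)| ≤ |s - t|) (p q : Γ.Point) : |X p - X q| ≤ Γ.dist p q :=
  le_csInf (hΓ.exists_path p q) fun _ h => Path.abs_sub_le hX h

lemma IsConn.dist_triangle (hΓ : Γ.IsConn) (p q s : Γ.Point) :
    Γ.dist p s ≤ Γ.dist p q + Γ.dist q s := by
  have h1 : ∀ a, Γ.Path p q a → Γ.dist p s - a ≤ Γ.dist q s := fun a ha =>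
    le_csInf (hΓ.exists_path q s) fun b hb => by
      have := (ha.trans hb).dist_le
      linarith
  have h2 : Γ.dist p s - Γ.dist q s ≤ Γ.dist p q :=
    le_csInf (hΓ.exists_path p q) fun a ha => by have := h1 a ha; linarith
  linarith

/-! ### Unit flows along geodesics -/

/-- A unit flow `ε` from the vertex `p` to the vertex `q`, running with unit speed along the
position function `x`, which is constant on the edges that do not carry the flow: this encodes a
geodesic from `p` to `q` of length `D` in a metric tree, `x` being the position of the projection
to the geodesic. Kirchhoff's law for the flow is stated in its weak form. -/
structure GeodFlow (Γ : MetricGraph.{u}) (p q : Γ.Vert) (D : ℝ) (x : Γ.Vert → ℝ)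
    (ε : Γ.Edge → ℝ) : Prop where
  nonneg : ∀ v, 0 ≤ x v
  le : ∀ v, x v ≤ D
  start : x p = 0
  finish : x q = D
  unit : ∀ e, ε e = 0 ∨ ε e = 1 ∨ ε e = -1
  speed : ∀ e, x (Γ.tgt e) - x (Γ.src e) = ε e * Γ.len e
  flow : ∀ H : Γ.Vert → ℝ, ∑ e, ε e * (H (Γ.tgt e) - H (Γ.src e)) = H q - H p

namespace GeodFlow

variable {p q : Γ.Vert} {D : ℝ} {x : Γ.Vert → ℝ} {ε : Γ.Edge → ℝ}

lemma reverse (h : Γ.GeodFlow p q D x ε) :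
    Γ.GeodFlow q p D (fun v => D - x v) (fun e => -ε e) where
  nonneg v := sub_nonneg.2 (h.le v)
  le v := sub_le_self _ (h.nonneg v)
  start := by rw [h.finish, sub_self]
  finish := by rw [h.start, sub_zero]
  unit e := by rcases h.unit e with h | h | h <;> simp [h]
  speed e := by linarith [h.speed e]
  flow H := by
    have := h.flow H
    simp only [neg_mul, Finset.sum_neg_distrib]
    linarith

lemma exists_ne_zero (h : Γ.GeodFlow p q D x ε) (hD : 0 < D) : ∃ e, ε e ≠ 0 := by
  by_contra! hcon
  have := h.flow x
  simp only [hcon, zero_mul, Finset.sum_const_zero, h.start, h.finish] at this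
  linarith

lemma sq_eq_one (h : Γ.GeodFlow p q D x ε) {e : Γ.Edge} (he : ε e ≠ 0) : ε e * ε e = 1 := by
  rcases h.unit e with h | h | h
  · exact absurd h he
  · rw [h]; norm_num
  · rw [h]; norm_num

/-- The position of a point on an edge lies between `0` and the length of the geodesic. -/
lemma pos_mem (h : Γ.GeodFlow p q D x ε) (e : Γ.Edge) {y : ℝ} (hy : y ∈ Set.Icc 0 (Γ.len e)) :
    x (Γ.src e) + ε e * y ∈ Set.Icc 0 D := by
  have h1 := h.nonneg (Γ.src e)
  have h2 := h.nonneg (Γ.tgt e)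
  have h3 := h.le (Γ.src e)
  have h4 := h.le (Γ.tgt e)
  have h5 := h.speed e
  have h6 := hy.1
  have h7 := hy.2
  rcases h.unit e with h8 | h8 | h8 <;> rw [h8] at h5 ⊢ <;> constructor <;> linarith

/-- Exactly one edge of a geodesic crosses a given position `t`. -/
lemma exists_cross (h : Γ.GeodFlow p q D x ε) {t : ℝ} (ht : 0 < t) (htD : t ≤ D) :
    ∃ e₀, ε e₀ * ((if t ≤ x (Γ.tgt e₀) then 1 else 0) - (if t ≤ x (Γ.src e₀) then 1 else 0)) = 1 ∧
      ∀ e, e ≠ e₀ →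
        ε e * ((if t ≤ x (Γ.tgt e) then 1 else 0) - (if t ≤ x (Γ.src e) then 1 else 0)) = 0 := by
  classical
  set c : Γ.Edge → ℝ := fun e =>
    ε e * ((if t ≤ x (Γ.tgt e) then 1 else 0) - (if t ≤ x (Γ.src e) then 1 else 0)) with hc
  have hsum : ∑ e, c e = 1 := by
    rw [hc, h.flow (fun v => if t ≤ x v then 1 else 0)]
    simp only [h.start, h.finish]
    rw [if_pos htD, if_neg (not_le.2 ht), sub_zero]
  have hor : ∀ e, c e = 0 ∨ c e = 1 := by
    intro e
    have h3 := h.speed e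
    have hl := Γ.len_pos e
    simp only [hc]
    rcases h.unit e with h4 | h4 | h4
    · simp [h4]
    · rw [h4] at h3 ⊢
      split_ifs <;> first | (exfalso; linarith) | simp
    · rw [h4] at h3 ⊢
      split_ifs <;> first | (exfalso; linarith) | simp
  have hnn : ∀ e, 0 ≤ c e := fun e => by rcases hor e with h | h <;> rw [h]; exact zero_le_one
  obtain ⟨e₀, he₀⟩ : ∃ e₀, c e₀ ≠ 0 := by
    by_contra! hcon
    rw [Finset.sum_eq_zero fun e _ => hcon e] at hsum
    exact zero_ne_one hsum
  have he₁ : c e₀ = 1 := (hor e₀).resolve_left he₀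
  refine ⟨e₀, he₁, fun e he => ?_⟩
  have h1 : c e₀ + c e ≤ ∑ e, c e := by
    rw [← Finset.sum_pair he.symm]
    exact Finset.sum_le_sum_of_subset_of_nonneg (Finset.subset_univ _) fun e _ _ => hnn e
  exact le_antisymm (by linarith) (hnn e)

end GeodFlow

end MetricGraph

/-! ### Families of symmetric operators -/

open Module in
/-- A continuous family of symmetric operators that has a two-dimensional nonpositive subspace at
the end of the parameter interval, but not at its beginning, is singular somewhere. At the least
parameter with such a subspace `W`, if the operator `T` were injective, the map `w ↦ w - s T w` with
small `s > 0` would turn `W` into a negative definite subspace, which would survive for slightly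
smaller parameters. -/
lemma exists_singular_of_nonpos_pair {E : Type*} [NormedAddCommGroup E] [InnerProductSpace ℝ E]
    [FiniteDimensional ℝ E] {k₀ : ℝ} (hk₀ : 0 ≤ k₀) (A : ℝ → E →L[ℝ] E)
    (hcont : ContinuousOn A (Set.Icc 0 k₀))
    (hsymm : ∀ k ∈ Set.Icc 0 k₀, ∀ u v, inner ℝ (A k u) v = inner ℝ u (A k v))
    (hend : ∃ u v : E, LinearIndependent ℝ ![u, v] ∧
      ∀ a b : ℝ, inner ℝ (A k₀ (a • u + b • v)) (a • u + b • v) ≤ 0)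
    (hstart : ¬ ∃ u v : E, LinearIndependent ℝ ![u, v] ∧
      ∀ a b : ℝ, inner ℝ (A 0 (a • u + b • v)) (a • u + b • v) ≤ 0) :
    ∃ k ∈ Set.Ioc 0 k₀, ∃ u : E, u ≠ 0 ∧ A k u = 0 := by
  -- linearly independent pairs may be replaced by orthonormal ones
  have ortho : ∀ (k : ℝ) (u v : E), LinearIndependent ℝ ![u, v] →
      (∀ a b : ℝ, inner ℝ (A k (a • u + b • v)) (a • u + b • v) ≤ 0) →
      ∃ u' v' : E, ‖u'‖ = 1 ∧ ‖v'‖ = 1 ∧ inner ℝ u' v' = 0 ∧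
        ∀ a b : ℝ, inner ℝ (A k (a • u' + b • v')) (a • u' + b • v') ≤ 0 := by
    intro k u v hli hq
    let W := Submodule.span ℝ (Set.range ![u, v])
    have hfin : finrank ℝ W = 2 := by
      rw [finrank_span_eq_card hli]; simp
    let b := (stdOrthonormalBasis ℝ W).reindex (finCongr hfin)
    have hW : ∀ w ∈ W, inner ℝ (A k w) w ≤ 0 := by
      intro w hw
      have : W = Submodule.span ℝ {u, v} := by
        simp [W, Matrix.range_cons, Set.pair_comm]
      rw [this, Submodule.mem_span_pair] at hw
      obtain ⟨a, c, rfl⟩ := hw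
      exact hq a c
    refine ⟨b 0, b 1, ?_, ?_, ?_, fun a c => hW _ ?_⟩
    · rw [← Submodule.coe_norm]; exact b.norm_eq_one 0
    · rw [← Submodule.coe_norm]; exact b.norm_eq_one 1
    · rw [← Submodule.coe_inner]; exact b.inner_eq_zero (by decide)
    · exact W.add_mem (W.smul_mem _ (b 0).2) (W.smul_mem _ (b 1).2)
  have indep : ∀ u v : E, ‖u‖ = 1 → ‖v‖ = 1 → inner ℝ u v = 0 → LinearIndependent ℝ ![u, v] := by
    intro u v hu hv huv
    rw [LinearIndependent.pair_iff]
    intro s t hst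
    constructor
    · have : inner ℝ u (s • u + t • v) = 0 := by rw [hst, inner_zero_right]
      rw [inner_add_right, inner_smul_right, inner_smul_right, huv,
        real_inner_self_eq_norm_sq, hu] at this
      linarith
    · have : inner ℝ v (s • u + t • v) = 0 := by rw [hst, inner_zero_right]
      rw [inner_add_right, inner_smul_right, inner_smul_right, real_inner_comm, huv,
        real_inner_self_eq_norm_sq, hv] at this
      linarith
  -- the compact set of orthonormal pairs spanning a nonpositive subspace
  let S : Set (ℝ × E × E) := (Set.Icc 0 k₀ ×ˢ Metric.sphere (0 : E) 1 ×ˢ Metric.sphere (0 : E) 1) ∩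
    {z | inner ℝ z.2.1 z.2.2 = 0 ∧ ∀ a b : ℝ,
      inner ℝ (A z.1 (a • z.2.1 + b • z.2.2)) (a • z.2.1 + b • z.2.2) ≤ 0}
  have hK : IsCompact (Set.Icc 0 k₀ ×ˢ Metric.sphere (0 : E) 1 ×ˢ Metric.sphere (0 : E) 1) :=
    isCompact_Icc.prod ((isCompact_sphere _ _).prod (isCompact_sphere _ _))
  have hS : IsCompact S := by
    have hclosed : IsClosed S := by
      have hset : S = ((Set.Icc 0 k₀ ×ˢ Metric.sphere (0 : E) 1 ×ˢ Metric.sphere (0 : E) 1) ∩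
          {z | inner ℝ z.2.1 z.2.2 = 0}) ∩ ⋂ (a : ℝ) (b : ℝ),
          ((Set.Icc 0 k₀ ×ˢ Metric.sphere (0 : E) 1 ×ˢ Metric.sphere (0 : E) 1) ∩
          (fun z : ℝ × E × E => inner ℝ (A z.1 (a • z.2.1 + b • z.2.2))
            (a • z.2.1 + b • z.2.2)) ⁻¹' Set.Iic 0) := by
        ext z
        simp only [S, Set.mem_inter_iff, Set.mem_ofPred_eq, Set.mem_iInter, Set.mem_preimage,
          Set.mem_Iic]
        constructor
        · rintro ⟨h1, h2, h3⟩
          exact ⟨⟨h1, h2⟩, fun a b => ⟨h1, h3 a b⟩⟩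
        · rintro ⟨⟨h1, h2⟩, h3⟩
          exact ⟨h1, h2, fun a b => (h3 a b).2⟩
      rw [hset]
      refine IsClosed.inter (hK.isClosed.inter
        (isClosed_eq (by fun_prop) continuous_const)) ?_
      refine isClosed_iInter fun a => isClosed_iInter fun b => ?_
      refine ContinuousOn.preimage_isClosed_of_isClosed ?_ hK.isClosed isClosed_Iic
      have hw : ContinuousOn (fun z : ℝ × E × E => a • z.2.1 + b • z.2.2)
          (Set.Icc 0 k₀ ×ˢ Metric.sphere (0 : E) 1 ×ˢ Metric.sphere (0 : E) 1) := by fun_prop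
      have hA : ContinuousOn (fun z : ℝ × E × E => A z.1)
          (Set.Icc 0 k₀ ×ˢ Metric.sphere (0 : E) 1 ×ˢ Metric.sphere (0 : E) 1) :=
        hcont.comp continuousOn_fst fun z hz => hz.1
      exact (hA.clm_apply hw).inner hw
    exact hK.of_isClosed_subset hclosed Set.inter_subset_left
  have hne : S.Nonempty := by
    obtain ⟨u, v, hli, hq⟩ := hend
    obtain ⟨u', v', h1, h2, h3, h4⟩ := ortho k₀ u v hli hq
    exact ⟨(k₀, u', v'), ⟨⟨hk₀, le_rfl⟩, by simpa using h1, by simpa using h2⟩, h3, h4⟩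
  obtain ⟨⟨k, u, v⟩, ⟨⟨hk, hu, hv⟩, huv, hq⟩, hmin⟩ := hS.exists_isMinOn hne continuousOn_fst
  simp only [mem_sphere_iff_norm, sub_zero] at hu hv
  simp only at hk huv hq
  have hkpos : 0 < k := by
    rcases hk.1.lt_or_eq with h | h
    · exact h
    · subst h
      exact absurd ⟨u, v, indep u v hu hv huv, hq⟩ hstart
  refine ⟨k, ⟨hkpos, hk.2⟩, ?_⟩
  by_contra! hinj
  -- contradiction: the pair can be moved to a smaller parameter
  obtain ⟨K, hKpos, hKl⟩ := (A k).toLinearMap.exists_antilipschitzWith (by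
    rw [LinearMap.ker_eq_bot']
    intro w hw
    by_contra h
    exact hinj w h hw)
  have hlow : ∀ w, ‖w‖ ≤ K * ‖A k w‖ := fun w => by
    simpa [dist_eq_norm] using hKl.le_mul_dist w 0
  set T := A k with hT
  obtain ⟨s, hs, hsT⟩ : ∃ s : ℝ, 0 < s ∧ s * ‖T‖ ≤ 1 := by
    refine ⟨(‖T‖ + 1)⁻¹, by positivity, ?_⟩
    rw [inv_mul_le_iff₀ (by positivity)]
    linarith
  let P : E →ₗ[ℝ] E := LinearMap.id - s • T.toLinearMap
  have hP : ∀ w, P w = w - s • T w := fun w => rfl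
  have hqw : ∀ w, inner ℝ (T w) w ≤ 0 → inner ℝ (T (P w)) (P w) ≤ -s * ‖T w‖ ^ 2 := by
    intro w hw
    have e1 : inner ℝ (T (T w)) w = ‖T w‖ ^ 2 := by
      rw [hsymm k hk, real_inner_self_eq_norm_sq]
    have e2 : inner ℝ (T (T w)) (T w) ≤ ‖T‖ * ‖T w‖ ^ 2 := by
      calc inner ℝ (T (T w)) (T w) ≤ ‖T (T w)‖ * ‖T w‖ := real_inner_le_norm _ _
        _ ≤ (‖T‖ * ‖T w‖) * ‖T w‖ := by gcongr; exact T.le_opNorm _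
        _ = _ := by ring
    rw [hP, map_sub, map_smul, inner_sub_left, inner_sub_right, inner_sub_right, inner_smul_left,
      inner_smul_right, inner_smul_right, inner_smul_left, e1, real_inner_self_eq_norm_sq]
    simp only [conj_trivial]
    have e3 : s * (s * inner ℝ (T (T w)) (T w)) ≤ s * (1 * ‖T w‖ ^ 2) := by
      refine mul_le_mul_of_nonneg_left ?_ hs.le
      calc s * inner ℝ (T (T w)) (T w) ≤ s * (‖T‖ * ‖T w‖ ^ 2) :=
            mul_le_mul_of_nonneg_left e2 hs.le
        _ = (s * ‖T‖) * ‖T w‖ ^ 2 := by ring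
        _ ≤ _ := by gcongr
    linarith
  have hPn : ∀ w, ‖P w‖ ≤ 2 * ‖w‖ := by
    intro w
    have e1 : ‖s • T w‖ ≤ 1 * ‖w‖ := by
      rw [norm_smul, Real.norm_of_nonneg hs.le]
      calc s * ‖T w‖ ≤ s * (‖T‖ * ‖w‖) := by gcongr; exact T.le_opNorm _
        _ = (s * ‖T‖) * ‖w‖ := by ring
        _ ≤ _ := by gcongr
    rw [hP]
    linarith [norm_sub_le w (s • T w)]
  have hnear : ∃ k' ∈ Set.Ico 0 k, ‖A k' - T‖ < s / (4 * K ^ 2) := by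
    have hc := hcont k hk
    rw [Metric.continuousWithinAt_iff] at hc
    obtain ⟨d, hd, hd'⟩ := hc (s / (4 * K ^ 2)) (by positivity)
    refine ⟨max 0 (k - d / 2), ⟨le_max_left _ _, max_lt hkpos (by linarith)⟩, ?_⟩
    rw [← dist_eq_norm]
    apply hd'
    · exact ⟨le_max_left _ _, max_le (hkpos.le.trans hk.2) (by linarith [hk.2])⟩
    · rw [Real.dist_eq, abs_lt]
      constructor
      · linarith [le_max_right 0 (k - d / 2)]
      · have : max 0 (k - d / 2) < k := max_lt hkpos (by linarith)
        linarith
  obtain ⟨k', hk', hclose⟩ := hnear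
  have hneg : ∀ w, inner ℝ (T w) w ≤ 0 → inner ℝ (A k' (P w)) (P w) ≤ 0 := by
    intro w hw
    have e1 : inner ℝ ((A k' - T) (P w)) (P w) ≤ s / (4 * K ^ 2) * ‖P w‖ ^ 2 := by
      calc inner ℝ ((A k' - T) (P w)) (P w) ≤ ‖(A k' - T) (P w)‖ * ‖P w‖ := real_inner_le_norm _ _
        _ ≤ (‖A k' - T‖ * ‖P w‖) * ‖P w‖ := by gcongr; exact ContinuousLinearMap.le_opNorm _ _
        _ ≤ (s / (4 * K ^ 2) * ‖P w‖) * ‖P w‖ := by gcongr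
        _ = _ := by ring
    have e2 : s / (4 * K ^ 2) * ‖P w‖ ^ 2 ≤ s * ‖T w‖ ^ 2 := by
      have e3 : ‖P w‖ ≤ 2 * (K * ‖T w‖) := (hPn w).trans (by gcongr; exact hlow w)
      calc s / (4 * K ^ 2) * ‖P w‖ ^ 2 ≤ s / (4 * K ^ 2) * (2 * (K * ‖T w‖)) ^ 2 := by gcongr
        _ = s * ‖T w‖ ^ 2 := by
          have : (K : ℝ) ≠ 0 := by positivity
          field_simp; ring
    have e4 := hqw w hw
    rw [sub_apply, inner_sub_left] at e1
    linarith
  have hPli : LinearIndependent ℝ ![P u, P v] := by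
    have huvli := indep u v hu hv huv
    rw [LinearIndependent.pair_iff] at huvli ⊢
    intro a b hab
    apply huvli
    by_contra hw
    have h0 : P (a • u + b • v) = 0 := by rw [map_add, map_smul, map_smul, hab]
    have h1 := hqw _ (hq a b)
    rw [h0, map_zero, inner_zero_left] at h1
    have h2 : 0 < ‖T (a • u + b • v)‖ := norm_pos_iff.2 (hinj _ hw)
    have : 0 < s * ‖T (a • u + b • v)‖ ^ 2 := by positivity
    linarith
  obtain ⟨u', v', h1, h2, h3, h4⟩ := ortho k' (P u) (P v) hPli (fun a b => by
    have := hneg _ (hq a b)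
    rwa [map_add, map_smul, map_smul] at this)
  have hmem : (k', u', v') ∈ S :=
    ⟨⟨⟨hk'.1, hk'.2.le.trans hk.2⟩, by simpa using h1, by simpa using h2⟩, h3, h4⟩
  have := hmin hmem
  simp only [Set.mem_ofPred_eq] at this
  exact absurd hk'.2 (not_lt.2 this)

namespace MetricGraph

variable {Γ : MetricGraph.{u}}

/-! ### Eigenfunctions and the spectral gap -/

/-- A function which on each edge is a classical solution of `-F'' = μ F`, and whose outgoing
derivatives at each vertex sum up to zero, is an eigenfunction. -/
lemma isNeumannLaplacian_of_hasDerivAt {f : Γ.Point → ℝ} {F F' : Γ.Edge → ℝ → ℝ} {μ : ℝ}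
    (hf : ∀ e, ∀ y ∈ Set.Icc 0 (Γ.len e), f (Γ.pt e y) = F e y)
    (hF : ∀ e y, HasDerivAt (F e) (F' e y) y)
    (hF' : ∀ e y, HasDerivAt (F' e) (-(μ * F e y)) y)
    (hK : ∀ H : Γ.Vert → ℝ,
      ∑ e, (H (Γ.src e) * F' e 0 - H (Γ.tgt e) * F' e (Γ.len e)) = 0) :
    Γ.IsNeumannLaplacian f (μ • f) := by
  classical
  have hFc : ∀ e, Continuous (F e) := fun e =>
    continuous_iff_continuousAt.2 fun y => (hF e y).continuousAt
  have hF'c : ∀ e, Continuous (F' e) := fun e =>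
    continuous_iff_continuousAt.2 fun y => (hF' e y).continuousAt
  refine ⟨F', fun e => ?_, fun e x hx => ?_, fun e x hx => ?_, fun v => ?_⟩
  · have h1 : MeasureTheory.MemLp (fun x => μ * F e x) 2
        (MeasureTheory.volume.restrict (Set.Icc 0 (Γ.len e))) := by
      have hc : Continuous fun x => μ * F e x := (hFc e).const_mul μ
      obtain ⟨C, hC⟩ := isCompact_Icc.exists_bound_of_continuousOn
        (hc.continuousOn (s := Set.Icc 0 (Γ.len e)))
      exact MeasureTheory.MemLp.of_bound hc.aestronglyMeasurable C
        ((MeasureTheory.ae_restrict_mem measurableSet_Icc).mono hC)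
    refine h1.ae_eq ?_
    filter_upwards [MeasureTheory.ae_restrict_mem measurableSet_Icc] with x hx
    rw [Pi.smul_apply, hf e x hx, smul_eq_mul]
  · rw [hf e x hx, hf e 0 (Γ.zero_mem e),
      intervalIntegral.integral_eq_sub_of_hasDerivAt (fun y _ => hF e y)
        ((hF'c e).intervalIntegrable _ _)]
    ring
  · have h1 : ∫ t in (0 : ℝ)..x, -(μ • f) (Γ.pt e t) = ∫ t in (0 : ℝ)..x, -(μ * F e t) := by
      apply intervalIntegral.integral_congr
      intro t ht
      rw [Set.uIcc_of_le hx.1] at ht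
      simp only [Pi.smul_apply, smul_eq_mul]
      rw [hf e t ⟨ht.1, ht.2.trans hx.2⟩]
    rw [h1, intervalIntegral.integral_eq_sub_of_hasDerivAt (fun y _ => hF' e y)
        (((hFc e).const_mul μ).neg.intervalIntegrable _ _)]
    ring
  · have := hK (fun w => if w = v then 1 else 0)
    refine Eq.trans (Finset.sum_congr rfl fun e _ => ?_) this
    split_ifs <;> ring

lemma isNeumannLaplacian_one (Γ : MetricGraph.{u}) :
    Γ.IsNeumannLaplacian (fun _ => 1) ((0 : ℝ) • fun _ => 1) :=
  isNeumannLaplacian_of_hasDerivAt (F := fun _ _ => 1) (F' := fun _ _ => 0)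
    (fun _ _ _ => rfl) (fun _ _ => hasDerivAt_const _ _)
    (fun _ y => by simpa using hasDerivAt_const y (0 : ℝ)) (fun _ => by simp)

/-- The set whose infimum is the first nontrivial eigenvalue. -/
lemma eigenvalue_one_eq (Γ : MetricGraph.{u}) : Γ.eigenvalue 1 =
    sInf {c : ℝ | ∃ φ : Fin 2 → Γ.Point → ℝ, LinearIndependent ℝ φ ∧
      ∀ i, ∃ μ ≤ c, Γ.IsNeumannLaplacian (φ i) (μ • φ i)} := rfl

lemma mem_of_nonconst {f : Γ.Point → ℝ} {μ : ℝ} (hμ : 0 ≤ μ)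
    (hf : Γ.IsNeumannLaplacian f (μ • f)) (hne : ¬ ∃ c, ∀ p, f p = c) [Nonempty Γ.Point] :
    μ ∈ {c : ℝ | ∃ φ : Fin 2 → Γ.Point → ℝ, LinearIndependent ℝ φ ∧
      ∀ i, ∃ μ ≤ c, Γ.IsNeumannLaplacian (φ i) (μ • φ i)} := by
  refine ⟨![fun _ => 1, f], ?_, ?_⟩
  · rw [LinearIndependent.pair_iff]
    intro s t hst
    have h : ∀ p, s + t * f p = 0 := fun p => by simpa using congrFun hst p
    have ht : t = 0 := by
      by_contra ht
      exact hne ⟨-s / t, fun p => by rw [eq_div_iff ht]; linarith [h p]⟩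
    subst ht
    simpa using h (Classical.arbitrary _)
  · intro i
    fin_cases i
    · exact ⟨0, hμ, isNeumannLaplacian_one Γ⟩
    · exact ⟨μ, le_rfl, hf⟩

/-- A nonconstant eigenfunction bounds the spectral gap from above. -/
lemma spectralGap_le_of_nonconst {f : Γ.Point → ℝ} {k k₀ : ℝ} (hk : 0 ≤ k) (hkk : k ≤ k₀)
    (hf : Γ.IsNeumannLaplacian f ((k ^ 2) • f)) (hne : ¬ ∃ c, ∀ p, f p = c)
    [Nonempty Γ.Point] : Γ.spectralGap ≤ k₀ := by
  have hmem := mem_of_nonconst (sq_nonneg k) hf hne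
  have h : Γ.eigenvalue 1 ≤ k ^ 2 := by
    rw [eigenvalue_one_eq]
    by_cases hb : BddBelow {c : ℝ | ∃ φ : Fin 2 → Γ.Point → ℝ, LinearIndependent ℝ φ ∧
      ∀ i, ∃ μ ≤ c, Γ.IsNeumannLaplacian (φ i) (μ • φ i)}
    · exact csInf_le hb hmem
    · rw [Real.sInf_of_not_bddBelow hb]
      positivity
  calc Γ.spectralGap ≤ √(k ^ 2) := Real.sqrt_le_sqrt h
    _ = k := Real.sqrt_sq hk
    _ ≤ k₀ := hkk

/-- If all eigenfunctions below `K²` are constant, and there is a nonconstant eigenfunction up to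
that level, then the spectral gap is `K`. -/
lemma spectralGap_eq {f : Γ.Point → ℝ} {k K : ℝ} (hk : 0 ≤ k) (hkK : k ≤ K)
    (hf : Γ.IsNeumannLaplacian f ((k ^ 2) • f)) (hne : ¬ ∃ c, ∀ p, f p = c)
    [Nonempty Γ.Point]
    (hlow : ∀ (g : Γ.Point → ℝ) (μ : ℝ), μ < K ^ 2 → Γ.IsNeumannLaplacian g (μ • g) →
      ∃ c, ∀ p, g p = c) : Γ.spectralGap = K := by
  refine le_antisymm (spectralGap_le_of_nonconst hk hkK hf hne) ?_
  have h : K ^ 2 ≤ Γ.eigenvalue 1 := by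
    rw [eigenvalue_one_eq]
    refine le_csInf ⟨_, mem_of_nonconst (sq_nonneg k) hf hne⟩ ?_
    rintro c ⟨φ, hli, hφ⟩
    by_contra! hc
    have hconst : ∀ i, ∃ d, ∀ p, φ i p = d := fun i => by
      obtain ⟨μ, hμ, hn⟩ := hφ i
      exact hlow _ μ (hμ.trans_lt hc) hn
    choose d hd using hconst
    have h2 := Fintype.linearIndependent_iff.1 hli ![d 1, -d 0] (by
      funext p
      simp [Fin.sum_univ_two, hd, mul_comm])
    have h0 : d 0 = 0 := by simpa using h2 1
    exact hli.ne_zero 0 (funext fun p => by rw [hd, h0]; rfl)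
  calc K = √(K ^ 2) := (Real.sqrt_sq (hk.trans hkK)).symm
    _ ≤ _ := Real.sqrt_le_sqrt h

/-! ### Reduction of the eigenvalue equation to the vertices -/

noncomputable instance (Γ : MetricGraph.{u}) : Fintype Γ.Vert := Fintype.ofFinite _

/-- The functional `u ↦ u a` times the unit vector at `b`. -/
noncomputable def elemOp (a b : Γ.Vert) :
    EuclideanSpace ℝ Γ.Vert →L[ℝ] EuclideanSpace ℝ Γ.Vert := by
  classical
  exact (EuclideanSpace.proj a : EuclideanSpace ℝ Γ.Vert →L[ℝ] ℝ).smulRight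
    (EuclideanSpace.single b (1 : ℝ))

lemma inner_elemOp (a b : Γ.Vert) (u w : EuclideanSpace ℝ Γ.Vert) :
    inner ℝ (elemOp a b u) w = u a * w b := by
  classical
  simp [elemOp, inner_smul_left, EuclideanSpace.inner_single_left]

/-- The symmetric operator on the vertex values whose kernel consists of the vertex values of the
solutions of `-f'' = k² f` which satisfy Kirchhoff's law, as long as `k` times each edge length is
less than `π`. Writing the coefficients with `sinc` extends them continuously to `k = 0`. -/
noncomputable def vertexOp (Γ : MetricGraph.{u}) (k : ℝ) :
    EuclideanSpace ℝ Γ.Vert →L[ℝ] EuclideanSpace ℝ Γ.Vert :=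
  ∑ e, ((Real.cos (k * Γ.len e) / (Γ.len e * Real.sinc (k * Γ.len e))) •
      (elemOp (Γ.src e) (Γ.src e) + elemOp (Γ.tgt e) (Γ.tgt e)) -
    (1 / (Γ.len e * Real.sinc (k * Γ.len e))) •
      (elemOp (Γ.src e) (Γ.tgt e) + elemOp (Γ.tgt e) (Γ.src e)))

lemma inner_vertexOp (k : ℝ) (u w : EuclideanSpace ℝ Γ.Vert) :
    inner ℝ (Γ.vertexOp k u) w =
      ∑ e, (Real.cos (k * Γ.len e) / (Γ.len e * Real.sinc (k * Γ.len e)) *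
          (u (Γ.src e) * w (Γ.src e) + u (Γ.tgt e) * w (Γ.tgt e)) -
        1 / (Γ.len e * Real.sinc (k * Γ.len e)) *
          (u (Γ.src e) * w (Γ.tgt e) + u (Γ.tgt e) * w (Γ.src e))) := by
  simp only [vertexOp, sum_apply, sub_apply, smul_apply, add_apply, sum_inner, inner_sub_left,
    inner_smul_left, inner_add_left, inner_elemOp, conj_trivial]

lemma sinc_pos {x : ℝ} (h0 : 0 ≤ x) (hπ : x < Real.pi) : 0 < Real.sinc x := by
  rcases h0.eq_or_lt with h | h
  · rw [← h, Real.sinc_zero]; exact one_pos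
  · rw [Real.sinc_of_ne_zero h.ne']
    exact div_pos (Real.sin_pos_of_pos_of_lt_pi h hπ) h

lemma continuousOn_vertexOp {k₀ : ℝ} (hk₀ : ∀ e, k₀ * Γ.len e < Real.pi) :
    ContinuousOn Γ.vertexOp (Set.Icc 0 k₀) := by
  have hpos : ∀ e, ∀ k ∈ Set.Icc 0 k₀, Γ.len e * Real.sinc (k * Γ.len e) ≠ 0 := fun e k hk =>
    (mul_pos (Γ.len_pos e) (sinc_pos (mul_nonneg hk.1 (Γ.len_pos e).le)
      (lt_of_le_of_lt (mul_le_mul_of_nonneg_right hk.2 (Γ.len_pos e).le) (hk₀ e)))).ne'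
  have hs : ∀ e, Continuous fun k => Γ.len e * Real.sinc (k * Γ.len e) := fun e =>
    continuous_const.mul (Real.continuous_sinc.comp (continuous_id.mul continuous_const))
  unfold vertexOp
  refine continuousOn_finsetSum _ fun e _ => ?_
  have h1 : ContinuousOn (fun k => Real.cos (k * Γ.len e) / (Γ.len e * Real.sinc (k * Γ.len e)))
      (Set.Icc 0 k₀) := ContinuousOn.div (by fun_prop) (hs e).continuousOn (hpos e)
  have h2 : ContinuousOn (fun k => 1 / (Γ.len e * Real.sinc (k * Γ.len e)))
      (Set.Icc 0 k₀) := ContinuousOn.div continuousOn_const (hs e).continuousOn (hpos e)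
  exact (h1.smul continuousOn_const).sub (h2.smul continuousOn_const)

/-- A vector in the kernel of the vertex operator extends to an eigenfunction. -/
lemma exists_eigenfunction_of_vertexOp_eq_zero [Nonempty Γ.Edge] {k : ℝ} (hk : 0 < k)
    (hkl : ∀ e, k * Γ.len e < Real.pi) {u : EuclideanSpace ℝ Γ.Vert} (hu : u ≠ 0)
    (h : Γ.vertexOp k u = 0) :
    ∃ f, Γ.IsNeumannLaplacian f ((k ^ 2) • f) ∧ ¬ ∃ c, ∀ p, f p = c := by
  classical
  have hsin : ∀ e, 0 < Real.sin (k * Γ.len e) := fun e =>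
    Real.sin_pos_of_pos_of_lt_pi (mul_pos hk (Γ.len_pos e)) (hkl e)
  let F : Γ.Edge → ℝ → ℝ := fun e y => (u (Γ.src e) * Real.sin (k * (Γ.len e - y)) +
    u (Γ.tgt e) * Real.sin (k * y)) / Real.sin (k * Γ.len e)
  let F' : Γ.Edge → ℝ → ℝ := fun e y => k * (-u (Γ.src e) * Real.cos (k * (Γ.len e - y)) +
    u (Γ.tgt e) * Real.cos (k * y)) / Real.sin (k * Γ.len e)
  have h0 : ∀ e, F e 0 = u (Γ.src e) := fun e => by
    simp [F, (hsin e).ne']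
  have hl : ∀ e, F e (Γ.len e) = u (Γ.tgt e) := fun e => by
    simp [F, (hsin e).ne']
  have d1 : ∀ l y : ℝ, HasDerivAt (fun y => k * (l - y)) (-k) y := fun l y => by
    simpa using ((hasDerivAt_id y).const_sub l).const_mul k
  have d2 : ∀ y : ℝ, HasDerivAt (fun y => k * y) k y := fun y => by
    simpa using (hasDerivAt_id y).const_mul k
  refine ⟨liftFun u F h0 hl, ?_, ?_⟩
  · refine isNeumannLaplacian_of_hasDerivAt (F := F) (F' := F')
      (fun e y hy => liftFun_pt _ _ _ _ e hy) (fun e y => ?_) (fun e y => ?_) fun H => ?_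
    · refine ((((d1 (Γ.len e) y).sin.const_mul (u (Γ.src e))).add
        ((d2 y).sin.const_mul (u (Γ.tgt e)))).div_const (Real.sin (k * Γ.len e))).congr_deriv ?_
      simp only [F']
      ring
    · refine (((((d1 (Γ.len e) y).cos.const_mul (-u (Γ.src e))).add
        ((d2 y).cos.const_mul (u (Γ.tgt e)))).const_mul k).div_const
          (Real.sin (k * Γ.len e))).congr_deriv ?_
      simp only [F]
      ring
    · have h1 := inner_vertexOp k u (WithLp.toLp 2 H)
      rw [h, inner_zero_left] at h1
      rw [← neg_eq_zero, ← Finset.sum_neg_distrib]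
      refine Eq.trans (Finset.sum_congr rfl fun e _ => ?_) h1.symm
      have e1 := (hsin e).ne'
      have e2 := (Γ.len_pos e).ne'
      rw [Real.sinc_of_ne_zero (mul_pos hk (Γ.len_pos e)).ne']
      simp only [F', sub_self, sub_zero, mul_zero, Real.cos_zero]
      field_simp
      ring
  · rintro ⟨c, hc⟩
    have hv : ∀ v, u v = c := fun v => by
      have := hc (Γ.vert v)
      rwa [liftFun_vert] at this
    have hc0 : c ≠ 0 := by
      rintro rfl
      exact hu (by ext v; simp [hv])
    obtain ⟨e⟩ := ‹Nonempty Γ.Edge›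
    -- the value at the midpoint of an edge differs from the common value at its ends
    have hm := hc (Γ.pt e (Γ.len e / 2))
    have hlp := Γ.len_pos e
    rw [liftFun_pt _ _ _ _ e ⟨by positivity, by linarith⟩] at hm
    simp only [F, hv] at hm
    rw [div_eq_iff (hsin e).ne', show k * (Γ.len e - Γ.len e / 2) = k * Γ.len e / 2 by ring,
      show k * (Γ.len e / 2) = k * Γ.len e / 2 by ring] at hm
    have h2 : Real.sin (k * Γ.len e) =
        2 * Real.sin (k * Γ.len e / 2) * Real.cos (k * Γ.len e / 2) := by
      rw [← Real.sin_two_mul]; congr 1; ring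
    have hkp := mul_pos hk hlp
    have h3 : 0 < Real.sin (k * Γ.len e / 2) :=
      Real.sin_pos_of_pos_of_lt_pi (by linarith) (by linarith [hkl e])
    have h4 : Real.cos (k * Γ.len e / 2) < 1 := by
      rw [← Real.cos_zero]
      exact Real.cos_lt_cos_of_nonneg_of_le_pi le_rfl (by linarith [hkl e]) (by linarith)
    rw [h2] at hm
    have h5 : (c * 2 * Real.sin (k * Γ.len e / 2)) * (1 - Real.cos (k * Γ.len e / 2)) = 0 := by
      linarith
    rcases mul_eq_zero.1 h5 with h6 | h6
    · have : c * 2 * Real.sin (k * Γ.len e / 2) ≠ 0 :=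
        mul_ne_zero (mul_ne_zero hc0 two_ne_zero) h3.ne'
      exact this h6
    · linarith

/-! ### The upper bound by the length of a geodesic -/

/-- The edge term of the quadratic form of the vertex operator, for the values of a solution
`W'' = -k² W` at the ends of the edge, is the increment of `W W'`. -/
lemma edge_form_eq {k l c s W V : ℝ} (hk : k ≠ 0) (hl : l ≠ 0) (hs : s ≠ 0)
    (hcs : s ^ 2 + c ^ 2 = 1) :
    c / (l * (s / (k * l))) * (W * W + (W * c + V * s) * (W * c + V * s)) -
      1 / (l * (s / (k * l))) * (W * (W * c + V * s) + (W * c + V * s) * W) =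
    k * ((W * c + V * s) * (V * c - W * s) - W * V) := by
  have h : c ^ 2 = 1 - s ^ 2 := by linarith
  field_simp
  ring_nf
  rw [show c ^ 3 = c * c ^ 2 by ring, h]
  ring_nf

/-- A geodesic of length `D` which consists of more than one edge yields a nonconstant
eigenfunction up to the eigenvalue `(π / D) ^ 2`. The trial functions are `a cos (k x) + b sin (k x)`
with `k = π / D`, where `x` is the position of the projection to the geodesic: their boundary
terms at the two ends of the geodesic cancel. -/
theorem GeodFlow.exists_eigenfunction {p q : Γ.Vert} {D : ℝ} {x : Γ.Vert → ℝ} {ε : Γ.Edge → ℝ}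
    (h : Γ.GeodFlow p q D x ε) (hΓ : Γ.IsConn) (hD : 0 < D) (hlen : ∀ e, Γ.len e < D) :
    ∃ k f, 0 ≤ k ∧ k ≤ Real.pi / D ∧ Γ.IsNeumannLaplacian f ((k ^ 2) • f) ∧
      ¬ ∃ c, ∀ p, f p = c := by
  obtain ⟨e₀, he₀⟩ := h.exists_ne_zero hD
  have : Nonempty Γ.Edge := ⟨e₀⟩
  set k₀ := Real.pi / D with hk₀
  have hk₀pos : 0 < k₀ := div_pos Real.pi_pos hD
  have hk₀D : k₀ * D = Real.pi := div_mul_cancel₀ _ hD.ne'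
  have hkl₀ : ∀ e, k₀ * Γ.len e < Real.pi := fun e => by
    rw [← hk₀D]; exact mul_lt_mul_of_pos_left (hlen e) hk₀pos
  have hend : ∃ u v : EuclideanSpace ℝ Γ.Vert, LinearIndependent ℝ ![u, v] ∧
      ∀ a b : ℝ, inner ℝ (Γ.vertexOp k₀ (a • u + b • v)) (a • u + b • v) ≤ 0 := by
    refine ⟨WithLp.toLp 2 fun v => Real.cos (k₀ * x v), WithLp.toLp 2 fun v => Real.sin (k₀ * x v),
      ?_, fun a b => ?_⟩
    · rw [LinearIndependent.pair_iff]
      intro a b hab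
      have hv : ∀ v, a * Real.cos (k₀ * x v) + b * Real.sin (k₀ * x v) = 0 := fun v => by
        simpa using congrArg (fun w : EuclideanSpace ℝ Γ.Vert => w v) hab
      have ha : a = 0 := by
        have := hv p
        rw [h.start] at this
        simpa using this
      refine ⟨ha, ?_⟩
      -- some vertex lies strictly inside of the geodesic
      have hin : ∃ v, 0 < x v ∧ x v < D := by
        by_contra! hcon
        have hor : ∀ v, x v = 0 ∨ x v = D := fun v => by
          rcases (h.nonneg v).eq_or_lt with h1 | h1
          · exact Or.inl h1.symm
          · exact Or.inr (le_antisymm (h.le v) (hcon v h1))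
        have hsp := h.speed e₀
        have hl := hlen e₀
        have hl0 := Γ.len_pos e₀
        rcases hor (Γ.src e₀) with h1 | h1 <;> rcases hor (Γ.tgt e₀) with h2 | h2 <;>
          rcases h.unit e₀ with h3 | h3 | h3 <;>
          first
          | exact he₀ h3
          | (rw [h1, h2, h3] at hsp; linarith)
      obtain ⟨v, hv1, hv2⟩ := hin
      have := hv v
      rw [ha, zero_mul, zero_add] at this
      have hsin : 0 < Real.sin (k₀ * x v) := Real.sin_pos_of_pos_of_lt_pi (by positivity) (by
        rw [← hk₀D]; exact mul_lt_mul_of_pos_left hv2 hk₀pos)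
      exact (mul_eq_zero.1 this).resolve_right hsin.ne'
    · let W : Γ.Vert → ℝ := fun v => a * Real.cos (k₀ * x v) + b * Real.sin (k₀ * x v)
      let U : Γ.Vert → ℝ := fun v => b * Real.cos (k₀ * x v) - a * Real.sin (k₀ * x v)
      have hflow := h.flow (fun v => k₀ * (W v * U v))
      have hzero : k₀ * (W q * U q) - k₀ * (W p * U p) = 0 := by
        simp only [W, U, h.start, h.finish, hk₀D]
        simp
      rw [hzero] at hflow
      rw [inner_vertexOp, ← hflow]
      refine Finset.sum_le_sum fun e _ => ?_
      have hl0 := Γ.len_pos e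
      have hkl0 : 0 < k₀ * Γ.len e := mul_pos hk₀pos hl0
      have hsin : 0 < Real.sin (k₀ * Γ.len e) := Real.sin_pos_of_pos_of_lt_pi hkl0 (hkl₀ e)
      have hcs := Real.sin_sq_add_cos_sq (k₀ * Γ.len e)
      have hval : ∀ v, (a • (WithLp.toLp 2 fun v => Real.cos (k₀ * x v)) +
          b • (WithLp.toLp 2 fun v => Real.sin (k₀ * x v)) : EuclideanSpace ℝ Γ.Vert) v = W v :=
        fun v => by simp [W]
      simp only [hval]
      rw [Real.sinc_of_ne_zero hkl0.ne']
      -- transport of the solution along an edge of the geodesic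
      have step : ∀ v w, x w = x v + Γ.len e →
          W w = W v * Real.cos (k₀ * Γ.len e) + U v * Real.sin (k₀ * Γ.len e) ∧
          U w = U v * Real.cos (k₀ * Γ.len e) - W v * Real.sin (k₀ * Γ.len e) := by
        intro v w hvw
        simp only [W, U, hvw, mul_add, Real.cos_add, Real.sin_add]
        constructor <;> ring
      rcases h.unit e with he | he | he
      · have hx : x (Γ.tgt e) = x (Γ.src e) := by
          have := h.speed e
          rw [he] at this
          linarith
        have hW : W (Γ.tgt e) = W (Γ.src e) := by simp only [W, hx]
        rw [he, zero_mul, hW]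
        have hc1 := Real.cos_le_one (k₀ * Γ.len e)
        have hβ : 0 < Γ.len e * (Real.sin (k₀ * Γ.len e) / (k₀ * Γ.len e)) := by positivity
        have : Real.cos (k₀ * Γ.len e) / (Γ.len e * (Real.sin (k₀ * Γ.len e) / (k₀ * Γ.len e))) ≤
            1 / (Γ.len e * (Real.sin (k₀ * Γ.len e) / (k₀ * Γ.len e))) := by gcongr
        nlinarith [mul_le_mul_of_nonneg_right this (mul_self_nonneg (W (Γ.src e)))]
      · have hx := h.speed e
        rw [he] at hx
        obtain ⟨e1, e2⟩ := step (Γ.src e) (Γ.tgt e) (by linarith)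
        rw [he, e1, e2, edge_form_eq hk₀pos.ne' hl0.ne' hsin.ne' hcs]
        exact le_of_eq (by ring)
      · have hx := h.speed e
        rw [he] at hx
        obtain ⟨e1, e2⟩ := step (Γ.tgt e) (Γ.src e) (by linarith)
        have := edge_form_eq (W := W (Γ.tgt e)) (V := U (Γ.tgt e)) hk₀pos.ne' hl0.ne' hsin.ne' hcs
        rw [he, e1, e2]
        refine le_of_eq ?_
        rw [show ∀ z : ℝ, z * z + W (Γ.tgt e) * W (Γ.tgt e) = W (Γ.tgt e) * W (Γ.tgt e) + z * z
          from fun z => add_comm _ _, show ∀ z : ℝ, z * W (Γ.tgt e) + W (Γ.tgt e) * z =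
          W (Γ.tgt e) * z + z * W (Γ.tgt e) from fun z => add_comm _ _, this]
        ring
  have hstart : ¬ ∃ u v : EuclideanSpace ℝ Γ.Vert, LinearIndependent ℝ ![u, v] ∧
      ∀ a b : ℝ, inner ℝ (Γ.vertexOp 0 (a • u + b • v)) (a • u + b • v) ≤ 0 := by
    -- for `k = 0` the form is the sum of the `(u (src e) - u (tgt e))² / len e`
    rintro ⟨u, v, hli, hq⟩
    have hconst : ∀ w : EuclideanSpace ℝ Γ.Vert, inner ℝ (Γ.vertexOp 0 w) w ≤ 0 →
        ∀ a, w a = w p := by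
      intro w hw
      rw [inner_vertexOp] at hw
      have hterm : ∀ e, Real.cos (0 * Γ.len e) / (Γ.len e * Real.sinc (0 * Γ.len e)) *
          (w (Γ.src e) * w (Γ.src e) + w (Γ.tgt e) * w (Γ.tgt e)) -
          1 / (Γ.len e * Real.sinc (0 * Γ.len e)) *
          (w (Γ.src e) * w (Γ.tgt e) + w (Γ.tgt e) * w (Γ.src e)) =
          1 / Γ.len e * (w (Γ.src e) - w (Γ.tgt e)) ^ 2 := fun e => by
        rw [zero_mul, Real.cos_zero, Real.sinc_zero]
        ring
      simp only [hterm] at hw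
      have hnn : ∀ e ∈ Finset.univ, 0 ≤ 1 / Γ.len e * (w (Γ.src e) - w (Γ.tgt e)) ^ 2 :=
        fun e _ => by have := Γ.len_pos e; positivity
      have hz := (Finset.sum_eq_zero_iff_of_nonneg hnn).1 (le_antisymm hw (Finset.sum_nonneg hnn))
      intro a
      refine hΓ (fun v => w v) (fun e => ?_) a p
      have h1 := hz e (Finset.mem_univ e)
      have h2 : 1 / Γ.len e ≠ 0 := (one_div_pos.2 (Γ.len_pos e)).ne'
      exact sub_eq_zero.1 (pow_eq_zero_iff two_ne_zero |>.1 ((mul_eq_zero.1 h1).resolve_left h2))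
    have hu := hconst u (by simpa using hq 1 0)
    have hv := hconst v (by simpa using hq 0 1)
    rw [LinearIndependent.pair_iff] at hli
    have h1 := hli (v p) (-u p) (by ext a; simp [hu a, hv a]; ring)
    have h2 := hli 1 0 (by
      ext a
      have : u p = 0 := by linarith [h1.2]
      simp [hu a, this])
    exact one_ne_zero h2.1
  obtain ⟨k, hk, u, hu, hAu⟩ := exists_singular_of_nonpos_pair hk₀pos.le Γ.vertexOp
    (continuousOn_vertexOp hkl₀)
    (fun k _ u v => by
      rw [real_inner_comm _ u, inner_vertexOp, inner_vertexOp]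
      exact Finset.sum_congr rfl fun e _ => by ring) hend hstart
  have hkl : ∀ e, k * Γ.len e < Real.pi := fun e =>
    lt_of_le_of_lt (mul_le_mul_of_nonneg_right hk.2 (Γ.len_pos e).le) (hkl₀ e)
  obtain ⟨f, hf, hne⟩ := exists_eigenfunction_of_vertexOp_eq_zero hk.1 hkl hu hAu
  exact ⟨k, f, hk.1.le, hk.2, hf, hne⟩

/-- A single edge of length `D` has the eigenfunction `cos (π x / D)`. This is the case excluded
from `GeodFlow.exists_eigenfunction`, where the reduction to the vertices degenerates. -/
theorem GeodFlow.exists_eigenfunction_of_subsingleton [Subsingleton Γ.Edge] {p q : Γ.Vert} {D : ℝ}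
    {x : Γ.Vert → ℝ} {ε : Γ.Edge → ℝ} (h : Γ.GeodFlow p q D x ε) (hD : 0 < D) :
    ∃ f, Γ.IsNeumannLaplacian f (((Real.pi / D) ^ 2) • f) ∧ ¬ ∃ c, ∀ p, f p = c := by
  obtain ⟨e₀, he₀⟩ := h.exists_ne_zero hD
  have huniq : ∀ e, e = e₀ := fun e => Subsingleton.elim _ _
  set k := Real.pi / D with hk
  have hkD : k * D = Real.pi := div_mul_cancel₀ _ hD.ne'
  have hends : ∀ e, (x (Γ.src e) = 0 ∨ x (Γ.src e) = D) ∧ (x (Γ.tgt e) = 0 ∨ x (Γ.tgt e) = D) := by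
    intro e
    have h1 := h.flow x
    rw [h.start, h.finish, Finset.sum_eq_single_of_mem e (Finset.mem_univ e)
      (fun b _ hb => absurd (Subsingleton.elim b e) hb)] at h1
    have hs := h.nonneg (Γ.src e)
    have hs' := h.le (Γ.src e)
    have ht := h.nonneg (Γ.tgt e)
    have ht' := h.le (Γ.tgt e)
    rcases h.unit e with h2 | h2 | h2 <;> rw [h2] at h1
    · linarith
    · exact ⟨Or.inl (by linarith), Or.inr (by linarith)⟩
    · exact ⟨Or.inr (by linarith), Or.inl (by linarith)⟩
  have hsin : ∀ y, y = 0 ∨ y = D → Real.sin (k * y) = 0 := by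
    rintro y (rfl | rfl)
    · simp
    · rw [hkD, Real.sin_pi]
  have hd : ∀ (a b y : ℝ), HasDerivAt (fun y => k * (a + b * y)) (k * b) y := fun a b y => by
    simpa using (((hasDerivAt_id y).const_mul b).const_add a).const_mul k
  have hspeed : ∀ e, x (Γ.src e) + ε e * Γ.len e = x (Γ.tgt e) := fun e => by
    linarith [h.speed e]
  refine ⟨liftFun (fun v => Real.cos (k * x v))
    (fun e y => Real.cos (k * (x (Γ.src e) + ε e * y))) (by simp) (fun e => by rw [hspeed]),
    ?_, ?_⟩
  · refine isNeumannLaplacian_of_hasDerivAt (F := fun e y => Real.cos (k * (x (Γ.src e) + ε e * y)))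
      (F' := fun e y => -Real.sin (k * (x (Γ.src e) + ε e * y)) * (k * ε e))
      (fun e y hy => liftFun_pt _ _ _ _ e hy) (fun e y => (hd _ _ y).cos) (fun e y => ?_)
      fun H => ?_
    · refine ((hd (x (Γ.src e)) (ε e) y).sin.neg.mul_const (k * ε e)).congr_deriv ?_
      have h1 : ε e * ε e = 1 := h.sq_eq_one (by rw [huniq e]; exact he₀)
      linear_combination (-(k ^ 2 * Real.cos (k * (x (Γ.src e) + ε e * y)))) * h1
    · refine Finset.sum_eq_zero fun e _ => ?_
      rw [hspeed, mul_zero, add_zero, hsin _ (hends e).1, hsin _ (hends e).2]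
      ring
  · rintro ⟨c, hc⟩
    have h1 := hc (Γ.vert p)
    have h2 := hc (Γ.vert q)
    rw [liftFun_vert, h.start, mul_zero, Real.cos_zero] at h1
    rw [liftFun_vert, h.finish, hkD, Real.cos_pi] at h2
    linarith

end MetricGraph

namespace MetricGraph

/-! ### Metric stars -/

/-- The data which exhibit a metric tree as the equilateral star with `m ≥ 2` edges, up to vertices
of degree two: leaves, geodesics of length `2 / m` between any two of them (with positions `x` and
flows `ε`), such that all edges outside of the geodesic from `i` to `j` project to its midpoint, and
such that each edge lies exactly on the geodesics that involve some leaf `k`. The centre need not be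
a vertex (if `m = 2`). -/
structure StarData (Γ : MetricGraph.{u}) (m : ℕ) where
  leaf : Fin m → Γ.Vert
  x : Fin m → Fin m → Γ.Vert → ℝ
  ε : Fin m → Fin m → Γ.Edge → ℝ
  conn : Γ.IsConn
  geod : ∀ i j, i ≠ j → Γ.GeodFlow (leaf i) (leaf j) (2 / m) (x i j) (ε i j)
  proj : ∀ i j, i ≠ j → ∀ e, ε i j e = 0 → x i j (Γ.src e) = 1 / m
  owner : ∀ e, ∃ k, ∀ i j, i ≠ j → (ε i j e ≠ 0 ↔ k = i ∨ k = j)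

variable {Γ : MetricGraph.{u}}

/-! ### Green's formula -/

/-- The solutions `S`, `C` of `-w'' = μ w` with `S(0) = 0`, `S' = C`, `C(0) = 1`. -/
lemma exists_sin_cos_like {μ r : ℝ} (hr : 0 < r) (hμ : μ < (Real.pi / (2 * r)) ^ 2) :
    ∃ S C : ℝ → ℝ, (∀ y, HasDerivAt S (C y) y) ∧ (∀ y, HasDerivAt C (-(μ * S y)) y) ∧
      S 0 = 0 ∧ C 0 = 1 ∧ (∀ t ∈ Set.Icc 0 r, 0 < C t) ∧ (∀ t, C (-t) = C t) ∧
      (μ = 0 → ∀ t, C t = 1) := by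
  rcases lt_trichotomy μ 0 with h | h | h
  · have hs : 0 < √(-μ) := Real.sqrt_pos.2 (by linarith)
    have hsq : √(-μ) * √(-μ) = -μ := Real.mul_self_sqrt (by linarith)
    have d : ∀ y, HasDerivAt (fun y => √(-μ) * y) (√(-μ)) y := fun y => by
      simpa using (hasDerivAt_id y).const_mul √(-μ)
    refine ⟨fun y => Real.sinh (√(-μ) * y) / √(-μ), fun y => Real.cosh (√(-μ) * y),
      fun y => ?_, fun y => ?_, by simp, by simp, fun t _ => Real.cosh_pos _, fun t => by simp,
      fun h0 => absurd h0 h.ne⟩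
    · exact ((d y).sinh.div_const _).congr_deriv (by field_simp)
    · refine (d y).cosh.congr_deriv ?_
      field_simp
      linear_combination (Real.sinh (√(-μ) * y)) * hsq
  · subst h
    exact ⟨fun y => y, fun _ => 1, fun y => hasDerivAt_id y,
      fun y => by simpa using hasDerivAt_const y (1 : ℝ), rfl, rfl, fun _ _ => one_pos,
      fun _ => rfl, fun _ _ => rfl⟩
  · have hs : 0 < √μ := Real.sqrt_pos.2 h
    have hsq : √μ * √μ = μ := Real.mul_self_sqrt h.le
    have d : ∀ y, HasDerivAt (fun y => √μ * y) (√μ) y := fun y => by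
      simpa using (hasDerivAt_id y).const_mul √μ
    refine ⟨fun y => Real.sin (√μ * y) / √μ, fun y => Real.cos (√μ * y),
      fun y => ?_, fun y => ?_, by simp, by simp, fun t ht => ?_, fun t => by simp,
      fun h0 => absurd h0 h.ne'⟩
    · exact ((d y).sin.div_const _).congr_deriv (by field_simp)
    · refine (d y).cos.congr_deriv ?_
      field_simp
      linear_combination (-Real.sin (√μ * y)) * hsq
    · have h1 : √μ < Real.pi / (2 * r) := (Real.sqrt_lt' (by positivity)).2 hμ
      have h2 : √μ * t < Real.pi / 2 := by
        calc √μ * t ≤ √μ * r := mul_le_mul_of_nonneg_left ht.2 hs.le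
          _ < Real.pi / (2 * r) * r := mul_lt_mul_of_pos_right h1 hr
          _ = Real.pi / 2 := by field_simp
      exact Real.cos_pos_of_mem_Ioo ⟨by linarith [mul_nonneg hs.le ht.1, Real.pi_pos], h2⟩

/-- The regularity of an eigenfunction on an edge. -/
lemma hasDerivAt_of_integral_eq {F F' : ℝ → ℝ} {l μ : ℝ} (hl : 0 < l)
    (hF : ∀ x ∈ Set.Icc 0 l, F x = F 0 + ∫ t in (0 : ℝ)..x, F' t)
    (hF' : ∀ x ∈ Set.Icc 0 l, F' x = F' 0 + ∫ t in (0 : ℝ)..x, -(μ * F t))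
    (hint : MeasureTheory.IntegrableOn (fun x => μ * F x) (Set.Icc 0 l)) :
    ContinuousOn F (Set.Icc 0 l) ∧ ContinuousOn F' (Set.Icc 0 l) ∧
      (∀ y ∈ Set.Ioo 0 l, HasDerivAt F (F' y) y) ∧
      ∀ y ∈ Set.Ioo 0 l, HasDerivAt F' (-(μ * F y)) y := by
  have prim : ∀ g : ℝ → ℝ, MeasureTheory.IntegrableOn g (Set.Icc 0 l) → ∀ c : ℝ,
      ContinuousOn (fun x => c + ∫ t in (0 : ℝ)..x, g t) (Set.Icc 0 l) := fun g hg c =>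
    continuousOn_const.add (by
      have := intervalIntegral.continuousOn_primitive_interval (a := 0) (b := l) (f := g)
        (μ := MeasureTheory.volume) (by rwa [Set.uIcc_of_le hl.le])
      rwa [Set.uIcc_of_le hl.le] at this)
  have hF'c : ContinuousOn F' (Set.Icc 0 l) := (prim _ hint.neg (F' 0)).congr hF'
  have hFc : ContinuousOn F (Set.Icc 0 l) :=
    (prim _ (hF'c.integrableOn_Icc) (F 0)).congr hF
  have der : ∀ (G g : ℝ → ℝ) (c : ℝ), ContinuousOn g (Set.Icc 0 l) →
      (∀ x ∈ Set.Icc 0 l, G x = c + ∫ t in (0 : ℝ)..x, g t) →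
      ∀ y ∈ Set.Ioo 0 l, HasDerivAt G (g y) y := by
    intro G g c hg hG y hy
    have hnear : Set.Ioo 0 l ∈ nhds y := isOpen_Ioo.mem_nhds hy
    have hint : IntervalIntegrable g MeasureTheory.volume 0 y := by
      refine ContinuousOn.intervalIntegrable (hg.mono ?_)
      rw [Set.uIcc_of_le hy.1.le]
      exact Set.Icc_subset_Icc_right hy.2.le
    have h1 := intervalIntegral.integral_hasDerivAt_right hint
      ((hg.mono Set.Ioo_subset_Icc_self).stronglyMeasurableAtFilter isOpen_Ioo y hy)
      (hg.continuousAt (Icc_mem_nhds hy.1 hy.2))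
    refine (h1.const_add c).congr_of_eventuallyEq ?_
    filter_upwards [hnear] with z hz
    exact hG z ⟨hz.1.le, hz.2.le⟩
  exact ⟨hFc, hF'c, der F F' _ hF'c hF, der F' _ _ (hFc.const_mul μ).neg hF'⟩

/-- The Wronskian of two solutions of `-w'' = μ w` is constant. -/
lemma wronskian_const {F F' W W' : ℝ → ℝ} {l μ : ℝ}
    (hFc : ContinuousOn F (Set.Icc 0 l)) (hF'c : ContinuousOn F' (Set.Icc 0 l))
    (hF : ∀ y ∈ Set.Ioo 0 l, HasDerivAt F (F' y) y)
    (hF' : ∀ y ∈ Set.Ioo 0 l, HasDerivAt F' (-(μ * F y)) y)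
    (hW : ∀ y, HasDerivAt W (W' y) y) (hW' : ∀ y, HasDerivAt W' (-(μ * W y)) y)
    {y z : ℝ} (hy : y ∈ Set.Icc 0 l) (hz : z ∈ Set.Icc 0 l) :
    F' y * W y - F y * W' y = F' z * W z - F z * W' z := by
  have hWc : Continuous W := continuous_iff_continuousAt.2 fun y => (hW y).continuousAt
  have hW'c : Continuous W' := continuous_iff_continuousAt.2 fun y => (hW' y).continuousAt
  have hc : ContinuousOn (fun y => F' y * W y - F y * W' y) (Set.Icc 0 l) :=
    (hF'c.mul hWc.continuousOn).sub (hFc.mul hW'c.continuousOn)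
  have hd : ∀ y ∈ Set.Ioo 0 l, HasDerivAt (fun y => F' y * W y - F y * W' y) 0 y := fun y hy =>
    (((hF' y hy).mul (hW y)).sub ((hF y hy).mul (hW' y))).congr_deriv (by ring)
  have key : ∀ y ∈ Set.Icc 0 l, ∀ z ∈ Set.Icc 0 l, y < z →
      F' y * W y - F y * W' y = F' z * W z - F z * W' z := by
    intro y hy z hz hyz
    obtain ⟨c, hc1, hc2⟩ := exists_hasDerivAt_eq_slope (fun y => F' y * W y - F y * W' y)
      (fun _ => 0) hyz (hc.mono (Set.Icc_subset_Icc hy.1 hz.2))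
      (fun t ht => hd t ⟨hy.1.trans_lt ht.1, ht.2.trans_le hz.2⟩)
    have := (div_eq_zero_iff.1 hc2.symm).resolve_right (by linarith)
    linarith
  rcases lt_trichotomy y z with h | h | h
  · exact key y hy z hz h
  · rw [h]
  · exact (key z hz y hy h).symm

/-- An eigenfunction, with its derivatives on the edges, in classical terms: Kirchhoff's law is
tested against functions on the vertices. -/
structure ClassicalEigen (Γ : MetricGraph.{u}) (f : Γ.Point → ℝ) (μ : ℝ)
    (F' : Γ.Edge → ℝ → ℝ) : Prop where
  cont : ∀ e, ContinuousOn (fun y => f (Γ.pt e y)) (Set.Icc 0 (Γ.len e))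
  cont' : ∀ e, ContinuousOn (F' e) (Set.Icc 0 (Γ.len e))
  deriv : ∀ e, ∀ y ∈ Set.Ioo 0 (Γ.len e), HasDerivAt (fun y => f (Γ.pt e y)) (F' e y) y
  deriv' : ∀ e, ∀ y ∈ Set.Ioo 0 (Γ.len e), HasDerivAt (F' e) (-(μ * f (Γ.pt e y))) y
  integral : ∀ e, F' e (Γ.len e) - F' e 0 = -(μ * ∫ y in (0 : ℝ)..Γ.len e, f (Γ.pt e y))
  kirchhoff : ∀ w : Γ.Vert → ℝ,
    ∑ e, (w (Γ.src e) * F' e 0 - w (Γ.tgt e) * F' e (Γ.len e)) = 0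

lemma IsNeumannLaplacian.exists_classicalEigen {f : Γ.Point → ℝ} {μ : ℝ}
    (h : Γ.IsNeumannLaplacian f (μ • f)) : ∃ F', Γ.ClassicalEigen f μ F' := by
  classical
  obtain ⟨F', h1, h2, h3, h4⟩ := h
  have hreg := fun e => hasDerivAt_of_integral_eq (F := fun y => f (Γ.pt e y)) (μ := μ)
    (Γ.len_pos e) (h2 e) (h3 e) (by
      have := (h1 e).integrable (by norm_num)
      exact this)
  refine ⟨F', fun e => (hreg e).1, fun e => (hreg e).2.1, fun e => (hreg e).2.2.1,
    fun e => (hreg e).2.2.2, fun e => ?_, fun w => ?_⟩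
  · rw [h3 e _ (Γ.len_mem e), ← intervalIntegral.integral_const_mul, ← intervalIntegral.integral_neg]
    simp
  · have : ∑ v, w v * ∑ e, ((if Γ.src e = v then F' e 0 else 0) +
      (if Γ.tgt e = v then -F' e (Γ.len e) else 0)) = 0 :=
      Finset.sum_eq_zero fun v _ => by
        have := h4 v
        convert mul_zero (w v)
    simp only [Finset.mul_sum] at this
    rw [Finset.sum_comm] at this
    refine Eq.trans (Finset.sum_congr rfl fun e _ => ?_) this
    simp only [mul_add, Finset.sum_add_distrib, mul_ite, mul_zero, Finset.sum_ite_eq,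
      Finset.mem_univ, if_true]
    ring

namespace ClassicalEigen

variable {f : Γ.Point → ℝ} {μ : ℝ} {F' : Γ.Edge → ℝ → ℝ}

/-- The Wronskian with `y ↦ S (a - b y)`, where `b = ±1`. -/
lemma wronskian (hf : Γ.ClassicalEigen f μ F') {S C : ℝ → ℝ}
    (hS : ∀ y, HasDerivAt S (C y) y) (hC : ∀ y, HasDerivAt C (-(μ * S y)) y)
    (e : Γ.Edge) (a : ℝ) {b : ℝ} (hb : b * b = 1) {y z : ℝ} (hy : y ∈ Set.Icc 0 (Γ.len e))
    (hz : z ∈ Set.Icc 0 (Γ.len e)) :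
    F' e y * S (a - b * y) + b * (f (Γ.pt e y) * C (a - b * y)) =
      F' e z * S (a - b * z) + b * (f (Γ.pt e z) * C (a - b * z)) := by
  have hd : ∀ y, HasDerivAt (fun y => a - b * y) (-b) y := fun y => by
    simpa using ((hasDerivAt_id y).const_mul b).const_sub a
  have := wronskian_const (W := fun y => S (a - b * y)) (W' := fun y => C (a - b * y) * -b)
    (hf.cont e) (hf.cont' e) (hf.deriv e) (hf.deriv' e)
    (fun y => (hS _).comp y (hd y))
    (fun y => (((hC _).comp y (hd y)).mul_const (-b)).congr_deriv (by
      linear_combination (-(μ * S (a - b * y))) * hb)) hy hz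
  linarith

variable {p q : Γ.Vert} {r : ℝ} {x : Γ.Vert → ℝ} {ε : Γ.Edge → ℝ}

/-- Green's formula for an eigenfunction and `S (r - x)`, where `x` is the position along a geodesic
of length `2 r` all of whose side branches start at its midpoint: the values of the eigenfunction at
the two ends of the geodesic agree. -/
lemma eq_of_geodFlow (hf : Γ.ClassicalEigen f μ F') {S C : ℝ → ℝ}
    (hS : ∀ y, HasDerivAt S (C y) y) (hC : ∀ y, HasDerivAt C (-(μ * S y)) y) (hS0 : S 0 = 0)
    (hCpos : 0 < C r) (hCeven : C (-r) = C r)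
    (h : Γ.GeodFlow p q (2 * r) x ε) (hproj : ∀ e, ε e = 0 → x (Γ.src e) = r) :
    f (Γ.vert p) = f (Γ.vert q) := by
  have hk := hf.kirchhoff (fun v => S (r - x v))
  have hfl := h.flow (fun v => f (Γ.vert v) * C (r - x v))
  have : ∀ e, S (r - x (Γ.src e)) * F' e 0 - S (r - x (Γ.tgt e)) * F' e (Γ.len e) =
      ε e * (f (Γ.vert (Γ.tgt e)) * C (r - x (Γ.tgt e)) -
        f (Γ.vert (Γ.src e)) * C (r - x (Γ.src e))) := by
    intro e
    have hsp := h.speed e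
    by_cases he : ε e = 0
    · have h1 := hproj e he
      have h2 : x (Γ.tgt e) = r := by rw [he] at hsp; linarith
      rw [h1, h2, he, sub_self, hS0]
      ring
    · have h1 := hf.wronskian hS hC e (r - x (Γ.src e)) (h.sq_eq_one he) (Γ.zero_mem e)
        (Γ.len_mem e)
      rw [pt_zero, pt_len, mul_zero, sub_zero,
        show r - x (Γ.src e) - ε e * Γ.len e = r - x (Γ.tgt e) by linarith] at h1
      linarith
  rw [Finset.sum_congr rfl fun e _ => this e, hfl, h.start, h.finish, sub_zero,
    show r - 2 * r = -r by ring, hCeven, ← sub_mul] at hk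
  linarith [(mul_eq_zero.1 hk).resolve_right hCpos.ne']

/-- Green's formula for an eigenfunction and the function that equals `S (t - x)` up to the position
`t` and vanishes beyond: on the first half of the geodesic, the eigenfunction is the multiple of `C`
determined by its value at the starting point. -/
lemma eq_mul_of_geodFlow (hf : Γ.ClassicalEigen f μ F') {S C : ℝ → ℝ}
    (hS : ∀ y, HasDerivAt S (C y) y) (hC : ∀ y, HasDerivAt C (-(μ * S y)) y) (hS0 : S 0 = 0)
    (hC0 : C 0 = 1) {D : ℝ}
    (h : Γ.GeodFlow p q D x ε) (hproj : ∀ e, ε e = 0 → x (Γ.src e) = r) (hrD : r ≤ D)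
    {e₀ : Γ.Edge} (he₀ : ε e₀ ≠ 0) {y : ℝ} (hy : y ∈ Set.Ioo 0 (Γ.len e₀))
    (ht : x (Γ.src e₀) + ε e₀ * y ≤ r) :
    f (Γ.pt e₀ y) = f (Γ.vert p) * C (x (Γ.src e₀) + ε e₀ * y) := by
  classical
  set t := x (Γ.src e₀) + ε e₀ * y with htdef
  have htpos : 0 < t := by
    have h1 := h.nonneg (Γ.src e₀)
    have h2 := h.nonneg (Γ.tgt e₀)
    have h3 := h.speed e₀
    rcases h.unit e₀ with h4 | h4 | h4
    · exact absurd h4 he₀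
    · rw [htdef, h4]; linarith [hy.1]
    · rw [h4] at h3; rw [htdef, h4]; linarith [hy.2]
  let ind : Γ.Vert → ℝ := fun v => if t ≤ x v then 1 else 0
  let H : Γ.Vert → ℝ := fun v => if t ≤ x v then 0 else -(f (Γ.vert v) * C (t - x v))
  let w : Γ.Vert → ℝ := fun v => if t ≤ x v then 0 else S (t - x v)
  let cross : Γ.Edge → ℝ := fun e => ε e * (ind (Γ.tgt e) - ind (Γ.src e))
  let Φ : Γ.Edge → ℝ := fun e => f (Γ.pt e (ε e * (t - x (Γ.src e))))
  have hcross₀ : cross e₀ = 1 := by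
    have h3 := h.speed e₀
    simp only [cross, ind]
    rcases h.unit e₀ with h4 | h4 | h4
    · exact absurd h4 he₀
    · rw [h4] at h3 htdef ⊢
      rw [if_pos (by linarith [hy.2]), if_neg (by linarith [hy.1])]; norm_num
    · rw [h4] at h3 htdef ⊢
      rw [if_neg (by linarith [hy.2]), if_pos (by linarith [hy.1])]; norm_num
  have hcross_ne : ∀ e, e ≠ e₀ → cross e = 0 := by
    obtain ⟨e₁, h1, h2⟩ := h.exists_cross htpos (ht.trans hrD)
    intro e he
    by_cases he₁ : e₀ = e₁
    · exact h2 e (he₁ ▸ he)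
    · exact absurd (hcross₀.symm.trans (h2 e₀ he₁)) one_ne_zero
  have hedge : ∀ e, w (Γ.src e) * F' e 0 - w (Γ.tgt e) * F' e (Γ.len e) =
      cross e * Φ e - ε e * (H (Γ.tgt e) - H (Γ.src e)) := by
    intro e
    have hsp := h.speed e
    have hl := Γ.len_pos e
    by_cases he : ε e = 0
    · have h1 := hproj e he
      have h2 : x (Γ.tgt e) = r := by rw [he] at hsp; linarith
      simp only [w, H, cross, h1, h2, if_pos ht, he]
      ring
    · have hb := h.sq_eq_one he
      have hW := fun {z z'} hz hz' => hf.wronskian hS hC e (t - x (Γ.src e)) hb (y := z) (z := z')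
        hz hz'
      have hend : t - x (Γ.src e) - ε e * Γ.len e = t - x (Γ.tgt e) := by linarith
      have hmid : t - x (Γ.src e) - ε e * (ε e * (t - x (Γ.src e))) = 0 := by
        linear_combination (-(t - x (Γ.src e))) * hb
      by_cases hs : t ≤ x (Γ.src e) <;> by_cases ht' : t ≤ x (Γ.tgt e)
      · simp only [w, H, cross, ind, if_pos hs, if_pos ht']
        ring
      · -- the flow crosses the position `t` on this edge, from the target to the source
        have hε : ε e = -1 := by
          rcases h.unit e with h4 | h4 | h4
          · exact absurd h4 he
          · rw [h4] at hsp; linarith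
          · exact h4
        have h1 := hW (Γ.len_mem e) (z' := ε e * (t - x (Γ.src e)))
          ⟨by rw [hε]; linarith, by rw [hε] at hsp ⊢; linarith⟩
        rw [hend, hmid, hS0, hC0, pt_len] at h1
        simp only [w, H, cross, ind, Φ, if_pos hs, if_neg ht']
        rw [hε] at h1 ⊢
        linarith
      · have hε : ε e = 1 := by
          rcases h.unit e with h4 | h4 | h4
          · exact absurd h4 he
          · exact h4
          · rw [h4] at hsp; linarith
        have h1 := hW (Γ.zero_mem e) (z' := ε e * (t - x (Γ.src e)))
          ⟨by rw [hε]; linarith, by rw [hε] at hsp ⊢; linarith⟩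
        rw [hmid, hS0, hC0, pt_zero, mul_zero, sub_zero] at h1
        simp only [w, H, cross, ind, Φ, if_neg hs, if_pos ht']
        rw [hε] at h1 ⊢
        linarith
      · have h1 := hW (Γ.zero_mem e) (Γ.len_mem e)
        rw [hend, pt_zero, pt_len, mul_zero, sub_zero] at h1
        simp only [w, H, cross, ind, if_neg hs, if_neg ht']
        linarith
  have hk := hf.kirchhoff w
  rw [Finset.sum_congr rfl fun e _ => hedge e, Finset.sum_sub_distrib, h.flow H,
    Finset.sum_eq_single_of_mem e₀ (Finset.mem_univ _) (fun e _ he => by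
      rw [hcross_ne e he, zero_mul]), hcross₀] at hk
  have hΦ : Φ e₀ = f (Γ.pt e₀ y) := by
    simp only [Φ, htdef]
    congr 2
    linear_combination y * h.sq_eq_one he₀
  simp only [H, h.start, h.finish, if_pos (ht.trans hrD), if_neg (not_le.2 htpos), sub_zero] at hk
  linarith

end ClassicalEigen

/-- On a metric star with `m` edges of length `1 / m`, the eigenfunctions below `(π m / 2)²` are
constant. -/
theorem StarData.eq_const {m : ℕ} (s : StarData Γ m) (hm : 2 ≤ m) {f : Γ.Point → ℝ} {μ : ℝ}
    (hμ : μ < (Real.pi / 2 * m) ^ 2) (hf : Γ.IsNeumannLaplacian f (μ • f)) :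
    ∃ c, ∀ p, f p = c := by
  have hm0 : (0 : ℝ) < m := by exact_mod_cast (by omega : 0 < m)
  obtain ⟨F', hF⟩ := hf.exists_classicalEigen
  have hr : (0 : ℝ) < 1 / m := by positivity
  obtain ⟨S, C, hS, hC, hS0, hC0, hCpos, hCe, hCone⟩ := exists_sin_cos_like (μ := μ) hr (by
    rwa [show Real.pi / (2 * (1 / (m : ℝ))) = Real.pi / 2 * m by field_simp])
  have h2r : (2 : ℝ) / m = 2 * (1 / m) := by ring
  have hle : (1 : ℝ) / m ≤ 2 / m := by rw [h2r]; linarith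
  have hleaf : ∀ i j, f (Γ.vert (s.leaf i)) = f (Γ.vert (s.leaf j)) := by
    intro i j
    by_cases hij : i = j
    · rw [hij]
    · exact hF.eq_of_geodFlow hS hC hS0 (hCpos _ ⟨hr.le, le_rfl⟩) (hCe _)
        (h2r ▸ s.geod i j hij) (s.proj i j hij)
  set a := f (Γ.vert (s.leaf ⟨0, by omega⟩)) with ha
  -- inside of the edges the eigenfunction has the sign of its value at the leaves
  have hval : ∀ e, ∀ y ∈ Set.Ioo 0 (Γ.len e), ∃ t ∈ Set.Icc (0 : ℝ) (1 / m),
      f (Γ.pt e y) = a * C t := by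
    intro e y hy
    obtain ⟨k, hk⟩ := s.owner e
    obtain ⟨j, hj⟩ : ∃ j, k ≠ j := by
      have : Nontrivial (Fin m) := Fin.nontrivial_iff_two_le.2 hm
      exact (exists_ne k).imp fun j h => h.symm
    have hε := (hk k j hj).2 (Or.inl rfl)
    have hmem := (s.geod k j hj).pos_mem e (Set.Ioo_subset_Icc_self hy)
    by_cases ht : s.x k j (Γ.src e) + s.ε k j e * y ≤ 1 / m
    · refine ⟨_, ⟨hmem.1, ht⟩, ?_⟩
      rw [hF.eq_mul_of_geodFlow hS hC hS0 hC0 (s.geod k j hj) (s.proj k j hj) hle hε hy ht,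
        hleaf k]
    · have hrev := (s.geod k j hj).reverse
      have ht' : 2 / m - s.x k j (Γ.src e) + -s.ε k j e * y ≤ 1 / m := by rw [h2r]; linarith
      refine ⟨_, ⟨(hrev.pos_mem e (Set.Ioo_subset_Icc_self hy)).1, ht'⟩, ?_⟩
      rw [hF.eq_mul_of_geodFlow hS hC hS0 hC0 hrev (fun e he => by
        rw [s.proj k j hj e (neg_eq_zero.1 he), h2r]; ring) hle (neg_ne_zero.2 hε) hy ht',
        hleaf j]
  obtain ⟨c, hc⟩ : ∃ c, ∀ e, ∀ y ∈ Set.Ioo 0 (Γ.len e), f (Γ.pt e y) = c := by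
    by_cases hμ0 : μ = 0
    · refine ⟨a, fun e y hy => ?_⟩
      obtain ⟨t, -, ht⟩ := hval e y hy
      rw [ht, hCone hμ0, mul_one]
    · have ha0 : a = 0 := by
        by_contra ha0
        have hk := hF.kirchhoff (fun _ => 1)
        have hpos : 0 < ∑ e, ∫ y in (0 : ℝ)..Γ.len e, a * f (Γ.pt e y) := by
          have : Nontrivial (Fin m) := Fin.nontrivial_iff_two_le.2 hm
          obtain ⟨i, j, hij⟩ := exists_pair_ne (Fin m)
          obtain ⟨e, -⟩ := (s.geod i j hij).exists_ne_zero (by positivity)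
          refine Finset.sum_pos (fun e _ => ?_) ⟨e, Finset.mem_univ _⟩
          refine intervalIntegral.intervalIntegral_pos_of_pos_on ?_ (fun y hy => ?_) (Γ.len_pos e)
          · refine ContinuousOn.intervalIntegrable ?_
            rw [Set.uIcc_of_le (Γ.len_pos e).le]
            exact continuousOn_const.mul (hF.cont e)
          · obtain ⟨t, ht, h⟩ := hval e y hy
            rw [h, ← mul_assoc]
            exact mul_pos (mul_self_pos.2 ha0) (hCpos t ht)
        have hsum : ∑ e, ∫ y in (0 : ℝ)..Γ.len e, f (Γ.pt e y) = 0 := by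
          have h1 : μ * ∑ e, ∫ y in (0 : ℝ)..Γ.len e, f (Γ.pt e y) = 0 := by
            rw [Finset.mul_sum]
            exact Eq.trans (Finset.sum_congr rfl fun e _ => by linarith [hF.integral e]) hk
          exact (mul_eq_zero.1 h1).resolve_left hμ0
        simp only [intervalIntegral.integral_const_mul, ← Finset.mul_sum, hsum, mul_zero,
          lt_self_iff_false] at hpos
      refine ⟨0, fun e y hy => ?_⟩
      obtain ⟨t, -, ht⟩ := hval e y hy
      rw [ht, ha0, zero_mul]
  have hc' : ∀ e, ∀ y ∈ Set.Icc 0 (Γ.len e), f (Γ.pt e y) = c := by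
    intro e
    have hcl : Set.Icc 0 (Γ.len e) ⊆ closure (Set.Ioo 0 (Γ.len e)) := by
      rw [closure_Ioo (Γ.len_pos e).ne]
    exact Set.EqOn.of_subset_closure (hc e) (hF.cont e) continuousOn_const
      Set.Ioo_subset_Icc_self hcl
  have hne : Nonempty Γ.Edge := by
    have : Nontrivial (Fin m) := Fin.nontrivial_iff_two_le.2 hm
    obtain ⟨i, j, hij⟩ := exists_pair_ne (Fin m)
    exact ((s.geod i j hij).exists_ne_zero (by positivity)).nonempty
  refine ⟨c, fun p => ?_⟩
  obtain ⟨e, y, hy, rfl⟩ := s.conn.exists_pt p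
  exact hc' e y hy

end MetricGraph

namespace MetricGraph

variable {Γ : MetricGraph.{u}}

/-! ### Geodesics as curves -/

/-- The flow `ε` runs on the edge `e` from its end `a` to its end `b`. -/
def Runs (ε : Γ.Edge → ℝ) (e : Γ.Edge) (a b : Γ.Vert) : Prop :=
  (ε e = 1 ∧ a = Γ.src e ∧ b = Γ.tgt e) ∨ (ε e = -1 ∧ a = Γ.tgt e ∧ b = Γ.src e)

namespace GeodFlow

variable {p q : Γ.Vert} {D : ℝ} {x : Γ.Vert → ℝ} {ε : Γ.Edge → ℝ}

lemma exists_runs (h : Γ.GeodFlow p q D x ε) {e : Γ.Edge} (he : ε e ≠ 0) :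
    ∃ a b, Runs ε e a b := by
  rcases h.unit e with h1 | h1 | h1
  · exact absurd h1 he
  · exact ⟨_, _, Or.inl ⟨h1, rfl, rfl⟩⟩
  · exact ⟨_, _, Or.inr ⟨h1, rfl, rfl⟩⟩

lemma _root_.MetricGraph.Runs.neg {e : Γ.Edge} {a b : Γ.Vert} (hr : Runs ε e a b) :
    Runs (fun e => -ε e) e b a := by
  rcases hr with ⟨h1, h2, h3⟩ | ⟨h1, h2, h3⟩
  · exact Or.inr ⟨by simp [h1], h3, h2⟩
  · exact Or.inl ⟨by simp [h1], h3, h2⟩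

lemma _root_.MetricGraph.Runs.ne_zero {e : Γ.Edge} {a b : Γ.Vert} (hr : Runs ε e a b) :
    ε e ≠ 0 := by
  rcases hr with ⟨h1, -, -⟩ | ⟨h1, -, -⟩ <;> rw [h1] <;> norm_num

lemma _root_.MetricGraph.Runs.flow_eq {e : Γ.Edge} {a b : Γ.Vert} (hr : Runs ε e a b)
    (H : Γ.Vert → ℝ) : ε e * (H (Γ.tgt e) - H (Γ.src e)) = H b - H a := by
  rcases hr with ⟨h1, h2, h3⟩ | ⟨h1, h2, h3⟩ <;> rw [h1, h2, h3] <;> ring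

lemma x_far (h : Γ.GeodFlow p q D x ε) {e : Γ.Edge} {a b : Γ.Vert} (hr : Runs ε e a b) :
    x b = x a + Γ.len e := by
  have := h.speed e
  rcases hr with ⟨h1, h2, h3⟩ | ⟨h1, h2, h3⟩ <;> rw [h1] at this <;> rw [h2, h3] <;> linarith

/-- The point of the edge `e` at position `t`. -/
noncomputable def ptAt (x : Γ.Vert → ℝ) (ε : Γ.Edge → ℝ) (e : Γ.Edge) (t : ℝ) : Γ.Point :=
  Γ.pt e (ε e * (t - x (Γ.src e)))

lemma ptAt_near (h : Γ.GeodFlow p q D x ε) {e : Γ.Edge} {a b : Γ.Vert} (hr : Runs ε e a b) :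
    ptAt x ε e (x a) = Γ.vert a := by
  have := h.speed e
  unfold ptAt
  rcases hr with ⟨h1, h2, h3⟩ | ⟨h1, h2, h3⟩
  · rw [h2, sub_self, mul_zero, pt_zero]
  · rw [h2, this, h1, ← pt_len]; congr 1; ring

lemma ptAt_far (h : Γ.GeodFlow p q D x ε) {e : Γ.Edge} {a b : Γ.Vert} (hr : Runs ε e a b) :
    ptAt x ε e (x b) = Γ.vert b := by
  have := h.speed e
  unfold ptAt
  rcases hr with ⟨h1, h2, h3⟩ | ⟨h1, h2, h3⟩
  · rw [h3, this, h1, ← pt_len]; congr 1; ring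
  · rw [h3, sub_self, mul_zero, pt_zero]

lemma coord_mem (h : Γ.GeodFlow p q D x ε) {e : Γ.Edge} {a b : Γ.Vert} (hr : Runs ε e a b)
    {t : ℝ} (ht : t ∈ Set.Icc (x a) (x b)) : ε e * (t - x (Γ.src e)) ∈ Set.Icc 0 (Γ.len e) := by
  have h0 := h.speed e
  obtain ⟨ht1, ht2⟩ := ht
  rcases hr with ⟨h1, h2, h3⟩ | ⟨h1, h2, h3⟩ <;> rw [h2] at ht1 <;> rw [h3] at ht2 <;>
    rw [h1] at h0 ⊢ <;> constructor <;> linarith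

lemma path_ptAt (h : Γ.GeodFlow p q D x ε) {e : Γ.Edge} {a b : Γ.Vert} (hr : Runs ε e a b)
    {s t : ℝ} (hs : s ∈ Set.Icc (x a) (x b)) (ht : t ∈ Set.Icc (x a) (x b)) (hst : s ≤ t) :
    Γ.Path (ptAt x ε e s) (ptAt x ε e t) (t - s) := by
  have := Path.single e (h.coord_mem hr hs) (h.coord_mem hr ht)
  rw [← mul_sub, abs_mul, sub_sub_sub_cancel_right,
    show |ε e| = 1 by rcases hr with ⟨h1, -, -⟩ | ⟨h1, -, -⟩ <;> simp [h1], one_mul, abs_sub_comm,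
    abs_of_nonneg (by linarith)] at this
  exact this

lemma ptAt_pos (h : Γ.GeodFlow p q D x ε) {e : Γ.Edge} (he : ε e ≠ 0) (y : ℝ) :
    ptAt x ε e (x (Γ.src e) + ε e * y) = Γ.pt e y := by
  unfold ptAt
  congr 1
  linear_combination y * h.sq_eq_one he

lemma pos_mem_of_runs (h : Γ.GeodFlow p q D x ε) {e : Γ.Edge} {a b : Γ.Vert} (hr : Runs ε e a b)
    {y : ℝ} (hy : y ∈ Set.Icc 0 (Γ.len e)) :
    x (Γ.src e) + ε e * y ∈ Set.Icc (x a) (x b) := by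
  have h0 := h.speed e
  obtain ⟨hy1, hy2⟩ := hy
  rcases hr with ⟨h1, h2, h3⟩ | ⟨h1, h2, h3⟩ <;> rw [h2, h3] <;>
    rw [h1] at h0 ⊢ <;> constructor <;> linarith

/-- Conservation of the flow: it leaves each vertex that it reaches, except for the final one. -/
lemma exists_out (h : Γ.GeodFlow p q D x ε) {v : Γ.Vert} (hvq : v ≠ q)
    (hv : v = p ∨ ∃ e a, Runs ε e a v) : ∃ e b, Runs ε e v b := by
  classical
  by_contra! hcon
  have hfl := h.flow (fun w => if w = v then 1 else 0)
  have hnn : ∀ e, (0 : ℝ) ≤ ε e *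
      ((if Γ.tgt e = v then 1 else 0) - (if Γ.src e = v then 1 else 0)) := by
    intro e
    by_cases he : ε e = 0
    · simp [he]
    · obtain ⟨a, b, hr⟩ := h.exists_runs he
      have ha : a ≠ v := by
        rintro rfl
        exact hcon e b hr
      rw [hr.flow_eq (fun w => if w = v then 1 else 0)]
      simp only [if_neg ha, sub_zero]
      split_ifs <;> norm_num
  rw [if_neg hvq.symm] at hfl
  by_cases hvp : v = p
  · rw [if_pos hvp.symm] at hfl
    have := Finset.sum_nonneg fun e (_ : e ∈ Finset.univ) => hnn e
    linarith
  · rw [if_neg (Ne.symm hvp), sub_zero] at hfl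
    obtain ⟨e, a, hr⟩ := hv.resolve_left hvp
    have h1 := (Finset.sum_eq_zero_iff_of_nonneg fun e _ => hnn e).1 hfl e (Finset.mem_univ e)
    rw [hr.flow_eq (fun w => if w = v then 1 else 0)] at h1
    have ha : a ≠ v := by
      rintro rfl
      exact hcon e a hr
    simp [ha] at h1

lemma exists_in (h : Γ.GeodFlow p q D x ε) {v : Γ.Vert} (hvp : v ≠ p)
    (hv : v = q ∨ ∃ e b, Runs ε e v b) : ∃ e a, Runs ε e a v := by
  obtain ⟨e, a, hr⟩ := h.reverse.exists_out hvp (hv.imp_right fun ⟨e, b, hr⟩ => ⟨e, b, hr.neg⟩)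
  exact ⟨e, a, by simpa using hr.neg⟩

lemma cross_unique (h : Γ.GeodFlow p q D x ε) {t : ℝ} {e e' : Γ.Edge} {a b a' b' : Γ.Vert}
    (hr : Runs ε e a b) (hr' : Runs ε e' a' b') (hat : x a < t) (htb : t ≤ x b)
    (hat' : x a' < t) (htb' : t ≤ x b') : e = e' := by
  obtain ⟨e₀, -, h2⟩ := h.exists_cross ((h.nonneg a).trans_lt hat) (htb.trans (h.le b))
  have key : ∀ {e a b}, Runs ε e a b → x a < t → t ≤ x b → e = e₀ := by
    intro e a b hr ha hb
    by_contra hne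
    have := h2 e hne
    rw [hr.flow_eq (fun v => if t ≤ x v then 1 else 0)] at this
    simp [hb, not_le.2 ha] at this
  rw [key hr hat htb, key hr' hat' htb']

/-- Following the flow, one reaches each later position along a path of the right length. -/
lemma exists_path_cross (h : Γ.GeodFlow p q D x ε) (n : ℕ) : ∀ (v : Γ.Vert),
    {w | x v < x w}.ncard ≤ n → (v = p ∨ ∃ e a, Runs ε e a v) → ∀ t, x v < t → t ≤ D →
    ∃ e a b, Runs ε e a b ∧ x a < t ∧ t ≤ x b ∧ Γ.Path (Γ.vert v) (ptAt x ε e t) (t - x v) := by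
  induction n with
  | zero =>
    intro v hn hv t hvt htD
    have hvq : v ≠ q := by
      rintro rfl
      rw [h.finish] at hvt; linarith
    obtain ⟨e, b, hr⟩ := h.exists_out hvq hv
    have hb := h.x_far hr
    have hl := Γ.len_pos e
    have : b ∈ {w | x v < x w} := by simp only [Set.mem_ofPred_eq]; linarith
    rw [Nat.le_zero, Set.ncard_eq_zero] at hn
    rw [hn] at this
    exact absurd this (Set.notMem_empty _)
  | succ n ih =>
    intro v hn hv t hvt htD
    have hvq : v ≠ q := by
      rintro rfl
      rw [h.finish] at hvt; linarith
    obtain ⟨e, b, hr⟩ := h.exists_out hvq hv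
    have hb := h.x_far hr
    have hl := Γ.len_pos e
    by_cases htb : t ≤ x b
    · refine ⟨e, v, b, hr, hvt, htb, ?_⟩
      rw [← h.ptAt_near hr]
      exact h.path_ptAt hr ⟨le_rfl, by linarith⟩ ⟨hvt.le, htb⟩ hvt.le
    · have hlt : {w | x b < x w}.ncard < {w | x v < x w}.ncard := by
        refine Set.ncard_lt_ncard ⟨fun w hw => ?_, fun hsub => ?_⟩
        · simp only [Set.mem_ofPred_eq] at hw ⊢; linarith
        · have h1 : b ∈ {w | x v < x w} := by simp only [Set.mem_ofPred_eq]; linarith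
          exact lt_irrefl (x b) (hsub h1)
      obtain ⟨e', a', b', hr', h1, h2, h3⟩ := ih b (by omega) (Or.inr ⟨e, v, hr⟩) t
        (not_le.1 htb) htD
      refine ⟨e', a', b', hr', h1, h2, ?_⟩
      have h4 := h.path_ptAt hr (s := x v) (t := x b) ⟨le_rfl, by linarith⟩
        ⟨by linarith, le_rfl⟩ (by linarith)
      rw [h.ptAt_near hr, h.ptAt_far hr] at h4
      convert h4.trans h3 using 1
      ring

/-- Two points of a geodesic at the same positive position coincide. -/
lemma ptAt_eq_of_cross (h : Γ.GeodFlow p q D x ε) {t : ℝ} {e e' : Γ.Edge} {a b a' b' : Γ.Vert}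
    (hr : Runs ε e a b) (hr' : Runs ε e' a' b') (hat : x a < t) (htb : t ≤ x b)
    (hat' : x a' ≤ t) (htb' : t ≤ x b') : ptAt x ε e t = ptAt x ε e' t := by
  rcases hat'.lt_or_eq with h1 | h1
  · rw [h.cross_unique hr hr' hat htb h1 htb']
  · have ha'p : a' ≠ p := by
      rintro rfl
      have := h.nonneg a
      rw [h.start] at h1
      linarith
    obtain ⟨e₃, c, hr₃⟩ := h.exists_in ha'p (Or.inr ⟨e', b', hr'⟩)
    have hx := h.x_far hr₃
    have hl := Γ.len_pos e₃
    rw [h.cross_unique hr hr₃ hat htb (by linarith) h1.ge, ← h1, h.ptAt_far hr₃, h.ptAt_near hr']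

/-- A geodesic, parametrized by arc length. -/
lemma exists_curve (h : Γ.GeodFlow p q D x ε) (hD : 0 < D) : ∃ γ : ℝ → Γ.Point,
    (∀ e, ε e ≠ 0 → ∀ y ∈ Set.Icc 0 (Γ.len e), γ (x (Γ.src e) + ε e * y) = Γ.pt e y) ∧
    (∀ t ∈ Set.Icc 0 D, ∃ e, ε e ≠ 0 ∧ ∃ y ∈ Set.Icc 0 (Γ.len e), x (Γ.src e) + ε e * y = t) ∧
    (∀ s ∈ Set.Icc 0 D, ∀ t ∈ Set.Icc 0 D, s ≤ t → Γ.Path (γ s) (γ t) (t - s)) ∧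
    γ 0 = Γ.vert p ∧ γ D = Γ.vert q := by
  have hpq : p ≠ q := by
    rintro rfl
    have h1 := h.start
    rw [h.finish] at h1
    linarith
  -- at position zero there is only the starting point
  have hzero : ∀ e a b, Runs ε e a b → x a = 0 → a = p := by
    intro e a b hr ha
    by_contra hap
    obtain ⟨e', c, hr'⟩ := h.exists_in hap (Or.inr ⟨e, b, hr⟩)
    have := h.x_far hr'
    linarith [h.nonneg c, Γ.len_pos e']
  have hcross : ∀ t, 0 < t → t ≤ D → ∃ e a b, Runs ε e a b ∧ x a < t ∧ t ≤ x b := by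
    intro t ht htD
    obtain ⟨e, a, b, h1, h2, h3, -⟩ := h.exists_path_cross _ p le_rfl (Or.inl rfl) t
      (by rwa [h.start]) htD
    exact ⟨e, a, b, h1, h2, h3⟩
  -- each position is attained, and all points at the same position coincide
  have hex : ∀ t ∈ Set.Icc 0 D, ∃ e a b, Runs ε e a b ∧ x a ≤ t ∧ t ≤ x b := by
    intro t ht
    rcases ht.1.eq_or_lt with h1 | h1
    · obtain ⟨e, b, hr⟩ := h.exists_out hpq (Or.inl rfl)
      have := h.x_far hr
      exact ⟨e, p, b, hr, by rw [h.start]; exact ht.1, by linarith [h.start, Γ.len_pos e]⟩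
    · obtain ⟨e, a, b, hr, h2, h3⟩ := hcross t h1 ht.2
      exact ⟨e, a, b, hr, h2.le, h3⟩
  have huniq : ∀ t e a b e' a' b', Runs ε e a b → Runs ε e' a' b' → x a ≤ t → t ≤ x b →
      x a' ≤ t → t ≤ x b' → ptAt x ε e t = ptAt x ε e' t := by
    intro t e a b e' a' b' hr hr' h1 h2 h3 h4
    rcases ((h.nonneg a).trans h1).eq_or_lt with h0 | h0
    · subst h0
      have ha : x a = 0 := le_antisymm h1 (h.nonneg a)
      have ha' : x a' = 0 := le_antisymm h3 (h.nonneg a')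
      have e1 := h.ptAt_near hr
      have e2 := h.ptAt_near hr'
      rw [ha, hzero _ _ _ hr ha] at e1
      rw [ha', hzero _ _ _ hr' ha'] at e2
      rw [e1, e2]
    · obtain ⟨e₀, a₀, b₀, hr₀, h5, h6⟩ := hcross t h0 (h2.trans (h.le b))
      rw [← h.ptAt_eq_of_cross hr₀ hr h5 h6 h1 h2, h.ptAt_eq_of_cross hr₀ hr' h5 h6 h3 h4]
  have : Nonempty Γ.Vert := ⟨p⟩
  have : Nonempty Γ.Edge := (h.exists_ne_zero hD).nonempty
  choose! E A B hR hA hB using hex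
  have hval : ∀ t e a b, Runs ε e a b → x a ≤ t → t ≤ x b → ptAt x ε (E t) t = ptAt x ε e t := by
    intro t e a b hr h1 h2
    have ht : t ∈ Set.Icc 0 D := ⟨(h.nonneg a).trans h1, h2.trans (h.le b)⟩
    exact huniq t _ _ _ _ _ _ (hR t ht) hr (hA t ht) (hB t ht) h1 h2
  refine ⟨fun t => ptAt x ε (E t) t, fun e he y hy => ?_, fun t ht => ?_, fun s hs t ht hst => ?_,
    ?_, ?_⟩
  · obtain ⟨a, b, hr⟩ := h.exists_runs he
    have := h.pos_mem_of_runs hr hy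
    simp only
    rw [hval _ e a b hr this.1 this.2, h.ptAt_pos he]
  · have hr := hR t ht
    refine ⟨E t, hr.ne_zero, _, h.coord_mem hr ⟨hA t ht, hB t ht⟩, ?_⟩
    linear_combination (t - x (Γ.src (E t))) * h.sq_eq_one hr.ne_zero
  · rcases hst.eq_or_lt with h1 | h1
    · subst h1
      rw [sub_self]
      exact Path.nil _
    · have hr := hR s hs
      by_cases h2 : t ≤ x (B s)
      · simp only
        rw [hval t _ _ _ hr ((hA s hs).trans hst) h2]
        exact h.path_ptAt hr ⟨hA s hs, hB s hs⟩ ⟨(hA s hs).trans hst, h2⟩ hst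
      · obtain ⟨e, a, b, hr', h3, h4, h5⟩ := h.exists_path_cross _ (B s) le_rfl
          (Or.inr ⟨_, _, hr⟩) t (not_le.1 h2) ht.2
        have h6 := h.path_ptAt hr ⟨hA s hs, hB s hs⟩ ⟨(hA s hs).trans (hB s hs), le_rfl⟩ (hB s hs)
        rw [h.ptAt_far hr] at h6
        simp only
        rw [hval t e a b hr' h3.le h4]
        convert h6.trans h5 using 1
        ring
  · obtain ⟨e, b, hr⟩ := h.exists_out hpq (Or.inl rfl)
    have := h.x_far hr
    have h0 := h.start
    simp only
    rw [hval 0 e p b hr h0.le (by linarith [Γ.len_pos e]), ← h.ptAt_near hr, h0]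
  · obtain ⟨e, a, hr⟩ := h.exists_in hpq.symm (Or.inl rfl)
    have := h.x_far hr
    have h0 := h.finish
    simp only
    rw [hval D e a q hr (h.le a) h0.ge, ← h.ptAt_far hr, h0]

/-- The position along a geodesic is a 1-Lipschitz function on the metric graph. -/
lemma abs_sub_le_dist (h : Γ.GeodFlow p q D x ε) (hΓ : Γ.IsConn) : ∃ X : Γ.Point → ℝ,
    (∀ v, X (Γ.vert v) = x v) ∧
    (∀ e, ∀ y ∈ Set.Icc 0 (Γ.len e), X (Γ.pt e y) = x (Γ.src e) + ε e * y) ∧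
    ∀ a b, |X a - X b| ≤ Γ.dist a b := by
  refine ⟨liftFun x (fun e y => x (Γ.src e) + ε e * y) (by simp)
    (fun e => by linarith [h.speed e]), fun v => rfl, fun e y hy => liftFun_pt _ _ _ _ e hy,
    fun a b => hΓ.le_dist (fun e s hs t ht => ?_) a b⟩
  rw [liftFun_pt _ _ _ _ e hs, liftFun_pt _ _ _ _ e ht, add_sub_add_left_eq_sub, ← mul_sub, abs_mul]
  refine mul_le_of_le_one_left (abs_nonneg _) ?_
  rcases h.unit e with h | h | h <;> simp [h]

end GeodFlow

end MetricGraph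

namespace MetricGraph

variable {Γ : MetricGraph.{u}}

/-! ### Metric stars are isometric -/

/-- Two metric spaces whose points are determined by their distances to given reference points, in
such a way that the distance of two points is a difference of such distances, are isometric if the
same tuples of distances occur in both. -/
lemma isometric_of_dist_profile {Γ' : MetricGraph.{v}} {ι : Type*} (hΓ : Γ.IsConn)
    (hΓ' : Γ'.IsConn) (a : ι → Γ.Point) (a' : ι → Γ'.Point)
    (hd : ∀ p q, ∃ i, Γ.dist p q ≤ |Γ.dist (a i) p - Γ.dist (a i) q|)
    (hd' : ∀ p q, ∃ i, Γ'.dist p q ≤ |Γ'.dist (a' i) p - Γ'.dist (a' i) q|)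
    (hinj : ∀ p q, (∀ i, Γ.dist (a i) p = Γ.dist (a i) q) → p = q)
    (hinj' : ∀ p q, (∀ i, Γ'.dist (a' i) p = Γ'.dist (a' i) q) → p = q)
    (h : ∀ p, ∃ p', ∀ i, Γ'.dist (a' i) p' = Γ.dist (a i) p)
    (h' : ∀ p', ∃ p, ∀ i, Γ'.dist (a' i) p' = Γ.dist (a i) p) : Γ.Isometric Γ' := by
  have htri : ∀ {Γ : MetricGraph.{u}} (_ : Γ.IsConn) (c p q : Γ.Point),
      |Γ.dist c p - Γ.dist c q| ≤ Γ.dist p q := fun hΓ c p q => by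
    have h1 := hΓ.dist_triangle c p q
    have h2 := hΓ.dist_triangle c q p
    rw [dist_comm' q p] at h2
    rw [abs_le]
    constructor <;> linarith
  have htri' : ∀ {Γ : MetricGraph.{v}} (_ : Γ.IsConn) (c p q : Γ.Point),
      |Γ.dist c p - Γ.dist c q| ≤ Γ.dist p q := fun hΓ c p q => by
    have h1 := hΓ.dist_triangle c p q
    have h2 := hΓ.dist_triangle c q p
    rw [dist_comm' q p] at h2
    rw [abs_le]
    constructor <;> linarith
  choose φ hφ using h
  have hφi : Function.Injective φ := fun p q hpq => hinj p q fun i => by rw [← hφ, ← hφ, hpq]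
  have hφs : Function.Surjective φ := fun p' => by
    obtain ⟨p, hp⟩ := h' p'
    exact ⟨p, hinj' _ _ fun i => by rw [hφ, hp]⟩
  refine ⟨Equiv.ofBijective φ ⟨hφi, hφs⟩, fun p q => ?_⟩
  · change Γ'.dist (φ p) (φ q) = Γ.dist p q
    refine le_antisymm ?_ ?_
    · obtain ⟨i, hi⟩ := hd' (φ p) (φ q)
      rw [hφ, hφ] at hi
      exact hi.trans (htri hΓ _ _ _)
    · obtain ⟨i, hi⟩ := hd p q
      rw [← hφ, ← hφ] at hi
      exact hi.trans (htri' hΓ' _ _ _)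

lemma GeodFlow.dist_start {p q : Γ.Vert} {D : ℝ} {x : Γ.Vert → ℝ} {ε : Γ.Edge → ℝ}
    (h : Γ.GeodFlow p q D x ε) (hΓ : Γ.IsConn) (hD : 0 < D) {e : Γ.Edge} (he : ε e ≠ 0) {y : ℝ}
    (hy : y ∈ Set.Icc 0 (Γ.len e)) : Γ.dist (Γ.vert p) (Γ.pt e y) = x (Γ.src e) + ε e * y := by
  obtain ⟨γ, h1, -, h3, h4, -⟩ := h.exists_curve hD
  obtain ⟨X, hX1, hX2, hX3⟩ := h.abs_sub_le_dist hΓ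
  have hmem := h.pos_mem e hy
  refine le_antisymm ?_ ?_
  · have := (h3 0 ⟨le_rfl, hD.le⟩ _ hmem hmem.1).dist_le
    rwa [h4, h1 e he y hy, sub_zero] at this
  · have := hX3 (Γ.vert p) (Γ.pt e y)
    rw [hX1, h.start, hX2 e y hy, zero_sub, abs_neg] at this
    exact (le_abs_self _).trans this

lemma GeodFlow.dist_finish {p q : Γ.Vert} {D : ℝ} {x : Γ.Vert → ℝ} {ε : Γ.Edge → ℝ}
    (h : Γ.GeodFlow p q D x ε) (hΓ : Γ.IsConn) (hD : 0 < D) {e : Γ.Edge} (he : ε e ≠ 0) {y : ℝ}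
    (hy : y ∈ Set.Icc 0 (Γ.len e)) :
    Γ.dist (Γ.vert q) (Γ.pt e y) = D - Γ.dist (Γ.vert p) (Γ.pt e y) := by
  rw [h.dist_start hΓ hD he hy, h.reverse.dist_start hΓ hD (neg_ne_zero.2 he) hy]
  ring

lemma GeodFlow.le_dist_ends {p q : Γ.Vert} {D : ℝ} {x : Γ.Vert → ℝ} {ε : Γ.Edge → ℝ}
    (h : Γ.GeodFlow p q D x ε) (hΓ : Γ.IsConn) : D ≤ Γ.dist (Γ.vert p) (Γ.vert q) := by
  obtain ⟨X, hX1, -, hX3⟩ := h.abs_sub_le_dist hΓ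
  have := hX3 (Γ.vert p) (Γ.vert q)
  rw [hX1, hX1, h.start, h.finish, zero_sub, abs_neg] at this
  exact (le_abs_self _).trans this

/-- Two points of a geodesic. -/
lemma GeodFlow.dist_eq {p q : Γ.Vert} {D : ℝ} {x : Γ.Vert → ℝ} {ε : Γ.Edge → ℝ}
    (h : Γ.GeodFlow p q D x ε) (hΓ : Γ.IsConn) (hD : 0 < D) {e e' : Γ.Edge} (he : ε e ≠ 0)
    (he' : ε e' ≠ 0) {y y' : ℝ} (hy : y ∈ Set.Icc 0 (Γ.len e)) (hy' : y' ∈ Set.Icc 0 (Γ.len e')) :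
    Γ.dist (Γ.pt e y) (Γ.pt e' y') ≤
      |Γ.dist (Γ.vert p) (Γ.pt e y) - Γ.dist (Γ.vert p) (Γ.pt e' y')| ∧
    (Γ.dist (Γ.vert p) (Γ.pt e y) = Γ.dist (Γ.vert p) (Γ.pt e' y') → Γ.pt e y = Γ.pt e' y') := by
  obtain ⟨γ, h1, -, h3, -, -⟩ := h.exists_curve hD
  rw [h.dist_start hΓ hD he hy, h.dist_start hΓ hD he' hy', ← h1 e he y hy, ← h1 e' he' y' hy']
  have m1 := h.pos_mem e hy
  have m2 := h.pos_mem e' hy'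
  refine ⟨?_, fun heq => by rw [heq]⟩
  rcases le_total (x (Γ.src e) + ε e * y) (x (Γ.src e') + ε e' * y') with hle | hle
  · rw [abs_sub_comm, abs_of_nonneg (by linarith)]
    exact (h3 _ m1 _ m2 hle).dist_le
  · rw [abs_of_nonneg (by linarith), dist_comm']
    exact (h3 _ m2 _ m1 hle).dist_le

namespace StarData

variable {m : ℕ}

lemma pos (_ : StarData Γ m) (hm : 2 ≤ m) : (0 : ℝ) < 2 / m := by
  have : (0 : ℝ) < m := by exact_mod_cast (by omega : 0 < m)
  positivity

lemma nonempty_edge (s : StarData Γ m) (hm : 2 ≤ m) : Nonempty Γ.Edge := by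
  have : Nontrivial (Fin m) := Fin.nontrivial_iff_two_le.2 hm
  obtain ⟨i, j, hij⟩ := exists_pair_ne (Fin m)
  exact ((s.geod i j hij).exists_ne_zero (s.pos hm)).nonempty

lemma le_dist_leaf (s : StarData Γ m) {i j : Fin m} (hij : i ≠ j) (p : Γ.Point) :
    2 / m ≤ Γ.dist (Γ.vert (s.leaf i)) p + Γ.dist (Γ.vert (s.leaf j)) p := by
  rw [dist_comm' (Γ.vert (s.leaf j)) p]
  exact ((s.geod i j hij).le_dist_ends s.conn).trans (s.conn.dist_triangle _ _ _)

/-- Any two points lie on a common geodesic between two leaves. -/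
lemma exists_common (s : StarData Γ m) (hm : 2 ≤ m) (p q : Γ.Point) : ∃ i j, i ≠ j ∧
    ∃ e e' y y', s.ε i j e ≠ 0 ∧ s.ε i j e' ≠ 0 ∧ y ∈ Set.Icc 0 (Γ.len e) ∧
      y' ∈ Set.Icc 0 (Γ.len e') ∧ p = Γ.pt e y ∧ q = Γ.pt e' y' := by
  have : Nontrivial (Fin m) := Fin.nontrivial_iff_two_le.2 hm
  have := s.nonempty_edge hm
  obtain ⟨e, y, hy, rfl⟩ := s.conn.exists_pt p
  obtain ⟨e', y', hy', rfl⟩ := s.conn.exists_pt q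
  obtain ⟨k, hk⟩ := s.owner e
  obtain ⟨k', hk'⟩ := s.owner e'
  by_cases hkk : k = k'
  · obtain ⟨j, hj⟩ := exists_ne k
    exact ⟨k, j, hj.symm, e, e', y, y', (hk k j hj.symm).2 (Or.inl rfl),
      (hk' k j hj.symm).2 (Or.inl hkk.symm), hy, hy', rfl, rfl⟩
  · exact ⟨k, k', hkk, e, e', y, y', (hk k k' hkk).2 (Or.inl rfl),
      (hk' k k' hkk).2 (Or.inr rfl), hy, hy', rfl, rfl⟩

lemma dist_le (s : StarData Γ m) (hm : 2 ≤ m) (p q : Γ.Point) : Γ.dist p q ≤ 2 / m := by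
  obtain ⟨i, j, hij, e, e', y, y', he, he', hy, hy', rfl, rfl⟩ := s.exists_common hm p q
  have h := s.geod i j hij
  refine (h.dist_eq s.conn (s.pos hm) he he' hy hy').1.trans ?_
  rw [h.dist_start s.conn (s.pos hm) he hy, h.dist_start s.conn (s.pos hm) he' hy']
  have m1 := h.pos_mem e hy
  have m2 := h.pos_mem e' hy'
  rw [abs_le]
  constructor <;> linarith [m1.1, m1.2, m2.1, m2.2]

lemma profile_of_point (s : StarData Γ m) (hm : 2 ≤ m) (p : Γ.Point) :
    ∃ i, ∃ t ∈ Set.Icc (0 : ℝ) (1 / m), Γ.dist (Γ.vert (s.leaf i)) p = t ∧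
      ∀ j, j ≠ i → Γ.dist (Γ.vert (s.leaf j)) p = 2 / m - t := by
  have : Nontrivial (Fin m) := Fin.nontrivial_iff_two_le.2 hm
  have := s.nonempty_edge hm
  have hnn : ∀ i, 0 ≤ Γ.dist (Γ.vert (s.leaf i)) p := fun i =>
    Real.sInf_nonneg fun _ h => Path.nonneg h
  obtain ⟨e, y, hy, rfl⟩ := s.conn.exists_pt p
  obtain ⟨k, hk⟩ := s.owner e
  have h2r : (2 : ℝ) / m = 2 * (1 / m) := by ring
  have hj : ∀ j, j ≠ k → Γ.dist (Γ.vert (s.leaf j)) (Γ.pt e y) =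
      2 / m - Γ.dist (Γ.vert (s.leaf k)) (Γ.pt e y) := fun j hj =>
    (s.geod k j hj.symm).dist_finish s.conn (s.pos hm) ((hk k j hj.symm).2 (Or.inl rfl)) hy
  by_cases hle : Γ.dist (Γ.vert (s.leaf k)) (Γ.pt e y) ≤ 1 / m
  · exact ⟨k, _, ⟨hnn k, hle⟩, rfl, hj⟩
  · obtain ⟨j, hjk⟩ := exists_ne k
    have h1 := hj j hjk
    refine ⟨j, _, ⟨hnn j, by linarith⟩, rfl, fun j' hj' => ?_⟩
    by_cases hj'k : j' = k
    · rw [hj'k]; linarith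
    · have h2 := hj j' hj'k
      have h3 := s.le_dist_leaf hj' (Γ.pt e y)
      linarith

lemma exists_point_of_profile (s : StarData Γ m) (hm : 2 ≤ m) (i : Fin m) {t : ℝ}
    (ht : t ∈ Set.Icc (0 : ℝ) (1 / m)) : ∃ p, Γ.dist (Γ.vert (s.leaf i)) p = t ∧
      ∀ j, j ≠ i → Γ.dist (Γ.vert (s.leaf j)) p = 2 / m - t := by
  have : Nontrivial (Fin m) := Fin.nontrivial_iff_two_le.2 hm
  have h2r : (2 : ℝ) / m = 2 * (1 / m) := by ring
  obtain ⟨j, hj⟩ := exists_ne i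
  have h := s.geod i j hj.symm
  obtain ⟨-, -, h2, -⟩ := h.exists_curve (s.pos hm)
  obtain ⟨e, he, y, hy, hyt⟩ := h2 t ⟨ht.1, by linarith [ht.1, ht.2]⟩
  have h3 : Γ.dist (Γ.vert (s.leaf i)) (Γ.pt e y) = t := by
    rw [h.dist_start s.conn (s.pos hm) he hy, hyt]
  have h4 := h.dist_finish s.conn (s.pos hm) he hy
  refine ⟨Γ.pt e y, h3, fun l hl => ?_⟩
  obtain ⟨k, hk⟩ := s.owner e
  rcases (hk i j hj.symm).1 he with rfl | rfl
  · rw [← h3]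
    exact (s.geod k l hl.symm).dist_finish s.conn (s.pos hm) ((hk k l hl.symm).2 (Or.inl rfl)) hy
  · by_cases hlk : l = k
    · rw [hlk, h4, h3]
    · have h5 := (s.geod k l (Ne.symm hlk)).dist_finish s.conn (s.pos hm)
        ((hk k l (Ne.symm hlk)).2 (Or.inl rfl)) hy
      have h6 := s.le_dist_leaf hl (Γ.pt e y)
      linarith [ht.2]

/-- Any two equilateral metric stars with the same number of edges are isometric. -/
theorem isometric {Γ' : MetricGraph.{v}} (s : StarData Γ m) (s' : StarData Γ' m) (hm : 2 ≤ m) :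
    Γ.Isometric Γ' := by
  refine isometric_of_dist_profile s.conn s'.conn (fun i => Γ.vert (s.leaf i))
    (fun i => Γ'.vert (s'.leaf i)) (fun p q => ?_) (fun p q => ?_) (fun p q hpq => ?_)
    (fun p q hpq => ?_) (fun p => ?_) (fun p' => ?_)
  · obtain ⟨i, j, hij, e, e', y, y', he, he', hy, hy', rfl, rfl⟩ := s.exists_common hm p q
    exact ⟨i, ((s.geod i j hij).dist_eq s.conn (s.pos hm) he he' hy hy').1⟩
  · obtain ⟨i, j, hij, e, e', y, y', he, he', hy, hy', rfl, rfl⟩ := s'.exists_common hm p q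
    exact ⟨i, ((s'.geod i j hij).dist_eq s'.conn (s'.pos hm) he he' hy hy').1⟩
  · obtain ⟨i, j, hij, e, e', y, y', he, he', hy, hy', rfl, rfl⟩ := s.exists_common hm p q
    exact ((s.geod i j hij).dist_eq s.conn (s.pos hm) he he' hy hy').2 (hpq i)
  · obtain ⟨i, j, hij, e, e', y, y', he, he', hy, hy', rfl, rfl⟩ := s'.exists_common hm p q
    exact ((s'.geod i j hij).dist_eq s'.conn (s'.pos hm) he he' hy hy').2 (hpq i)
  · obtain ⟨i, t, ht, h1, h2⟩ := s.profile_of_point hm p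
    obtain ⟨p', h3, h4⟩ := s'.exists_point_of_profile hm i ht
    refine ⟨p', fun j => ?_⟩
    by_cases hj : j = i
    · rw [hj, h1, h3]
    · rw [h2 j hj, h4 j hj]
  · obtain ⟨i, t, ht, h1, h2⟩ := s'.profile_of_point hm p'
    obtain ⟨p, h3, h4⟩ := s.exists_point_of_profile hm i ht
    refine ⟨p, fun j => ?_⟩
    by_cases hj : j = i
    · rw [hj, h1, h3]
    · rw [h2 j hj, h4 j hj]

end StarData

/-! ### The equilateral star -/

/-- The position of the vertices of the equilateral star (`none` being the centre) along the
geodesic from the leaf `i` to the leaf `j`. -/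
noncomputable def starPos {m : ℕ} (i j : Fin m) : Option (Fin m) → ℝ
  | none => 1 / m
  | some e => if e = i then 0 else if e = j then 2 / m else 1 / m

/-- The flow from the leaf `i` to the leaf `j` on the edges of the equilateral star, which are
oriented outwards. -/
noncomputable def starFlow {m : ℕ} (i j e : Fin m) : ℝ :=
  if e = j then 1 else if e = i then -1 else 0

lemma sum_starFlow {m : ℕ} {i j : Fin m} (hij : i ≠ j) (H : Option (Fin m) → ℝ) :
    ∑ e : Fin m, starFlow i j e * (H (some e) - H none) = H (some j) - H (some i) := by
  have hterm : ∀ e : Fin m, starFlow i j e * (H (some e) - H none) =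
      (if e = j then H (some e) - H none else 0) - (if e = i then H (some e) - H none else 0) := by
    intro e
    unfold starFlow
    by_cases he : e = j
    · rw [if_pos he, if_pos he, if_neg (by rw [he]; exact hij.symm)]; ring
    · rw [if_neg he, if_neg he]
      split_ifs <;> ring
  rw [Finset.sum_congr rfl fun e _ => hterm e, Finset.sum_sub_distrib, Finset.sum_ite_eq',
    Finset.sum_ite_eq', if_pos (Finset.mem_univ _), if_pos (Finset.mem_univ _)]
  ring

lemma starPos_sub {m : ℕ} {i j : Fin m} (hij : i ≠ j) (e : Fin m) :
    starPos i j (some e) - starPos i j none = starFlow i j e * (1 / m) := by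
  simp only [starPos, starFlow]
  by_cases he : e = i
  · rw [if_pos he, if_neg (by rw [he]; exact hij), if_pos he]; ring
  · by_cases he' : e = j
    · rw [if_neg he, if_pos he', if_pos he']; ring
    · rw [if_neg he, if_neg he', if_neg he', if_neg he]; ring

lemma geodFlow_equilateralStar {m : ℕ} {i j : Fin m} (hij : i ≠ j) :
    (equilateralStar m).GeodFlow (some i) (some j) (2 / m) (starPos i j) (starFlow i j) := by
  have hm0 : (0 : ℝ) < m := by exact_mod_cast i.pos
  have h1 : (0 : ℝ) < 1 / m := by positivity
  have h2 : (2 : ℝ) / m = 2 * (1 / m) := by ring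
  refine ⟨?_, ?_, ?_, ?_, fun e => ?_, fun e => ?_, fun H => ?_⟩
  · rintro (_ | e) <;> unfold starPos
    · exact h1.le
    · simp only []
      split_ifs <;> linarith
  · rintro (_ | e) <;> unfold starPos
    · simp only []
      linarith
    · simp only []
      split_ifs <;> linarith
  · simp [starPos]
  · simp [starPos, hij.symm]
  · unfold starFlow
    split_ifs <;> simp
  · exact starPos_sub hij e
  · refine Eq.trans ?_ (sum_starFlow hij H)
    exact @Fintype.sum_equiv _ _ _ (equilateralStar m).instFintypeEdge _ _ (Equiv.refl (Fin m)) _ _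
      fun _ => rfl

/-- The equilateral star is a metric star. -/
noncomputable def equilateralStarData (m : ℕ) : StarData (equilateralStar m) m where
  leaf i := some i
  x i j := starPos i j
  ε i j := starFlow i j
  conn := by
    intro H hH
    have : ∀ v, H v = H none := by
      rintro (_ | i)
      · rfl
      · exact (hH i).symm
    intro v w
    rw [this v, this w]
  geod i j hij := geodFlow_equilateralStar hij
  proj i j hij e he := rfl
  owner := by
    intro (e : Fin m)
    refine ⟨e, fun i j hij => ?_⟩
    unfold starFlow
    by_cases h1 : e = j
    · simp [h1]
    · by_cases h2 : e = i
      · simp [h2, hij]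
      · simp [h1, h2]

/-- The spectral gap of a metric star, given an eigenfunction on the expected level or below. -/
lemma StarData.spectralGap_eq {m : ℕ} (s : StarData Γ m) (hm : 2 ≤ m) {f : Γ.Point → ℝ} {k : ℝ}
    (hk : 0 ≤ k) (hkm : k ≤ Real.pi / 2 * m) (hf : Γ.IsNeumannLaplacian f ((k ^ 2) • f))
    (hne : ¬ ∃ c, ∀ p, f p = c) : Γ.spectralGap = Real.pi / 2 * m := by
  have : Nonempty Γ.Point := ⟨Γ.vert (s.leaf ⟨0, by omega⟩)⟩
  exact MetricGraph.spectralGap_eq hk hkm hf hne fun g μ hμ hg => s.eq_const hm hμ hg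

theorem spectralGap_equilateralStar {m : ℕ} (hm : 2 ≤ m) :
    (equilateralStar m).spectralGap = Real.pi / 2 * m := by
  have hm0 : (0 : ℝ) < m := by exact_mod_cast (by omega : 0 < m)
  have s := equilateralStarData m
  have : Nontrivial (Fin m) := Fin.nontrivial_iff_two_le.2 hm
  obtain ⟨i, j, hij⟩ := exists_pair_ne (Fin m)
  obtain ⟨k, f, hk, hk', hf, hne⟩ := (s.geod i j hij).exists_eigenfunction s.conn (s.pos hm)
    (fun e => by
      change (1 : ℝ) / m < 2 / m
      gcongr
      norm_num)
  refine s.spectralGap_eq hm hk ?_ hf hne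
  rwa [show Real.pi / (2 / (m : ℝ)) = Real.pi / 2 * m by field_simp] at hk'

end MetricGraph

/-! ### Cuts of a tree -/

namespace SimpleGraph

variable {V : Type*} {G : SimpleGraph V}

/-- The vertices `u` and `v` are separated by the edge `e`: they are not connected once `e` is
deleted. -/
def Sep (G : SimpleGraph V) (e : Sym2 V) (u v : V) : Prop := ¬ (G.deleteEdges {e}).Reachable u v

lemma not_sep_self (e : Sym2 V) (u : V) : ¬ G.Sep e u u := not_not.2 (Reachable.refl u)

lemma sep_comm {e : Sym2 V} {u v : V} : G.Sep e u v ↔ G.Sep e v u := not_congr reachable_comm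

lemma not_sep_symm {e : Sym2 V} {u v : V} (h : ¬ G.Sep e u v) : ¬ G.Sep e v u :=
  fun h' => h (sep_comm.1 h')

lemma not_sep_trans {e : Sym2 V} {u v w : V} (h : ¬ G.Sep e u v) (h' : ¬ G.Sep e v w) :
    ¬ G.Sep e u w :=
  not_not.2 ((not_not.1 h).trans (not_not.1 h'))

lemma Sep.of_left {e : Sym2 V} {u v w : V} (h : G.Sep e u w) (h' : ¬ G.Sep e u v) : G.Sep e v w :=
  fun h'' => h ((not_not.1 h').trans h'')

lemma Sep.of_right {e : Sym2 V} {u v w : V} (h : G.Sep e u w) (h' : ¬ G.Sep e v w) : G.Sep e u v :=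
  fun h'' => h (h''.trans (not_not.1 h'))

lemma not_sep_of_adj {e : Sym2 V} {u v : V} (h : G.Adj u v) (he : s(u, v) ≠ e) : ¬ G.Sep e u v :=
  not_not.2 (Adj.reachable (deleteEdges_adj.2 ⟨h, he⟩))

namespace IsTree

lemma sep_of_adj (hG : G.IsTree) {u v : V} (h : G.Adj u v) : G.Sep s(u, v) u v :=
  isAcyclic_iff_forall_adj_isBridge.1 hG.2 h

lemma not_sep_or (hG : G.IsTree) {a b : V} (u : V) :
    ¬ G.Sep s(a, b) u a ∨ ¬ G.Sep s(a, b) u b := by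
  obtain ⟨w⟩ := hG.1 u a
  induction w with
  | nil => exact Or.inl (not_sep_self _ _)
  | @cons u v a h w ih =>
    by_cases he : s(u, v) = s(a, b)
    · rcases Sym2.eq_iff.1 he with ⟨rfl, rfl⟩ | ⟨rfl, rfl⟩
      · exact Or.inl (not_sep_self _ _)
      · exact Or.inr (not_sep_self _ _)
    · have h1 := not_sep_of_adj h he
      exact ih.imp (not_sep_trans h1) (not_sep_trans h1)

/-- An edge has only two sides. -/
lemma not_sep_of_sep_of_sep (hG : G.IsTree) {e : Sym2 V} {u v w : V} (h1 : G.Sep e u v)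
    (h2 : G.Sep e v w) : ¬ G.Sep e u w := by
  induction e with
  | _ a b =>
    rcases hG.not_sep_or (a := a) (b := b) u with hu | hu <;>
      rcases hG.not_sep_or (a := a) (b := b) v with hv | hv <;>
      rcases hG.not_sep_or (a := a) (b := b) w with hw | hw <;>
      first
      | exact absurd (not_sep_trans hu (not_sep_symm hv)) (not_not.2 h1)
      | exact absurd (not_sep_trans hv (not_sep_symm hw)) (not_not.2 h2)
      | exact not_sep_trans hu (not_sep_symm hw)

end IsTree

/-- If `e'` separates two vertices on the same side of `e`, then `e'` lies on that side of `e`. -/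
lemma not_sep_of_mem {e e' : Sym2 V} {u v c : V} (h : G.Sep e' u v) (h' : ¬ G.Sep e u v)
    (hc : c ∈ e') : ¬ G.Sep e u c := by
  classical
  obtain ⟨w⟩ := not_not.1 h'
  have hnr : ¬ ((G.deleteEdges {e}).deleteEdges {e'}).Reachable u v := fun hr =>
    h (hr.mono (deleteEdges_mono (deleteEdges_le _)))
  have hmem := w.mem_edges_of_not_reachable_deleteEdges hnr
  have hsupp : c ∈ w.support := by
    induction e' with
    | _ a b =>
      rcases Sym2.mem_iff.1 hc with rfl | rfl
      · exact w.fst_mem_support_of_mem_edges hmem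
      · exact w.snd_mem_support_of_mem_edges hmem
  exact not_not.2 ⟨w.takeUntil c hsupp⟩

namespace IsTree

/-- An edge `e` separating `i` and `j` lies on the path from `i` to `j`; so no edge `e'` separates
an end `v` of `e` from both `i` and `j`. -/
lemma not_sep_and_sep (hG : G.IsTree) {e e' : Sym2 V} (he : e ∈ G.edgeSet) {i j v : V}
    (h : G.Sep e i j) (hv : v ∈ e) : ¬ (G.Sep e' i v ∧ G.Sep e' v j) := by
  rintro ⟨h1, h2⟩
  by_cases hee : e' = e
  · subst hee
    exact hG.not_sep_of_sep_of_sep h1 h2 h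
  -- both ends of `e` are on the same side of `e'`
  have hends : ∀ c ∈ e, ¬ G.Sep e' v c := by
    induction e with
    | _ a b =>
      have hab : ¬ G.Sep e' a b := not_sep_of_adj he (Ne.symm hee)
      intro c hc
      rcases Sym2.mem_iff.1 hv with rfl | rfl <;> rcases Sym2.mem_iff.1 hc with rfl | rfl <;>
        first
        | exact not_sep_self _ _
        | exact hab
        | exact not_sep_symm hab
  -- the end of `e` on the side of a given vertex
  have hside : ∀ u, ∃ c ∈ e, ¬ G.Sep e u c := by
    intro u
    induction e with
    | _ a b =>
      rcases hG.not_sep_or (a := a) (b := b) u with hu | hu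
      · exact ⟨a, by simp, hu⟩
      · exact ⟨b, by simp, hu⟩
  obtain ⟨a, ha, hia⟩ := hside i
  obtain ⟨b, hb, hjb⟩ := hside j
  have h3 : G.Sep e' i a := h1.of_right (not_sep_symm (hends a ha))
  have h4 : G.Sep e' j b := sep_comm.1 (h2.of_left (hends b hb))
  obtain ⟨c, hc⟩ : ∃ c, c ∈ e' := by
    induction e' with
    | _ a b => exact ⟨a, by simp⟩
  exact not_sep_trans (not_sep_of_mem h3 hia hc) (not_sep_symm (not_sep_of_mem h4 hjb hc)) h

end IsTree

open scoped Classical in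
/-- The indicator of separation: `1` if `e` separates `u` and `v`, otherwise `0`. -/
noncomputable def cut (G : SimpleGraph V) (e : Sym2 V) (u v : V) : ℝ :=
  if G.Sep e u v then 1 else 0

lemma cut_eq_one {e : Sym2 V} {u v : V} (h : G.Sep e u v) : G.cut e u v = 1 := if_pos h

lemma cut_eq_zero {e : Sym2 V} {u v : V} (h : ¬ G.Sep e u v) : G.cut e u v = 0 := if_neg h

lemma cut_eq_zero_or_one (e : Sym2 V) (u v : V) : G.cut e u v = 0 ∨ G.cut e u v = 1 := by
  by_cases h : G.Sep e u v
  · exact Or.inr (cut_eq_one h)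
  · exact Or.inl (cut_eq_zero h)

lemma cut_nonneg (e : Sym2 V) (u v : V) : 0 ≤ G.cut e u v := by
  rcases G.cut_eq_zero_or_one e u v with h | h <;> rw [h]; exact zero_le_one

lemma cut_le_one (e : Sym2 V) (u v : V) : G.cut e u v ≤ 1 := by
  rcases G.cut_eq_zero_or_one e u v with h | h <;> rw [h]; exact zero_le_one

lemma cut_self (e : Sym2 V) (u : V) : G.cut e u u = 0 := cut_eq_zero (not_sep_self e u)

lemma cut_comm (e : Sym2 V) (u v : V) : G.cut e u v = G.cut e v u := by
  by_cases h : G.Sep e u v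
  · rw [cut_eq_one h, cut_eq_one (sep_comm.1 h)]
  · rw [cut_eq_zero h, cut_eq_zero (not_sep_symm h)]

lemma cut_ne_zero_iff {e : Sym2 V} {u v : V} : G.cut e u v ≠ 0 ↔ G.Sep e u v := by
  refine ⟨fun h => ?_, fun h => by rw [cut_eq_one h]; exact one_ne_zero⟩
  by_contra hc
  exact h (cut_eq_zero hc)

namespace IsTree

/-- As an edge has two sides, separation is additive modulo two. -/
lemma cut_add (hG : G.IsTree) (e : Sym2 V) (u v w : V) :
    G.cut e u w = G.cut e u v + G.cut e v w - 2 * G.cut e u v * G.cut e v w := by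
  by_cases h1 : G.Sep e u v <;> by_cases h2 : G.Sep e v w
  · rw [cut_eq_one h1, cut_eq_one h2, cut_eq_zero (hG.not_sep_of_sep_of_sep h1 h2)]; norm_num
  · rw [cut_eq_one h1, cut_eq_zero h2, cut_eq_one (h1.of_right (not_sep_symm h2))]; norm_num
  · rw [cut_eq_zero h1, cut_eq_one h2, cut_eq_one]; norm_num
    exact h2.of_left (not_sep_symm h1)
  · rw [cut_eq_zero h1, cut_eq_zero h2, cut_eq_zero (not_sep_trans h1 h2)]; norm_num

lemma cut_of_adj_of_ne {e : Sym2 V} {u v : V} (h : G.Adj u v) (he : s(u, v) ≠ e) (p : V) :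
    G.cut e p u = G.cut e p v := by
  have h1 := not_sep_of_adj h he
  by_cases h2 : G.Sep e p u
  · rw [cut_eq_one h2, cut_eq_one (h2.of_right (not_sep_symm h1))]
  · rw [cut_eq_zero h2, cut_eq_zero (not_sep_trans h2 h1)]

/-- The two ends of an edge lie on different sides of it. -/
lemma cut_add_cut (hG : G.IsTree) {u v : V} (h : G.Adj u v) (p : V) :
    G.cut s(u, v) p u + G.cut s(u, v) p v = 1 := by
  have h1 := hG.cut_add s(u, v) u p v
  rw [cut_eq_one (hG.sep_of_adj h), cut_comm _ u p] at h1
  rcases G.cut_eq_zero_or_one s(u, v) p u with h2 | h2 <;>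
    rcases G.cut_eq_zero_or_one s(u, v) p v with h3 | h3 <;> rw [h2, h3] at h1 ⊢ <;> linarith

end IsTree

/-- The first end of an edge, in an arbitrary orientation. -/
noncomputable def fstEnd (e : Sym2 V) : V := (Quot.out e).1

/-- The second end of an edge, in an arbitrary orientation. -/
noncomputable def sndEnd (e : Sym2 V) : V := (Quot.out e).2

lemma mk_ends (e : Sym2 V) : s(fstEnd e, sndEnd e) = e := Quot.out_eq e

lemma adj_ends {e : Sym2 V} (he : e ∈ G.edgeSet) : G.Adj (fstEnd e) (sndEnd e) := by
  rw [← mem_edgeSet, mk_ends]; exact he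

lemma fstEnd_mem (e : Sym2 V) : fstEnd e ∈ e := by
  have h := Sym2.mem_mk_left (fstEnd e) (sndEnd e)
  rwa [mk_ends] at h

/-- The unit flow through the tree which starts at `p`: `1` if `e` is oriented away from `p`, `-1`
otherwise. -/
noncomputable def sgn (G : SimpleGraph V) (p : V) (e : Sym2 V) : ℝ :=
  G.cut e p (sndEnd e) - G.cut e p (fstEnd e)

lemma IsTree.sgn_eq (hG : G.IsTree) (p : V) {e : Sym2 V} (he : e ∈ G.edgeSet) :
    G.sgn p e = 1 ∨ G.sgn p e = -1 := by
  have h := hG.cut_add_cut (adj_ends he) p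
  rw [mk_ends] at h
  unfold sgn
  rcases G.cut_eq_zero_or_one e p (fstEnd e) with h1 | h1 <;> rw [h1] at h ⊢
  · left; linarith
  · right; linarith

lemma IsTree.cut_sub_cut (hG : G.IsTree) (p : V) {u v : V} (h : G.Adj u v) (K : V → ℝ) :
    (G.cut s(u, v) p v - G.cut s(u, v) p u) *
      (G.sgn p s(u, v) * (K (sndEnd s(u, v)) - K (fstEnd s(u, v)))) = K v - K u := by
  have h1 := hG.cut_add_cut h p
  have h2 : (G.cut s(u, v) p v - G.cut s(u, v) p u) ^ 2 = 1 := by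
    rcases G.cut_eq_zero_or_one s(u, v) p u with h3 | h3 <;> rw [h3] at h1 ⊢
    · rw [show G.cut s(u, v) p v = 1 by linarith]; norm_num
    · rw [show G.cut s(u, v) p v = 0 by linarith]; norm_num
  unfold sgn
  rcases Sym2.eq_iff.1 (mk_ends s(u, v)) with ⟨h3, h4⟩ | ⟨h3, h4⟩ <;> rw [h3, h4] <;>
    linear_combination (K v - K u) * h2

section Flow

variable [Fintype G.edgeSet]

/-- The increments of a function along the edges which separate `p` from `v`, oriented away from
`p`, sum up to its increment from `p` to `v`. -/
lemma IsTree.sum_cut_mul (hG : G.IsTree) (K : V → ℝ) (p v : V) :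
    ∑ e : G.edgeSet, G.cut e p v *
      (G.sgn p e * (K (sndEnd (e : Sym2 V)) - K (fstEnd (e : Sym2 V)))) = K v - K p := by
  classical
  obtain ⟨w⟩ := hG.1 v p
  induction w with
  | nil => simp [cut_self]
  | @cons v u p h w ih =>
    have key : ∑ e : G.edgeSet, (G.cut e p v - G.cut e p u) *
        (G.sgn p e * (K (sndEnd (e : Sym2 V)) - K (fstEnd (e : Sym2 V)))) = K v - K u := by
      rw [Finset.sum_eq_single_of_mem ⟨s(u, v), h.symm⟩ (Finset.mem_univ _)]
      · exact hG.cut_sub_cut p h.symm K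
      · intro e _ he
        have hne : s(u, v) ≠ (e : Sym2 V) := fun h' => he (Subtype.ext h'.symm)
        rw [IsTree.cut_of_adj_of_ne h.symm hne, sub_self, zero_mul]
    simp only [sub_mul, Finset.sum_sub_distrib] at key
    linarith

/-- Some edge separates two distinct vertices. -/
lemma IsTree.exists_sep (hG : G.IsTree) {v w : V} (hvw : v ≠ w) :
    ∃ e ∈ G.edgeSet, G.Sep e v w := by
  classical
  by_contra! hcon
  have := hG.sum_cut_mul (fun u => if u = w then 1 else 0) v w
  rw [Finset.sum_eq_zero fun e _ => by rw [cut_eq_zero (hcon e e.2), zero_mul]] at this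
  simp [hvw] at this

end Flow

/-! ### Counting vertices on the sides of an edge -/

section Degrees

variable [Fintype V]

open scoped Classical in
/-- The vertices on the side of `e` which contains `a`. -/
noncomputable def side (G : SimpleGraph V) (e : Sym2 V) (a : V) : Finset V :=
  Finset.univ.filter fun w => ¬ G.Sep e a w

lemma mem_side {e : Sym2 V} {a w : V} : w ∈ G.side e a ↔ ¬ G.Sep e a w := by
  simp [side]

variable [DecidableRel G.Adj]

/-- Counting the edges on one side of an edge, which form a tree: there, the numbers
`2 - deg` sum up to one. -/
lemma IsTree.sum_side (hG : G.IsTree) {a b : V} (hab : G.Adj a b) :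
    ∑ w ∈ G.side s(a, b) a, (2 - (G.degree w : ℤ)) = 1 := by
  classical
  set e := s(a, b) with he
  set C := (G.deleteEdges {e}).connectedComponentMk a with hC
  have hmem : ∀ w, w ∈ C ↔ w ∈ G.side e a := fun w => by
    rw [mem_side, Sep, not_not, hC]
    exact (SimpleGraph.ConnectedComponent.eq).trans reachable_comm
  have hT : C.toSimpleGraph.IsTree :=
    (hG.2.anti (deleteEdges_le _)).isTree_connectedComponent C
  have hdeg : ∀ w : C, (G.degree w : ℤ) =
      (C.toSimpleGraph.degree w : ℤ) + if (w : V) = a then 1 else 0 := by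
    rintro ⟨w, hw⟩
    have hws := (hmem w).1 hw
    rw [mem_side] at hws
    have h1 : (C.toSimpleGraph.neighborFinset ⟨w, hw⟩).map (Function.Embedding.subtype _) =
        (G.neighborFinset w).filter fun u => s(w, u) ≠ e := by
      ext u
      simp only [Finset.mem_map, mem_neighborFinset, Function.Embedding.subtype_apply,
        Finset.mem_filter]
      constructor
      · rintro ⟨⟨u', hu'⟩, hadj, rfl⟩
        rw [ConnectedComponent.toSimpleGraph_adj] at hadj
        exact deleteEdges_adj.1 hadj
      · rintro ⟨hadj, hne⟩
        have hu : u ∈ C := by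
          rw [hmem, mem_side]
          exact not_sep_trans hws (not_sep_of_adj hadj hne)
        refine ⟨⟨u, hu⟩, ?_, rfl⟩
        rw [ConnectedComponent.toSimpleGraph_adj]
        exact deleteEdges_adj.2 ⟨hadj, hne⟩
    have h2 : ((G.neighborFinset w).filter fun u => ¬ s(w, u) ≠ e) =
        if w = a then {b} else ∅ := by
      ext u
      simp only [Finset.mem_filter, mem_neighborFinset, not_not]
      constructor
      · rintro ⟨hadj, heq⟩
        rcases Sym2.eq_iff.1 heq with ⟨rfl, rfl⟩ | ⟨rfl, rfl⟩
        · simp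
        · exact absurd (hG.sep_of_adj hab) hws
      · intro hu
        by_cases hwa : w = a
        · rw [if_pos hwa, Finset.mem_singleton] at hu
          subst hwa hu
          exact ⟨hab, rfl⟩
        · rw [if_neg hwa] at hu
          exact absurd hu (Finset.notMem_empty _)
    have h3 := Finset.card_filter_add_card_filter_not (s := G.neighborFinset w)
      (fun u => s(w, u) ≠ e)
    rw [← h1, h2, Finset.card_map, card_neighborFinset_eq_degree,
      card_neighborFinset_eq_degree] at h3
    rw [← h3]
    push_cast
    congr 1
    by_cases hwa : w = a <;> simp [hwa]
  have hsum : ∑ w ∈ G.side e a, (2 - (G.degree w : ℤ)) = ∑ w : C, (2 - (G.degree w : ℤ)) :=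
    Finset.sum_subtype _ (fun w => (hmem w).symm) _
  have ha : a ∈ C := (hmem a).2 (mem_side.2 (not_sep_self _ _))
  have hone : ∑ w : C, (if (w : V) = a then (1 : ℤ) else 0) = 1 := by
    rw [Finset.sum_eq_single_of_mem ⟨a, ha⟩ (Finset.mem_univ _)]
    · simp
    · intro w _ hw
      rw [if_neg fun h => hw (Subtype.ext h)]
  have h1 := C.toSimpleGraph.sum_degrees_eq_twice_card_edges
  have h2 := hT.card_edgeFinset
  have h3 : ∑ w : C, (C.toSimpleGraph.degree w : ℤ) = 2 * (Fintype.card C - 1) := by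
    rw [← h2]
    push_cast
    have : ((∑ w, C.toSimpleGraph.degree w : ℕ) : ℤ) =
        ((2 * C.toSimpleGraph.edgeFinset.card : ℕ) : ℤ) := by rw [h1]
    push_cast at this
    linarith
  rw [hsum]
  simp only [hdeg]
  rw [Finset.sum_sub_distrib, Finset.sum_add_distrib, hone, h3]
  simp
  ring

end Degrees

end SimpleGraph

namespace SimpleGraph

variable {V : Type*} {G : SimpleGraph V}

/-! ### Leaves on the sides of an edge -/

lemma IsTree.exists_mem_sep (hG : G.IsTree) {e : Sym2 V} (he : e ∈ G.edgeSet) (u : V) :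
    (∃ a ∈ e, G.Sep e u a) ∧ ∃ a ∈ e, ¬ G.Sep e u a := by
  induction e with
  | _ a b =>
    have h := hG.sep_of_adj he
    rcases hG.not_sep_or (a := a) (b := b) u with hu | hu
    · exact ⟨⟨b, by simp, fun h' => h ((not_not.1 (not_sep_symm hu)).trans h')⟩, a, by simp, hu⟩
    · exact ⟨⟨a, by simp, (sep_comm.1 h).of_left (not_sep_symm hu)⟩, b, by simp, hu⟩

lemma not_sep_of_mem_of_mem {e e' : Sym2 V} (he : e ∈ G.edgeSet) (hne : e ≠ e') {a b : V}
    (ha : a ∈ e) (hb : b ∈ e) : ¬ G.Sep e' a b := by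
  induction e with
  | _ c d =>
    have hcd : ¬ G.Sep e' c d := not_sep_of_adj he hne
    rcases Sym2.mem_iff.1 ha with rfl | rfl <;> rcases Sym2.mem_iff.1 hb with rfl | rfl <;>
      first
      | exact not_sep_self _ _
      | exact hcd
      | exact not_sep_symm hcd

variable [Fintype V] [DecidableRel G.Adj]

/-- `IsTree.sum_side` for the side of an arbitrary vertex. -/
lemma IsTree.sum_side' (hG : G.IsTree) {e : Sym2 V} (he : e ∈ G.edgeSet) (u : V) :
    ∑ w ∈ G.side e u, (2 - (G.degree w : ℤ)) = 1 := by
  obtain ⟨a, ha, hua⟩ := (hG.exists_mem_sep he u).2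
  have hside : G.side e u = G.side e a := by
    ext w
    rw [mem_side, mem_side]
    exact ⟨not_sep_trans (not_sep_symm hua), not_sep_trans hua⟩
  rw [hside]
  obtain ⟨b, rfl⟩ := ha
  exact hG.sum_side he

/-- An enumeration of the leaves. -/
noncomputable def leaf (G : SimpleGraph V) [DecidableRel G.Adj] (k : Fin (numLeaves G)) : V :=
  ((Finset.univ.filter fun v => G.degree v = 1).equivFin.symm k : V)

lemma leaf_injective : Function.Injective G.leaf := fun _ _ h =>
  (Equiv.injective _) (Subtype.ext h)

lemma degree_leaf (k : Fin (numLeaves G)) : G.degree (G.leaf k) = 1 :=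
  (Finset.mem_filter.1 ((Finset.univ.filter fun v => G.degree v = 1).equivFin.symm k).2).2

lemma exists_leaf_eq {v : V} (h : G.degree v = 1) : ∃ k, G.leaf k = v :=
  ⟨(Finset.univ.filter fun v => G.degree v = 1).equivFin
    ⟨v, Finset.mem_filter.2 ⟨Finset.mem_univ _, h⟩⟩, by simp [leaf]⟩

lemma IsTree.degree_pos (hG : G.IsTree) {e : Sym2 V} (he : e ∈ G.edgeSet) (v : V) :
    0 < G.degree v := by
  have : Nontrivial V := by
    induction e with
    | _ a b => exact ⟨a, b, G.ne_of_adj he⟩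
  exact hG.1.1.degree_pos_of_nontrivial v

/-- Each side of an edge contains a leaf. -/
lemma IsTree.exists_leaf_not_sep (hG : G.IsTree) {e : Sym2 V} (he : e ∈ G.edgeSet) (u : V) :
    ∃ k, ¬ G.Sep e u (G.leaf k) := by
  by_contra! hcon
  have h : ∑ w ∈ G.side e u, (2 - (G.degree w : ℤ)) ≤ 0 := Finset.sum_nonpos fun w hw => by
    have h1 := hG.degree_pos he w
    have h2 : G.degree w ≠ 1 := fun h => by
      obtain ⟨k, rfl⟩ := exists_leaf_eq h
      exact mem_side.1 hw (hcon k)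
    omega
  rw [hG.sum_side' he u] at h
  exact absurd h (by norm_num)

/-- Any two edges of a tree lie on a common path between two leaves. -/
lemma IsTree.exists_leaf_sep_sep (hG : G.IsTree) {e e' : Sym2 V} (he : e ∈ G.edgeSet)
    (he' : e' ∈ G.edgeSet) (hne : e ≠ e') :
    ∃ i j, G.Sep e (G.leaf i) (G.leaf j) ∧ G.Sep e' (G.leaf i) (G.leaf j) := by
  -- the end `a` of `e` averted from `e'`, and the end `c` of `e'` averted from `e`
  obtain ⟨c₀, hc₀⟩ : ∃ c, c ∈ e' := ⟨_, fstEnd_mem e'⟩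
  obtain ⟨a, ha, h1⟩ := (hG.exists_mem_sep he c₀).1
  obtain ⟨c, hc, h2⟩ := (hG.exists_mem_sep he' a).1
  replace h1 : G.Sep e c a := h1.of_left (not_sep_of_mem_of_mem he' hne.symm hc₀ hc)
  obtain ⟨j, hj⟩ := hG.exists_leaf_not_sep he a
  obtain ⟨i, hi⟩ := hG.exists_leaf_not_sep he' c
  have hi' : ¬ G.Sep e c (G.leaf i) := fun h => not_sep_of_mem h hi ha (sep_comm.1 h2)
  have hj' : ¬ G.Sep e' a (G.leaf j) := fun h => not_sep_of_mem h hj hc (sep_comm.1 h1)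
  exact ⟨i, j, (h1.of_left hi').of_right (not_sep_symm hj),
    sep_comm.1 ((h2.of_left hj').of_right (not_sep_symm hi))⟩

/-- The edge `e` separates the leaf `k` from all other leaves. -/
def Isolates (G : SimpleGraph V) [DecidableRel G.Adj] (e : Sym2 V) (k : Fin (numLeaves G)) : Prop :=
  ∀ j, j ≠ k → G.Sep e (G.leaf k) (G.leaf j)

lemma IsTree.sep_iff_of_isolates (hG : G.IsTree) {e : Sym2 V} {k : Fin (numLeaves G)}
    (hk : G.Isolates e k) {i j : Fin (numLeaves G)} (hij : i ≠ j) :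
    G.Sep e (G.leaf i) (G.leaf j) ↔ k = i ∨ k = j := by
  constructor
  · intro h
    by_contra! hc
    exact hG.not_sep_of_sep_of_sep (sep_comm.1 (hk i hc.1.symm)) (hk j hc.2.symm) h
  · rintro (rfl | rfl)
    · exact hk j hij.symm
    · exact sep_comm.1 (hk i hij)

/-- Each vertex other than a leaf `a` is separated from `a` by the edge at `a`. -/
lemma sep_of_degree_eq_one {a b : V} (ha : G.degree a = 1) (hab : G.Adj a b) {w : V}
    (hw : w ≠ a) : G.Sep s(a, b) a w := by
  rintro ⟨p⟩
  cases p with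
  | nil => exact hw rfl
  | cons h p =>
    rw [deleteEdges_adj] at h
    obtain ⟨b', -, hb'⟩ := degree_eq_one_iff_existsUnique_adj.1 ha
    exact h.2 (by rw [hb' _ h.1, hb' _ hab]; rfl)

lemma isolates_of_leaf_mem {e : Sym2 V} (he : e ∈ G.edgeSet) {k : Fin (numLeaves G)}
    (hk : G.leaf k ∈ e) : G.Isolates e k := by
  obtain ⟨b, rfl⟩ := hk
  exact fun j hj => sep_of_degree_eq_one (degree_leaf k) he fun h => hj (leaf_injective h)

/-- There are no branching vertices between a leaf and an edge which isolates it. -/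
lemma IsTree.degree_le_two_of_isolates (hG : G.IsTree) {e : Sym2 V} (he : e ∈ G.edgeSet)
    {k : Fin (numLeaves G)} (hk : G.Isolates e k) {v : V} (hv : ¬ G.Sep e (G.leaf k) v) :
    G.degree v ≤ 2 := by
  classical
  by_contra! hdeg
  have hmem : v ∈ (G.side e (G.leaf k)).erase (G.leaf k) := Finset.mem_erase.2
    ⟨fun h => by rw [h, degree_leaf] at hdeg; omega, mem_side.2 hv⟩
  have h1 := hG.sum_side' he (G.leaf k)
  rw [← Finset.add_sum_erase _ _ (mem_side.2 (not_sep_self e (G.leaf k))), degree_leaf,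
    ← Finset.add_sum_erase _ _ hmem] at h1
  have h2 : ∑ w ∈ ((G.side e (G.leaf k)).erase (G.leaf k)).erase v, (2 - (G.degree w : ℤ)) ≤ 0 :=
    Finset.sum_nonpos fun w hw => by
      have h3 := Finset.mem_of_mem_erase hw
      have h4 := hG.degree_pos he w
      have h5 : G.degree w ≠ 1 := fun h => by
        obtain ⟨j, rfl⟩ := exists_leaf_eq h
        rw [Finset.mem_erase, mem_side] at h3
        exact h3.2 (hk j fun h => h3.1 (h ▸ rfl))
      omega
  push_cast at h1
  omega

/-- An edge isolates a leaf if there are no branching vertices on one of its sides. -/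
lemma IsTree.exists_isolates (hG : G.IsTree) {e : Sym2 V} (he : e ∈ G.edgeSet) {u : V}
    (hu : ∀ v, ¬ G.Sep e u v → G.degree v ≤ 2) : ∃ k, G.Isolates e k := by
  classical
  obtain ⟨k, hk⟩ := hG.exists_leaf_not_sep he u
  refine ⟨k, fun j hj hkj => ?_⟩
  have h := hG.sum_side' he u
  have hmem : G.leaf j ∈ (G.side e u).erase (G.leaf k) := Finset.mem_erase.2
    ⟨fun h => hj (leaf_injective h), mem_side.2 (not_sep_trans hk (not_not.2 hkj))⟩
  rw [← Finset.add_sum_erase _ _ (mem_side.2 hk), ← Finset.add_sum_erase _ _ hmem, degree_leaf,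
    degree_leaf] at h
  have h2 : 0 ≤ ∑ w ∈ ((G.side e u).erase (G.leaf k)).erase (G.leaf j), (2 - (G.degree w : ℤ)) :=
    Finset.sum_nonneg fun w hw => by
      have h3 := hu w (mem_side.1 (Finset.mem_of_mem_erase (Finset.mem_of_mem_erase hw)))
      omega
  push_cast at h
  omega

/-! ### Averaging over the pairs of leaves -/

/-- An edge with `S` leaves on one side and `T` leaves on the other separates `S T` pairs of leaves
(here, ordered pairs are counted). -/
lemma IsTree.exists_card_mul (hG : G.IsTree) {e : Sym2 V} (he : e ∈ G.edgeSet) :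
    ∃ S T : ℕ, 1 ≤ S ∧ 1 ≤ T ∧ S + T = numLeaves G ∧ (S = 1 ∨ T = 1 → ∃ k, G.Isolates e k) ∧
      ∑ i, ∑ j, G.cut e (G.leaf i) (G.leaf j) = 2 * S * T := by
  classical
  obtain ⟨a, ha⟩ : ∃ a, a ∈ e := ⟨_, fstEnd_mem e⟩
  obtain ⟨b, hb, hab⟩ := (hG.exists_mem_sep he a).1
  set A : Finset (Fin (numLeaves G)) := Finset.univ.filter fun i => G.Sep e a (G.leaf i) with hA
  set B : Finset (Fin (numLeaves G)) := Finset.univ.filter fun i => ¬ G.Sep e a (G.leaf i) with hB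
  have hmA : ∀ i, i ∈ A ↔ G.Sep e a (G.leaf i) := fun i => by simp [hA]
  have hmB : ∀ i, i ∈ B ↔ ¬ G.Sep e a (G.leaf i) := fun i => by simp [hB]
  have hcard : A.card + B.card = numLeaves G := by
    rw [hA, hB, Finset.card_filter_add_card_filter_not, Finset.card_univ, Fintype.card_fin]
  refine ⟨A.card, B.card, ?_, ?_, hcard, ?_, ?_⟩
  · obtain ⟨k, hk⟩ := hG.exists_leaf_not_sep he b
    exact Finset.card_pos.2 ⟨k, (hmA k).2 (hab.of_right (not_sep_symm hk))⟩
  · obtain ⟨k, hk⟩ := hG.exists_leaf_not_sep he a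
    exact Finset.card_pos.2 ⟨k, (hmB k).2 hk⟩
  · rintro (h | h) <;> obtain ⟨k, hk⟩ := Finset.card_eq_one.1 h
    · have h1 : G.Sep e a (G.leaf k) := (hmA k).1 (hk ▸ Finset.mem_singleton_self k)
      refine ⟨k, fun j hj => ?_⟩
      have h2 : ¬ G.Sep e a (G.leaf j) := fun h' =>
        hj (Finset.mem_singleton.1 (hk ▸ (hmA j).2 h'))
      exact sep_comm.1 (h1.of_left h2)
    · have h1 : ¬ G.Sep e a (G.leaf k) := (hmB k).1 (hk ▸ Finset.mem_singleton_self k)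
      refine ⟨k, fun j hj => ?_⟩
      have h2 : G.Sep e a (G.leaf j) := by
        by_contra h'
        exact hj (Finset.mem_singleton.1 (hk ▸ (hmB j).2 h'))
      exact h2.of_left h1
  · have hsum : ∑ i, G.cut e a (G.leaf i) = A.card := by
      simp [cut, hA]
    have hc : ∀ i j, G.cut e (G.leaf i) (G.leaf j) = G.cut e a (G.leaf i) + G.cut e a (G.leaf j) -
        2 * (G.cut e a (G.leaf i) * G.cut e a (G.leaf j)) := fun i j => by
      rw [hG.cut_add e (G.leaf i) a (G.leaf j), cut_comm e (G.leaf i) a, mul_assoc]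
    simp only [hc, Finset.sum_sub_distrib, Finset.sum_add_distrib, ← Finset.mul_sum,
      ← Finset.sum_mul, hsum, Finset.sum_const, Finset.card_univ, Fintype.card_fin, nsmul_eq_mul]
    have hcard' : (numLeaves G : ℝ) = A.card + B.card := by exact_mod_cast hcard.symm
    rw [hcard']
    ring

/-- The path distance of two vertices of a tree, for the edge lengths `l`: the sum of the lengths of
the edges which separate them. -/
noncomputable def treeDist (G : SimpleGraph V) [DecidableRel G.Adj] (l : G.edgeSet → ℝ) (u v : V) :
    ℝ := ∑ e, l e * G.cut e u v

/-- The edge lengths `l` are those of an equilateral star of total length one: any two leaves have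
the same distance `2 / m`, where `m` is the number of leaves. -/
def IsEquidistant (G : SimpleGraph V) [DecidableRel G.Adj] (l : G.edgeSet → ℝ) : Prop :=
  ∀ i j, i ≠ j → G.treeDist l (G.leaf i) (G.leaf j) = 2 / numLeaves G

/-- The averaging argument: the distances of the leaves cannot all be at most `2 / m` unless they are
all equal to `2 / m`, as an edge with `S` and `T` leaves on its sides contributes to the sum of all
distances with the weight `2 S T = 2 (m - 1) + 2 (S - 1) (T - 1)`. -/
lemma IsTree.isEquidistant_of_le (hG : G.IsTree) (hm : 2 ≤ numLeaves G) {l : G.edgeSet → ℝ}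
    (hl : ∀ e, 0 ≤ l e) (hsum : ∑ e, l e = 1)
    (hd : ∀ i j, i ≠ j → G.treeDist l (G.leaf i) (G.leaf j) ≤ 2 / numLeaves G) :
    G.IsEquidistant l ∧ ∀ e, 0 < l e → ∃ k, G.Isolates e k := by
  have hm0 : (numLeaves G : ℝ) ≠ 0 := by positivity
  set N : G.edgeSet → ℝ := fun e => ∑ i, ∑ j, G.cut e (G.leaf i) (G.leaf j) with hN
  have hN1 : ∀ e, 0 ≤ N e - 2 * (numLeaves G - 1) ∧
      (N e - 2 * (numLeaves G - 1) = 0 → ∃ k, G.Isolates e k) := by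
    intro e
    obtain ⟨S, T, hS, hT, hST, hiso, heq⟩ := hG.exists_card_mul e.2
    have h1 : N e - 2 * (numLeaves G - 1) = 2 * ((S : ℝ) - 1) * ((T : ℝ) - 1) := by
      rw [hN]
      simp only
      rw [heq, ← hST]
      push_cast
      ring
    have hS' : (1 : ℝ) ≤ S := by exact_mod_cast hS
    have hT' : (1 : ℝ) ≤ T := by exact_mod_cast hT
    rw [h1]
    refine ⟨mul_nonneg (by linarith) (by linarith), fun h => hiso ?_⟩
    rcases mul_eq_zero.1 h with h | h
    · left; exact_mod_cast (by linarith : (S : ℝ) = 1)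
    · right; exact_mod_cast (by linarith : (T : ℝ) = 1)
  have hg : ∑ i : Fin (numLeaves G), ∑ j, (if i = j then (0 : ℝ) else 2 / numLeaves G) =
      2 * (numLeaves G - 1) := by
    have : ∀ i j : Fin (numLeaves G), (if i = j then (0 : ℝ) else 2 / numLeaves G) =
        2 / numLeaves G - if i = j then 2 / (numLeaves G : ℝ) else 0 := fun i j => by
      split_ifs <;> ring
    simp only [this, Finset.sum_sub_distrib, Finset.sum_ite_eq, Finset.mem_univ, if_true,
      Finset.sum_const, Finset.card_univ, Fintype.card_fin, nsmul_eq_mul]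
    field_simp
  have hdsum : ∑ i, ∑ j, G.treeDist l (G.leaf i) (G.leaf j) = ∑ e, l e * N e := by
    simp only [treeDist, hN, Finset.mul_sum]
    rw [Finset.sum_congr rfl fun i _ => Finset.sum_comm, Finset.sum_comm]
  have hnn : ∀ i j, 0 ≤ (if i = j then (0 : ℝ) else 2 / numLeaves G) -
      G.treeDist l (G.leaf i) (G.leaf j) := by
    intro i j
    split_ifs with hij
    · simp [hij, treeDist, cut_self]
    · exact sub_nonneg.2 (hd i j hij)
  have htot : ∑ i, ∑ j, ((if i = j then (0 : ℝ) else 2 / numLeaves G) -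
      G.treeDist l (G.leaf i) (G.leaf j)) = - ∑ e, l e * (N e - 2 * (numLeaves G - 1)) := by
    simp only [Finset.sum_sub_distrib, hg, hdsum, mul_sub, ← Finset.sum_mul, hsum]
    ring
  have hE : ∀ e ∈ Finset.univ, 0 ≤ l e * (N e - 2 * (numLeaves G - 1)) := fun e _ =>
    mul_nonneg (hl e) (hN1 e).1
  have hz : ∑ e, l e * (N e - 2 * (numLeaves G - 1)) = 0 := by
    refine le_antisymm ?_ (Finset.sum_nonneg hE)
    have := Finset.sum_nonneg fun i (_ : i ∈ Finset.univ) =>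
      Finset.sum_nonneg fun j (_ : j ∈ Finset.univ) => hnn i j
    linarith
  rw [hz, neg_zero] at htot
  constructor
  · intro i j hij
    have h1 := (Finset.sum_eq_zero_iff_of_nonneg fun i (_ : i ∈ Finset.univ) =>
      Finset.sum_nonneg fun j (_ : j ∈ Finset.univ) => hnn i j).1 htot i (Finset.mem_univ _)
    have h2 := (Finset.sum_eq_zero_iff_of_nonneg fun j (_ : j ∈ Finset.univ) => hnn i j).1 h1 j
      (Finset.mem_univ _)
    rw [if_neg hij] at h2
    linarith
  · intro e he
    have h1 := (Finset.sum_eq_zero_iff_of_nonneg hE).1 hz e (Finset.mem_univ _)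
    exact (hN1 e).2 ((mul_eq_zero.1 h1).resolve_left he.ne')

/-! ### Equidistant edge lengths -/

/-- Edge lengths are equidistant if they arise by distributing, for each leaf, the length `1 / m`
among the edges that isolate it. -/
lemma IsTree.isEquidistant_sum (hG : G.IsTree) {c : Fin (numLeaves G) → G.edgeSet → ℝ}
    (hsum : ∀ k, ∑ e, c k e = 1 / numLeaves G) (hc : ∀ k e, c k e ≠ 0 → G.Isolates e k) :
    G.IsEquidistant fun e => ∑ k, c k e := by
  intro i j hij
  have h1 : ∀ k, ∑ e : G.edgeSet, c k e * G.cut e (G.leaf i) (G.leaf j) =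
      (if k = i then 1 / (numLeaves G : ℝ) else 0) + if k = j then 1 / (numLeaves G : ℝ) else 0 := by
    intro k
    have h2 : ∀ e : G.edgeSet, c k e * G.cut e (G.leaf i) (G.leaf j) =
        c k e * ((if k = i then 1 else 0) + if k = j then 1 else 0) := by
      intro e
      by_cases hce : c k e = 0
      · rw [hce, zero_mul, zero_mul]
      · congr 1
        have h3 := hG.sep_iff_of_isolates (hc k e hce) hij
        by_cases hki : k = i
        · rw [cut_eq_one (h3.2 (Or.inl hki)), if_pos hki, if_neg fun h => hij (hki ▸ h), add_zero]
        · by_cases hkj : k = j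
          · rw [cut_eq_one (h3.2 (Or.inr hkj)), if_pos hkj, if_neg hki, zero_add]
          · rw [cut_eq_zero fun h => (h3.1 h).elim hki hkj, if_neg hki, if_neg hkj, add_zero]
    rw [Finset.sum_congr rfl fun e _ => h2 e, ← Finset.sum_mul, hsum]
    split_ifs <;> ring
  rw [treeDist]
  simp only [Finset.sum_mul]
  rw [Finset.sum_comm, Finset.sum_congr rfl fun k _ => h1 k, Finset.sum_add_distrib]
  simp only [Finset.sum_ite_eq', Finset.mem_univ, if_true]
  ring

lemma sum_sum_eq_one (hm : 2 ≤ numLeaves G) {c : Fin (numLeaves G) → G.edgeSet → ℝ}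
    (hsum : ∀ k, ∑ e, c k e = 1 / numLeaves G) : ∑ e, ∑ k, c k e = 1 := by
  have hm0 : (numLeaves G : ℝ) ≠ 0 := by positivity
  rw [Finset.sum_comm, Finset.sum_congr rfl fun k _ => hsum k]
  simp [hm0]

lemma exists_leaf_edge (k : Fin (numLeaves G)) : ∃ e : G.edgeSet, G.leaf k ∈ (e : Sym2 V) := by
  obtain ⟨b, hb, -⟩ := degree_eq_one_iff_existsUnique_adj.1 (degree_leaf k)
  exact ⟨⟨s(G.leaf k, b), hb⟩, by simp⟩

open scoped Classical in
/-- The edge lengths which, for each leaf `k`, distribute the length `1 / m` evenly among the edges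
in the set `F k`. -/
lemma IsTree.exists_isEquidistant (hG : G.IsTree) (hm : 2 ≤ numLeaves G)
    (F : Fin (numLeaves G) → Finset G.edgeSet) (hF : ∀ k, (F k).Nonempty)
    (hFi : ∀ k, ∀ e ∈ F k, G.Isolates e k) :
    ∃ l : G.edgeSet → ℝ, (∀ e, 0 ≤ l e) ∧ ∑ e, l e = 1 ∧ G.IsEquidistant l ∧
      ∀ k, ∀ e ∈ F k, 0 < l e := by
  have hpos : ∀ k, 0 < 1 / ((numLeaves G : ℝ) * (F k).card) := fun k => by
    have := (hF k).card_pos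
    positivity
  set c : Fin (numLeaves G) → G.edgeSet → ℝ := fun k e =>
    if e ∈ F k then 1 / ((numLeaves G : ℝ) * (F k).card) else 0 with hc
  have hc0 : ∀ k e, 0 ≤ c k e := fun k e => by
    simp only [hc]
    split_ifs
    exacts [(hpos k).le, le_rfl]
  have hsum : ∀ k, ∑ e, c k e = 1 / numLeaves G := fun k => by
    have := (hF k).card_pos
    simp only [hc, Finset.sum_ite_mem, Finset.univ_inter, Finset.sum_const, nsmul_eq_mul]
    field_simp
  refine ⟨fun e => ∑ k, c k e, fun e => Finset.sum_nonneg fun k _ => hc0 k e,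
    sum_sum_eq_one hm hsum, hG.isEquidistant_sum hsum fun k e h => hFi k e ?_, fun k e he => ?_⟩
  · by_contra hk
    exact h (if_neg hk)
  · refine Finset.sum_pos' (fun k _ => hc0 k e) ⟨k, Finset.mem_univ _, ?_⟩
    simp only [hc, if_pos he]
    exact hpos k

end SimpleGraph

/-! ### The metric graphs of a tree -/

namespace SimpleGraph

variable {V : Type*} {G : SimpleGraph V} [Fintype V] [DecidableRel G.Adj]

/-- The ends of an edge which separates `i` from `j` lie on the path from `i` to `j`. -/
lemma IsTree.treeDist_add (hG : G.IsTree) (l : G.edgeSet → ℝ) {e : Sym2 V} (he : e ∈ G.edgeSet)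
    {i j v : V} (h : G.Sep e i j) (hv : v ∈ e) :
    G.treeDist l i v + G.treeDist l v j = G.treeDist l i j := by
  simp only [treeDist, ← Finset.sum_add_distrib]
  refine Finset.sum_congr rfl fun e' _ => ?_
  have h1 : G.cut e' i v * G.cut e' v j = 0 := by
    by_contra hne
    exact hG.not_sep_and_sep he h hv ⟨cut_ne_zero_iff.1 (left_ne_zero_of_mul hne),
      cut_ne_zero_iff.1 (right_ne_zero_of_mul hne)⟩
  linear_combination (-l e') * hG.cut_add (e' : Sym2 V) i v j + 2 * l e' * h1

lemma treeDist_comm (l : G.edgeSet → ℝ) (u v : V) : G.treeDist l u v = G.treeDist l v u :=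
  Finset.sum_congr rfl fun e _ => by rw [cut_comm]

/-- The position of the projection of the vertex `v` to the path from `p` to `q`. -/
noncomputable def position (G : SimpleGraph V) [DecidableRel G.Adj] (l : G.edgeSet → ℝ)
    (p q v : V) : ℝ := ∑ e : G.edgeSet, l e * G.cut e p q * G.cut e p v

lemma IsTree.two_mul_position (hG : G.IsTree) (l : G.edgeSet → ℝ) (p q v : V) :
    2 * G.position l p q v = G.treeDist l p q + G.treeDist l p v - G.treeDist l v q := by
  simp only [treeDist, position, Finset.mul_sum, ← Finset.sum_add_distrib, ← Finset.sum_sub_distrib]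
  refine Finset.sum_congr rfl fun e _ => ?_
  rw [hG.cut_add e v p q, cut_comm _ v p]
  ring

lemma position_sub (l : G.edgeSet → ℝ) (p q : V) {u v : V} (h : G.Adj u v) :
    G.position l p q v - G.position l p q u =
      l ⟨s(u, v), h⟩ * G.cut s(u, v) p q * (G.cut s(u, v) p v - G.cut s(u, v) p u) := by
  simp only [position, ← Finset.sum_sub_distrib, ← mul_sub]
  refine Finset.sum_eq_single_of_mem (⟨s(u, v), h⟩ : G.edgeSet) (Finset.mem_univ _) fun e _ he => ?_
  rw [IsTree.cut_of_adj_of_ne h (fun h' => he (Subtype.ext h'.symm)), sub_self, mul_zero]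

end SimpleGraph

namespace MetricGraph

open SimpleGraph

variable {V : Type*} {G : SimpleGraph V} [Fintype V] {l : G.edgeSet → ℝ}

/-- The vertex of the metric graph of `G` that comes from the vertex `v` of `G`. -/
def mkVert (l : G.edgeSet → ℝ) (v : V) : (ofGraph G l).Vert := Quot.mk _ v

lemma mkVert_eq {e : G.edgeSet} (he : l e = 0) :
    mkVert l (fstEnd (e : Sym2 V)) = mkVert l (sndEnd (e : Sym2 V)) := by
  refine Quot.sound ⟨adj_ends e.2, ?_⟩
  rw [← he]
  exact congrArg l (Subtype.ext (mk_ends _))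

variable [DecidableRel G.Adj]

lemma sum_ofGraph (hl : ∀ e, 0 ≤ l e) {F : G.edgeSet → ℝ} (hF : ∀ e, l e = 0 → F e = 0) :
    ∑ e : (ofGraph G l).Edge, F e.1 = ∑ e, F e := by
  classical
  have h : ∑ e ∈ Finset.univ.filter (fun e => 0 < l e), F e = ∑ e : (ofGraph G l).Edge, F e.1 :=
    Finset.sum_subtype (p := fun e => 0 < l e) _ (by simp) F
  rw [← h, Finset.sum_filter_of_ne]
  intro e _ hne
  exact lt_of_le_of_ne (hl e) fun h' => hne (hF e h'.symm)

lemma isConn_ofGraph (hG : G.IsTree) (hl : ∀ e, 0 ≤ l e) : (ofGraph G l).IsConn := by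
  intro H hH v w
  induction v using Quot.ind with | _ v =>
  induction w using Quot.ind with | _ w =>
  have h := hG.sum_cut_mul (fun u => H (mkVert l u)) w v
  rw [Finset.sum_eq_zero] at h
  · exact sub_eq_zero.1 h.symm
  · intro e _
    rcases (hl e).eq_or_lt with he | he
    · rw [mkVert_eq he.symm]; ring
    · rw [show H (mkVert l (fstEnd (e : Sym2 V))) = H (mkVert l (sndEnd (e : Sym2 V))) from
        hH ⟨e, he⟩]
      ring

/-- The path between two vertices of a tree is a geodesic of the metric graph. -/
lemma geodFlow_ofGraph (hG : G.IsTree) (hl : ∀ e, 0 ≤ l e) (p q : V) :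
    (ofGraph G l).GeodFlow (mkVert l p) (mkVert l q) (G.treeDist l p q)
      (Quot.lift (G.position l p q) fun u v ⟨h, hz⟩ => by
        have := position_sub l p q h
        rw [hz] at this
        linarith)
      (fun e => G.cut e.1 p q * G.sgn p e.1) where
  nonneg v := by
    induction v using Quot.ind with | _ v =>
    exact Finset.sum_nonneg fun e _ =>
      mul_nonneg (mul_nonneg (hl e) (cut_nonneg _ _ _)) (cut_nonneg _ _ _)
  le v := by
    induction v using Quot.ind with | _ v =>
    exact Finset.sum_le_sum fun e _ =>
      mul_le_of_le_one_right (mul_nonneg (hl e) (cut_nonneg _ _ _)) (cut_le_one _ _ _)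
  start := Finset.sum_eq_zero fun e _ => by rw [cut_self, mul_zero]
  finish := Finset.sum_congr rfl fun e _ => by
    rcases G.cut_eq_zero_or_one e p q with h | h <;> rw [h] <;> ring
  unit e := by
    rcases G.cut_eq_zero_or_one e.1 p q with h | h <;> rw [h]
    · left; ring
    · right; rw [one_mul]; exact hG.sgn_eq p e.1.2
  speed e := by
    have h := position_sub l p q (adj_ends e.1.2)
    have he : (⟨s(fstEnd (e.1 : Sym2 V), sndEnd (e.1 : Sym2 V)), adj_ends e.1.2⟩ : G.edgeSet) =
      e.1 := Subtype.ext (mk_ends _)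
    rw [he, mk_ends] at h
    refine h.trans ?_
    change _ = G.cut e.1 p q * G.sgn p e.1 * l e.1
    rw [sgn]
    ring
  flow H := by
    have h := sum_ofGraph hl (F := fun e => G.cut e p q * G.sgn p e *
      (H (mkVert l (sndEnd (e : Sym2 V))) - H (mkVert l (fstEnd (e : Sym2 V)))))
      fun e he => by rw [mkVert_eq he]; ring
    refine h.trans ?_
    rw [← hG.sum_cut_mul (fun u => H (mkVert l u)) p q]
    exact Finset.sum_congr rfl fun e _ => mul_assoc _ _ _

/-- The metric graph of a tree with equidistant edge lengths is an equilateral star. -/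
noncomputable def starDataOfGraph (hG : G.IsTree) (hm : 2 ≤ numLeaves G) (hl : ∀ e, 0 ≤ l e)
    (hsum : ∑ e, l e = 1) (h : G.IsEquidistant l) : StarData (ofGraph G l) (numLeaves G) where
  leaf k := mkVert l (G.leaf k)
  x i j := Quot.lift (G.position l (G.leaf i) (G.leaf j)) fun u v ⟨h, hz⟩ => by
    have := position_sub l (G.leaf i) (G.leaf j) h
    rw [hz] at this
    linarith
  ε i j e := G.cut e.1 (G.leaf i) (G.leaf j) * G.sgn (G.leaf i) e.1
  conn := isConn_ofGraph hG hl
  geod i j hij := h i j hij ▸ geodFlow_ofGraph hG hl (G.leaf i) (G.leaf j)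
  proj i j hij e he := by
    have hsep : ¬ G.Sep e.1 (G.leaf i) (G.leaf j) := by
      intro hs
      rw [cut_eq_one hs, one_mul] at he
      rcases hG.sgn_eq (G.leaf i) e.1.2 with h1 | h1 <;> rw [h1] at he <;> norm_num at he
    obtain ⟨k, hk⟩ := (hG.isEquidistant_of_le hm hl hsum fun i j hij => (h i j hij).le).2 e.1 e.2
    have hki : k ≠ i := fun h' => hsep ((hG.sep_iff_of_isolates hk hij).2 (Or.inl h'))
    have hkj : k ≠ j := fun h' => hsep ((hG.sep_iff_of_isolates hk hij).2 (Or.inr h'))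
    have h1 := hG.treeDist_add l e.1.2 (hk i hki.symm) (fstEnd_mem _)
    have h2 := hG.treeDist_add l e.1.2 (hk j hkj.symm) (fstEnd_mem _)
    have h3 := hG.two_mul_position l (G.leaf i) (G.leaf j) (fstEnd (e.1 : Sym2 V))
    rw [treeDist_comm l (G.leaf i) (fstEnd (e.1 : Sym2 V)), h i j hij] at h3
    rw [h k i hki] at h1
    rw [h k j hkj] at h2
    change G.position l (G.leaf i) (G.leaf j) (fstEnd (e.1 : Sym2 V)) = 1 / numLeaves G
    have h4 : (2 : ℝ) / numLeaves G = 2 * (1 / numLeaves G) := by ring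
    linarith
  owner e := by
    obtain ⟨k, hk⟩ := (hG.isEquidistant_of_le hm hl hsum fun i j hij => (h i j hij).le).2 e.1 e.2
    refine ⟨k, fun i j hij => ?_⟩
    rw [← hG.sep_iff_of_isolates hk hij, ← cut_ne_zero_iff]
    have : G.sgn (G.leaf i) e.1 ≠ 0 := by
      rcases hG.sgn_eq (G.leaf i) e.1.2 with h1 | h1 <;> rw [h1] <;> norm_num
    simp [this]

/-! ### The maximal spectral gap -/

/-- A nonconstant eigenfunction from the path between two leaves at maximal distance, which is at
least `2 / m`. -/
lemma exists_eigenfunction_ofGraph (hG : G.IsTree) (hm : 2 ≤ numLeaves G) (hl : ∀ e, 0 ≤ l e)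
    (hsum : ∑ e, l e = 1) :
    ∃ D, 2 / (numLeaves G : ℝ) ≤ D ∧ (D = 2 / numLeaves G → G.IsEquidistant l) ∧
      ∃ (k : ℝ) (f : (ofGraph G l).Point → ℝ), 0 ≤ k ∧ k ≤ Real.pi / D ∧
        (ofGraph G l).IsNeumannLaplacian f ((k ^ 2) • f) ∧ ¬ ∃ c, ∀ p, f p = c := by
  classical
  have hmpos : (0 : ℝ) < 2 / numLeaves G := by positivity
  obtain ⟨⟨i, j⟩, hij, hmax⟩ := Finset.exists_max_image
    (Finset.univ : Finset (Fin (numLeaves G))).offDiag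
    (fun p => G.treeDist l (G.leaf p.1) (G.leaf p.2))
    ⟨(⟨0, by omega⟩, ⟨1, by omega⟩), by simp⟩
  simp only [Finset.mem_offDiag, Finset.mem_univ, true_and, Prod.forall] at hij hmax
  set D := G.treeDist l (G.leaf i) (G.leaf j) with hD
  have hDm : 2 / (numLeaves G : ℝ) ≤ D := by
    by_contra! hlt
    have := (hG.isEquidistant_of_le hm hl hsum fun i' j' h => (hmax i' j' h).trans hlt.le).1 i j hij
    exact hlt.ne this
  have hDpos : 0 < D := hmpos.trans_le hDm
  refine ⟨D, hDm, fun h =>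
    (hG.isEquidistant_of_le hm hl hsum fun i' j' h' => (hmax i' j' h').trans h.le).1, ?_⟩
  have hflow := geodFlow_ofGraph hG hl (G.leaf i) (G.leaf j)
  by_cases hlen : ∀ e, l e < D
  · exact hflow.exists_eigenfunction (isConn_ofGraph hG hl) hDpos fun e => hlen e.1
  · -- an edge of length at least `D` is the only edge of positive length
    push Not at hlen
    obtain ⟨e₀, he₀⟩ := hlen
    have huniq : ∀ e, 0 < l e → e = e₀ := by
      intro e he
      by_contra hne
      obtain ⟨i', j', h1, h2⟩ := hG.exists_leaf_sep_sep e.2 e₀.2 fun h => hne (Subtype.ext h)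
      have hij' : i' ≠ j' := fun h => not_sep_self _ _ (h ▸ h1)
      have h3 := hmax i' j' hij'
      have h4 : ∑ e' ∈ {e, e₀}, l e' * G.cut (e' : Sym2 V) (G.leaf i') (G.leaf j') ≤
          G.treeDist l (G.leaf i') (G.leaf j') :=
        Finset.sum_le_sum_of_subset_of_nonneg (Finset.subset_univ _)
          fun e' _ _ => mul_nonneg (hl e') (cut_nonneg _ _ _)
      rw [Finset.sum_pair hne, cut_eq_one h1, cut_eq_one h2] at h4
      linarith
    have : Subsingleton (ofGraph G l).Edge :=
      ⟨fun e e' => Subtype.ext ((huniq e.1 e.2).trans (huniq e'.1 e'.2).symm)⟩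
    obtain ⟨f, hf, hne⟩ := hflow.exists_eigenfunction_of_subsingleton hDpos
    exact ⟨Real.pi / D, f, by positivity, le_rfl, hf, hne⟩

lemma pi_div_le {m D : ℝ} (hm : 0 < m) (hD : 2 / m ≤ D) : Real.pi / D ≤ Real.pi / 2 * m := by
  have h : 0 < 2 / m := by positivity
  calc Real.pi / D ≤ Real.pi / (2 / m) := div_le_div_of_nonneg_left Real.pi_pos.le h hD
    _ = Real.pi / 2 * m := by field_simp

lemma spectralGap_ofGraph_le (hG : G.IsTree) (hm : 2 ≤ numLeaves G) (hl : ∀ e, 0 ≤ l e)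
    (hsum : ∑ e, l e = 1) : (ofGraph G l).spectralGap ≤ Real.pi / 2 * numLeaves G := by
  obtain ⟨D, hD, -, k, f, hk, hkD, hf, hne⟩ := exists_eigenfunction_ofGraph hG hm hl hsum
  have : Nonempty (ofGraph G l).Point := ⟨vert _ (mkVert l (G.leaf ⟨0, by omega⟩))⟩
  exact spectralGap_le_of_nonconst hk (hkD.trans (pi_div_le (by positivity) hD)) hf hne

/-- The spectral gap is at most `π / D`, where `D` is the maximal distance of two leaves, so the bound
is attained only if `D = 2 / m`. -/
lemma spectralGap_ofGraph_eq_iff (hG : G.IsTree) (hm : 2 ≤ numLeaves G) (hl : ∀ e, 0 ≤ l e)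
    (hsum : ∑ e, l e = 1) :
    (ofGraph G l).spectralGap = Real.pi / 2 * numLeaves G ↔ G.IsEquidistant l := by
  obtain ⟨D, hD, hDeq, k, f, hk, hkD, hf, hne⟩ := exists_eigenfunction_ofGraph hG hm hl hsum
  have hm0 : (0 : ℝ) < numLeaves G := by positivity
  constructor
  · intro h
    refine hDeq (le_antisymm ?_ hD)
    have : Nonempty (ofGraph G l).Point := ⟨vert _ (mkVert l (G.leaf ⟨0, by omega⟩))⟩
    have h1 := h ▸ spectralGap_le_of_nonconst hk hkD hf hne
    have hDpos : 0 < D := lt_of_lt_of_le (by positivity) hD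
    rw [le_div_iff₀ hDpos] at h1
    rw [le_div_iff₀ hm0]
    nlinarith [Real.pi_pos]
  · intro h
    exact (starDataOfGraph hG hm hl hsum h).spectralGap_eq hm hk
      (hkD.trans (pi_div_le hm0 hD)) hf hne

lemma isometric_ofGraph_iff (hG : G.IsTree) (hm : 2 ≤ numLeaves G) (hl : ∀ e, 0 ≤ l e)
    (hsum : ∑ e, l e = 1) :
    (ofGraph G l).Isometric (equilateralStar (numLeaves G)) ↔ G.IsEquidistant l := by
  constructor
  · rintro ⟨φ, hφ⟩
    refine (hG.isEquidistant_of_le hm hl hsum fun i j _ => ?_).1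
    have h1 := (geodFlow_ofGraph hG hl (G.leaf i) (G.leaf j)).le_dist_ends (isConn_ofGraph hG hl)
    rw [← hφ] at h1
    exact h1.trans ((equilateralStarData _).dist_le hm _ _)
  · intro h
    exact (starDataOfGraph hG hm hl hsum h).isometric (equilateralStarData _) hm

end MetricGraph

/-! ### Equidistant lengths and the shape of the tree -/

namespace SimpleGraph

variable {V : Type*} {G : SimpleGraph V}

lemma mem_closure_lengthSpace [Fintype G.edgeSet] {l : G.edgeSet → ℝ} :
    l ∈ closure (lengthSpace G) ↔ (∀ e, 0 ≤ l e) ∧ ∑ e, l e = 1 := by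
  constructor
  · intro h
    have hcl1 : IsClosed {l : G.edgeSet → ℝ | ∀ e, 0 ≤ l e} := by
      simp only [Set.ofPred_forall]
      exact isClosed_iInter fun e => isClosed_le continuous_const (by fun_prop)
    have hcl2 : IsClosed {l : G.edgeSet → ℝ | ∑ e, l e = 1} :=
      isClosed_eq (by fun_prop) continuous_const
    have hsub : lengthSpace G ⊆ {l | ∀ e, 0 ≤ l e} ∩ {l | ∑ e, l e = 1} :=
      fun l hl => ⟨fun e => (hl.2 e).le, hl.1⟩
    exact closure_minimal hsub (hcl1.inter hcl2) h
  · rintro ⟨h0, h1⟩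
    -- convex combinations with the vector of equal lengths
    have hne : Nonempty G.edgeSet := by
      by_contra hc
      rw [not_nonempty_iff] at hc
      simp at h1
    have hcard : (0 : ℝ) < Fintype.card G.edgeSet := Nat.cast_pos.2 Fintype.card_pos
    have hcont : Continuous fun t : ℝ => fun e : G.edgeSet =>
        (1 - t) * l e + t * (1 / (Fintype.card G.edgeSet : ℝ)) := by fun_prop
    have hlim := (hcont.tendsto 0).mono_left (nhdsWithin_le_nhds (s := Set.Ioi 0))
    have h00 : (fun e : G.edgeSet => (1 - (0 : ℝ)) * l e + 0 * (1 / (Fintype.card G.edgeSet : ℝ))) =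
        l := by ext e; ring
    rw [h00] at hlim
    refine mem_closure_of_tendsto hlim ?_
    filter_upwards [Ioo_mem_nhdsGT (zero_lt_one (α := ℝ))] with t ht
    refine ⟨?_, fun e => ?_⟩
    · rw [Finset.sum_add_distrib, ← Finset.mul_sum, h1]
      simp only [Finset.sum_const, Finset.card_univ, nsmul_eq_mul]
      field_simp
      ring
    · have h2 : 0 ≤ (1 - t) * l e := mul_nonneg (by linarith [ht.2]) (h0 e)
      have h3 : 0 < t * (1 / (Fintype.card G.edgeSet : ℝ)) := mul_pos ht.1 (by positivity)
      exact add_pos_of_nonneg_of_pos h2 h3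

variable [Fintype V] [DecidableRel G.Adj]

/-- If all edge lengths are positive, then every edge isolates some leaf, whereas an edge on the
path between two branching vertices does not. -/
lemma IsTree.eq_of_three_le_degree (hG : G.IsTree) (hm : 2 ≤ numLeaves G) {l : G.edgeSet → ℝ}
    (hl : l ∈ lengthSpace G) (h : G.IsEquidistant l) {v w : V} (hv : 3 ≤ G.degree v)
    (hw : 3 ≤ G.degree w) : v = w := by
  by_contra hvw
  obtain ⟨e, he, hsep⟩ := hG.exists_sep hvw
  obtain ⟨k, hk⟩ := (hG.isEquidistant_of_le hm (fun e => (hl.2 e).le) hl.1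
    fun i j hij => (h i j hij).le).2 ⟨e, he⟩ (hl.2 _)
  by_cases hkv : G.Sep e (G.leaf k) v
  · have h1 := hG.degree_le_two_of_isolates he hk (hG.not_sep_of_sep_of_sep hkv hsep)
    omega
  · have h1 := hG.degree_le_two_of_isolates he hk hkv
    omega

lemma IsTree.exists_isEquidistant_of_mem_closure (hG : G.IsTree) (hm : 2 ≤ numLeaves G) :
    ∃ l ∈ closure (lengthSpace G), G.IsEquidistant l := by
  classical
  obtain ⟨l, h0, h1, h2, -⟩ := hG.exists_isEquidistant hm
    (fun k => Finset.univ.filter fun e : G.edgeSet => G.leaf k ∈ (e : Sym2 V))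
    (fun k => by
      obtain ⟨e, he⟩ := exists_leaf_edge k
      exact ⟨e, by simpa using he⟩)
    (fun k e he => isolates_of_leaf_mem e.2 (by simpa using he))
  exact ⟨l, mem_closure_lengthSpace.2 ⟨h0, h1⟩, h2⟩

lemma IsTree.exists_isEquidistant_of_mem_lengthSpace (hG : G.IsTree) (hm : 2 ≤ numLeaves G)
    (hdeg : ∀ v w, 3 ≤ G.degree v → 3 ≤ G.degree w → v = w) :
    ∃ l ∈ lengthSpace G, G.IsEquidistant l := by
  classical
  have hiso : ∀ e : G.edgeSet, ∃ k, G.Isolates e k := by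
    rintro ⟨e, he⟩
    induction e with
    | _ a b =>
      -- the branching vertex lies on at most one of the two sides
      by_cases ha : ∀ v, ¬ G.Sep s(a, b) a v → G.degree v ≤ 2
      · exact hG.exists_isolates he ha
      · push Not at ha
        obtain ⟨v, hv, hv3⟩ := ha
        refine hG.exists_isolates he (u := b) fun w hw => ?_
        by_contra! hw3
        have hvw := hdeg v w hv3 hw3
        subst hvw
        exact hG.sep_of_adj he ((not_not.1 hv).trans (not_not.1 hw).symm)
  obtain ⟨l, -, h1, h2, h3⟩ := hG.exists_isEquidistant hm
    (fun k => Finset.univ.filter fun e : G.edgeSet => G.Isolates e k)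
    (fun k => by
      obtain ⟨e, he⟩ := exists_leaf_edge k
      exact ⟨e, by simpa using isolates_of_leaf_mem e.2 he⟩)
    (fun k e he => by simpa using he)
  refine ⟨l, ⟨h1, fun e => ?_⟩, h2⟩
  obtain ⟨k, hk⟩ := hiso e
  exact h3 k e (by simpa using hk)

lemma nontrivial_of_two_le_numLeaves (hm : 2 ≤ numLeaves G) : Nontrivial V :=
  ⟨G.leaf ⟨0, by omega⟩, G.leaf ⟨1, by omega⟩, fun h => by
    have := leaf_injective h
    simp at this⟩

/-- Without vertices of degree two, only the edge at a leaf isolates it. -/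
lemma IsTree.leaf_mem_of_isolates (hG : G.IsTree) (hdeg : ∀ v, G.degree v ≠ 2) {e : Sym2 V}
    (he : e ∈ G.edgeSet) {k : Fin (numLeaves G)} (hk : G.Isolates e k) : G.leaf k ∈ e := by
  obtain ⟨a, ha, hka⟩ := (hG.exists_mem_sep he (G.leaf k)).2
  have h1 := hG.degree_le_two_of_isolates he hk hka
  have h2 := hG.degree_pos he a
  obtain ⟨j, rfl⟩ := exists_leaf_eq (show G.degree a = 1 by have := hdeg a; omega)
  by_cases hj : j = k
  · rwa [← hj]
  · exact absurd (hk j hj) hka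

lemma eq_of_leaf_mem {e e' : G.edgeSet} {k : Fin (numLeaves G)} (he : G.leaf k ∈ (e : Sym2 V))
    (he' : G.leaf k ∈ (e' : Sym2 V)) : e = e' := by
  obtain ⟨e, h⟩ := e
  obtain ⟨e', h'⟩ := e'
  obtain ⟨b, rfl⟩ := he
  obtain ⟨c, rfl⟩ := he'
  obtain ⟨a, -, ha⟩ := degree_eq_one_iff_existsUnique_adj.1 (degree_leaf k)
  have hb : b = a := ha _ h
  have hc : c = a := ha _ h'
  subst hb hc
  rfl

/-- Without vertices of degree two, equidistant lengths are supported on the edges at the leaves.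
There, they are `1 / m`, unless the tree is a single edge. -/
lemma IsTree.isEquidistant_unique (hG : G.IsTree) (hm : 2 ≤ numLeaves G)
    (hdeg : ∀ v, G.degree v ≠ 2) {l l' : G.edgeSet → ℝ} (hl : l ∈ closure (lengthSpace G))
    (hl' : l' ∈ closure (lengthSpace G)) (h : G.IsEquidistant l) (h' : G.IsEquidistant l') :
    l = l' := by
  suffices H : ∃ g : G.edgeSet → ℝ, ∀ l ∈ closure (lengthSpace G), G.IsEquidistant l → l = g by
    obtain ⟨g, hg⟩ := H
    rw [hg l hl h, hg l' hl' h']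
  rcases hm.eq_or_lt with hm2 | hm3
  · -- with two leaves, the edge is the only one
    refine ⟨fun _ => 1, fun l hl h => ?_⟩
    have hall : ∀ (e : G.edgeSet) k, G.leaf k ∈ (e : Sym2 V) := by
      intro e k
      refine hG.leaf_mem_of_isolates hdeg e.2 ?_
      obtain ⟨S, T, hS, hT, hST, hiso, -⟩ := hG.exists_card_mul e.2
      obtain ⟨k', hk'⟩ := hiso (by omega)
      intro j hj
      exact (hG.sep_iff_of_isolates hk' hj.symm).2 (by
        have h1 := k.2
        have h2 := j.2
        have h3 := k'.2
        simp only [Fin.ext_iff] at hj ⊢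
        omega)
    have hsum := (mem_closure_lengthSpace.1 hl).2
    ext e
    rwa [Finset.sum_eq_single_of_mem e (Finset.mem_univ _) fun e' _ hne =>
      absurd (eq_of_leaf_mem (hall e' ⟨0, by omega⟩) (hall e ⟨0, by omega⟩)) hne] at hsum
  · classical
    refine ⟨fun e => if ∃ k, G.leaf k ∈ (e : Sym2 V) then 1 / numLeaves G else 0,
      fun l hl h => ?_⟩
    obtain ⟨hl0, hl1⟩ := mem_closure_lengthSpace.1 hl
    have hiso := (hG.isEquidistant_of_le hm hl0 hl1 fun i j hij => (h i j hij).le).2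
    ext e
    split_ifs with hk
    · obtain ⟨k, hk⟩ := hk
      -- the length of the edge at `k` from the distances of three leaves
      have hthree : ∀ a, ∃ b : Fin (numLeaves G), b ≠ k ∧ b ≠ a := fun a => by
        obtain ⟨b, hb⟩ := Finset.exists_mem_notMem_of_card_lt_card (s := {k, a})
          (t := (Finset.univ : Finset (Fin (numLeaves G))))
          (by rw [Finset.card_univ, Fintype.card_fin]; exact Finset.card_le_two.trans_lt hm3)
        exact ⟨b, by simpa using hb⟩
      obtain ⟨i, hi⟩ := hthree k
      obtain ⟨j, hj⟩ := hthree i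
      have h1 : G.treeDist l (G.leaf k) (G.leaf i) + G.treeDist l (G.leaf k) (G.leaf j) -
          G.treeDist l (G.leaf i) (G.leaf j) = 2 * l e := by
        simp only [treeDist, ← Finset.sum_add_distrib, ← Finset.sum_sub_distrib]
        have hki := cut_eq_one (isolates_of_leaf_mem e.2 hk i hi.1)
        have hkj := cut_eq_one (isolates_of_leaf_mem e.2 hk j hj.1)
        rw [Finset.sum_eq_single_of_mem e (Finset.mem_univ _), hki, hkj, cut_eq_zero]
        · ring
        · intro hs
          rcases (hG.sep_iff_of_isolates (isolates_of_leaf_mem e.2 hk) hj.2.symm).1 hs with h | h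
          exacts [hi.1 h.symm, hj.1 h.symm]
        · intro e' _ hne
          rcases (hl0 e').eq_or_lt with h0 | h0
          · rw [← h0]; ring
          · obtain ⟨k', hk'⟩ := hiso e' h0
            have hkk : k' ≠ k := fun hkk =>
              hne (eq_of_leaf_mem (hkk ▸ hG.leaf_mem_of_isolates hdeg e'.2 hk') hk)
            have hcut : ∀ a b, a ≠ b → G.cut (e' : Sym2 V) (G.leaf a) (G.leaf b) =
                if k' = a ∨ k' = b then 1 else 0 := fun a b hab => by
              split_ifs with hs
              · exact cut_eq_one ((hG.sep_iff_of_isolates hk' hab).2 hs)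
              · exact cut_eq_zero fun h => hs ((hG.sep_iff_of_isolates hk' hab).1 h)
            rw [hcut k i hi.1.symm, hcut k j hj.1.symm, hcut i j hj.2.symm]
            by_cases h1 : k' = i <;> by_cases h2 : k' = j
            · exact absurd (h2.symm.trans h1) hj.2
            all_goals simp [hkk, h1, h2, hj.2, hj.2.symm, hi.1, hj.1]
      rw [h k i hi.1.symm, h k j hj.1.symm, h i j hj.2.symm] at h1
      have h2 : (2 : ℝ) / numLeaves G = 2 * (1 / numLeaves G) := by ring
      linarith
    · rcases (hl0 e).eq_or_lt with h0 | h0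
      · exact h0.symm
      · obtain ⟨k, hk'⟩ := hiso e h0
        exact absurd ⟨k, hG.leaf_mem_of_isolates hdeg e.2 hk'⟩ hk

lemma eq_of_isStarGraph (hG : IsStarGraph G) {v w : V} (hv : 3 ≤ G.degree v)
    (hw : 3 ≤ G.degree w) : v = w := by
  classical
  obtain ⟨c, rfl⟩ := hG
  have h : ∀ v, 3 ≤ (starGraph c).degree v → v = c := fun v hv => by
    by_contra hc
    have h1 := degree_starGraph_of_ne_center hc
    have h2 : (starGraph c).degree v = 1 := by convert h1
    omega
  rw [h v hv, h w hw]

/-- In a tree, two leaves are adjacent only if there are no other vertices. -/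
lemma IsTree.eq_or_eq_of_adj (hG : G.IsTree) {a b c : V} (hab : G.Adj a b) (ha : G.degree a = 1)
    (hb : G.degree b = 1) : c = a ∨ c = b := by
  by_contra! hc
  have h1 := sep_of_degree_eq_one ha hab hc.1
  have h2 := sep_of_degree_eq_one hb hab.symm hc.2
  rw [Sym2.eq_swap] at h2
  exact hG.not_sep_of_sep_of_sep (sep_comm.1 h1) (hG.sep_of_adj hab) (sep_comm.1 h2)

lemma IsTree.isStarGraph (hG : G.IsTree) (hm : 2 ≤ numLeaves G) (hdeg : ∀ v, G.degree v ≠ 2)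
    (h : ∀ v w, 3 ≤ G.degree v → 3 ≤ G.degree w → v = w) : IsStarGraph G := by
  have := nontrivial_of_two_le_numLeaves hm
  obtain ⟨c, hc⟩ : ∃ c, ∀ v, v ≠ c → G.degree v = 1 := by
    have hpos := fun v => hG.1.1.degree_pos_of_nontrivial v
    by_cases hex : ∃ c, 3 ≤ G.degree c
    · obtain ⟨c, hc⟩ := hex
      refine ⟨c, fun v hv => ?_⟩
      have h1 := hpos v
      have h2 := hdeg v
      have h3 : ¬ 3 ≤ G.degree v := fun h3 => hv (h v c h3 hc)
      omega
    · push Not at hex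
      refine ⟨G.leaf ⟨0, by omega⟩, fun v _ => ?_⟩
      have h1 := hpos v
      have h2 := hdeg v
      have h3 := hex v
      omega
  have hadj : ∀ a b, G.Adj a b → a = c ∨ b = c := fun a b hab => by
    by_contra! hne
    rcases hG.eq_or_eq_of_adj (c := c) hab (hc a hne.1) (hc b hne.2) with h | h
    exacts [hne.1 h.symm, hne.2 h.symm]
  have hadj' : ∀ b, b ≠ c → G.Adj b c := fun b hb => by
    obtain ⟨x, hx, -⟩ := degree_eq_one_iff_existsUnique_adj.1 (hc b hb)
    rcases hadj b x hx with h | rfl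
    exacts [absurd h hb, hx]
  refine ⟨c, ?_⟩
  ext a b
  rw [starGraph_adj]
  constructor
  · exact fun hab => ⟨hab.ne, hadj a b hab⟩
  · rintro ⟨hne, rfl | rfl⟩
    exacts [(hadj' b hne.symm).symm, hadj' a hne]

lemma isSupremizer_iff (hG : G.IsTree) (hm : 2 ≤ numLeaves G) {l : G.edgeSet → ℝ} :
    IsSupremizer G l ↔ l ∈ closure (lengthSpace G) ∧ G.IsEquidistant l := by
  constructor
  · rintro ⟨hl, hmax⟩
    refine ⟨hl, ?_⟩
    obtain ⟨l', hl', h'⟩ := hG.exists_isEquidistant_of_mem_closure hm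
    obtain ⟨h0, h1⟩ := mem_closure_lengthSpace.1 hl
    obtain ⟨h0', h1'⟩ := mem_closure_lengthSpace.1 hl'
    rw [← MetricGraph.spectralGap_ofGraph_eq_iff hG hm h0 h1]
    refine le_antisymm (MetricGraph.spectralGap_ofGraph_le hG hm h0 h1) ?_
    rw [← (MetricGraph.spectralGap_ofGraph_eq_iff hG hm h0' h1').2 h']
    exact hmax l' hl'
  · rintro ⟨hl, h⟩
    obtain ⟨h0, h1⟩ := mem_closure_lengthSpace.1 hl
    refine ⟨hl, fun l' hl' => ?_⟩
    obtain ⟨h0', h1'⟩ := mem_closure_lengthSpace.1 hl'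
    rw [(MetricGraph.spectralGap_ofGraph_eq_iff hG hm h0 h1).2 h]
    exact MetricGraph.spectralGap_ofGraph_le hG hm h0' h1'

lemma isSupremizer_and_isMaximizer_iff (hG : G.IsTree) (hm : 2 ≤ numLeaves G) {l : G.edgeSet → ℝ} :
    (IsSupremizer G l ∧ IsMaximizer G l) ↔ l ∈ lengthSpace G ∧ G.IsEquidistant l := by
  constructor
  · rintro ⟨h, h'⟩
    exact ⟨h'.1, ((isSupremizer_iff hG hm).1 h).2⟩
  · rintro ⟨hl, h⟩
    have hs := (isSupremizer_iff hG hm).2 ⟨subset_closure hl, h⟩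
    exact ⟨hs, hl, fun l' hl' => hs.2 l' (subset_closure hl')⟩

lemma exists_isSupremizer_and_isMaximizer_iff (hG : G.IsTree) (hm : 2 ≤ numLeaves G) :
    (∃ l, IsSupremizer G l ∧ IsMaximizer G l) ↔
      ∀ v w, 3 ≤ G.degree v → 3 ≤ G.degree w → v = w := by
  simp only [isSupremizer_and_isMaximizer_iff hG hm]
  constructor
  · rintro ⟨l, hl, h⟩ v w hv hw
    exact hG.eq_of_three_le_degree hm hl h hv hw
  · exact hG.exists_isEquidistant_of_mem_lengthSpace hm

end SimpleGraph

theorem theorem2p2 {V : Type*} [Fintype V] [DecidableEq V] (G : SimpleGraph V)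
    [DecidableRel G.Adj] (hG : G.IsTree) (hleaves : 2 ≤ numLeaves G) :
    -- a supremizer exists
    (∃ l, IsSupremizer G l) ∧
    -- the supremizers are exactly the realizations of the equilateral star
    (∀ l ∈ closure (lengthSpace G), IsSupremizer G l ↔
      (MetricGraph.ofGraph G l).Isometric (MetricGraph.equilateralStar (numLeaves G))) ∧
    -- the value of the supremal spectral gap
    (MetricGraph.equilateralStar (numLeaves G)).spectralGap = Real.pi / 2 * numLeaves G ∧
    (∀ l, IsSupremizer G l →
      (MetricGraph.ofGraph G l).spectralGap = Real.pi / 2 * numLeaves G) ∧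
    -- it is a maximizer exactly for stars, up to subdivision of edges
    ((∃ l, IsSupremizer G l ∧ IsMaximizer G l) ↔
      ∀ v w, 3 ≤ G.degree v → 3 ≤ G.degree w → v = w) ∧
    (IsStarGraph G → ∃ l, IsSupremizer G l ∧ IsMaximizer G l) ∧
    -- without vertices of degree two, all is literal
    ((∀ v, G.degree v ≠ 2) →
      (∃! l, IsSupremizer G l) ∧
      ((∃ l, IsSupremizer G l ∧ IsMaximizer G l) ↔ IsStarGraph G)) := by
  obtain ⟨l, hl, h⟩ := hG.exists_isEquidistant_of_mem_closure hleaves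
  have hsup := (SimpleGraph.isSupremizer_iff hG hleaves).2 ⟨hl, h⟩
  have hiff := SimpleGraph.exists_isSupremizer_and_isMaximizer_iff hG hleaves
  refine ⟨⟨l, hsup⟩, fun l' hl' => ?_, MetricGraph.spectralGap_equilateralStar hleaves,
    fun l' hl' => ?_, hiff, fun hstar => hiff.2 fun v w => SimpleGraph.eq_of_isStarGraph hstar,
    fun hdeg => ⟨⟨l, hsup, fun l' hl' => ?_⟩, hiff.trans ⟨hG.isStarGraph hleaves hdeg,
      fun hstar v w => SimpleGraph.eq_of_isStarGraph hstar⟩⟩⟩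
  · obtain ⟨h0, h1⟩ := SimpleGraph.mem_closure_lengthSpace.1 hl'
    rw [SimpleGraph.isSupremizer_iff hG hleaves, and_iff_right hl',
      MetricGraph.isometric_ofGraph_iff hG hleaves h0 h1]
  · obtain ⟨hl', h'⟩ := (SimpleGraph.isSupremizer_iff hG hleaves).1 hl'
    obtain ⟨h0, h1⟩ := SimpleGraph.mem_closure_lengthSpace.1 hl'
    exact (MetricGraph.spectralGap_ofGraph_eq_iff hG hleaves h0 h1).2 h'
  · obtain ⟨hl', h'⟩ := (SimpleGraph.isSupremizer_iff hG hleaves).1 hl'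
    exact hG.isEquidistant_unique hleaves hdeg hl' hl h' h
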